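/- **Setting.** Let $d\ge 1$, let $\Theta=\{\eta\in\mathbb{R}^d:|\eta|=1,\ \eta_1\ge 0\}$, and let $(x_i,y_i)$, $i\ge 1$, be i.i.d. copies of $(X,Y)$ from the single index model $$Y=m_0(\theta_0^\top X)+\epsilon,\qquad \mathbb{E}(\epsilon\mid X)=0\ \text{a.s.},\qquad \theta_0\in\Theta .$$ Let $\chi\subset\mathbb{R}^d$ be the support of $X$, let $D$ be the interval spanned by $\{\theta^\top x: x\in\chi,\theta\in\Theta\}$ (its convex hull; for $d\ge 2$ the set is already an interval), and let $D_0=\{\theta_0^\top x:x\in\chi\}$. Let $\mathcal{R}$ be the class of convex functions on $D$ with an absolutely continuous first derivative, and $J^2(m)=\int_D m''(t)^2\,dt\in[0,\infty]$. Given random $\hat\lambda_n\ne 0$, let $(\hat m_n,\hat\theta_n)$ be any minimizer over $(m,\theta)\in\mathcal{R}\times\Theta$ of $$\frac1n\sum_{i=1}^n\{y_i-m(\theta^\top x_i)\}^2+\hat\lambda_n^2J^2(m).$$ **Assumptions.** * (A0) $\theta_{0,1}>0$, and for some $d_1\in\{1,\dots,d\}$ the vector $(X_1,\dots,X_{d_1})$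 has a joint density with respect to Lebesgue measure and $X_{d_1+1},\dots,X_d$ are discrete. There are a nonempty open interval $\mathcal{I}$ and vectors $c_0,\dots,c_{d-d_1}\in\mathbb{R}^{d-d_1}$ such that $c_l-c_0$, $1\le l\le d-d_1$, are linearly independent and $$\mathcal{I}\subset\bigcap_{l=0}^{d-d_1}\{\theta_0^\top x:x\in\chi,\ (x_{d_1+1},\dots,x_d)=c_l\};$$ if $d_1<d$, then $m_0$ is not constant on $\mathcal{I}$. * (A1) $\chi$ is compact, with $\sup_{x\in\chi}|x|\le T<\infty$. * (A2) There is $K_1>0$ with $K_1\,\mathbb{E}[\exp(\epsilon^2/K_1)-1\mid X]\le 1$ a.s. * (A3) $\mathbb{E}[XX^\top\{m_0'(\theta_0^\top X)\}^2]$ is nonsingular. * (A4) $\mathrm{Var}(X)$ is positive definite. * (P1) $m_0\in\mathcal{R}$, $m_0$ is bounded on $D$, and $J(m_0)<\infty$. * (P2) $\hat\lambda_n^{-1}=O_p(n^{2/5})$ and $\hat\lambda_n=o_p(n^{-1/4})$. **Theorem.** Under (A0)–(A4) and (P1)–(P2), as $n\to\infty$, $$\hat\theta_n\overset{P}{\to}\theta_0,\qquad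 \sup_{t\in D_0}|\hat m_n(t)-m_0(t)|+\sup_{t\in D_0}|\hat m_n'(t)-m_0'(t)|\overset{P}{\to}0,\qquad \sup_{t\in D}|\hat m_n'(t)|=O_p(1).$$ -/

import Mathlib

open MeasureTheory ProbabilityTheory Filter Topology Set
open scoped ENNReal NNReal

noncomputable section

namespace ConvexSIM

variable {d : ℕ}

/-- The index parameter set: unit vectors of `ℝ^d` with nonnegative first coordinate. -/
def Theta (d : ℕ) [NeZero d] : Set (EuclideanSpace ℝ (Fin d)) :=
  {η | ‖η‖ = 1 ∧ 0 ≤ η 0}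

/-- The marginal law `P_X`, where `ν` is the joint law of `(X, ε)`. -/
def lawX (ν : Measure (EuclideanSpace ℝ (Fin d) × ℝ)) : Measure (EuclideanSpace ℝ (Fin d)) :=
  ν.map Prod.fst

/-- The support `χ` of `X`. -/
def supp (ν : Measure (EuclideanSpace ℝ (Fin d) × ℝ)) : Set (EuclideanSpace ℝ (Fin d)) :=
  (lawX ν).support

/-- The domain `D`: the interval spanned by `{θᵀx : x ∈ χ, θ ∈ Θ}`. For `d ≥ 2` that set is itself
an interval (it is a union of intervals containing `0`), so the convex hull only matters for
`d = 1`. -/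
def dom [NeZero d] (χ : Set (EuclideanSpace ℝ (Fin d))) : Set ℝ :=
  convexHull ℝ {t | ∃ θ ∈ Theta d, ∃ x ∈ χ, inner ℝ θ x = t}

/-- The set `D_θ = {θᵀx : x ∈ χ}`; the set `D₀` is `domAt χ θ₀`. -/
def domAt (χ : Set (EuclideanSpace ℝ (Fin d))) (θ : EuclideanSpace ℝ (Fin d)) : Set ℝ :=
  {t | ∃ x ∈ χ, inner ℝ θ x = t}

/-- The class `𝓡`: convex functions on `D` that are differentiable on `D` with an absolutely
continuous derivative (one-sided at the end points). Only the values on `D` matter. -/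
def classR (D : Set ℝ) : Set (ℝ → ℝ) :=
  {m | ConvexOn ℝ D m ∧ DifferentiableOn ℝ m D ∧
    ∀ a ∈ D, ∀ b ∈ D, AbsolutelyContinuousOnInterval (derivWithin m D) a b}

/-- The squared roughness `J²(m) = ∫_D (m'')²`, possibly `∞`. -/
def Jsq (D : Set ℝ) (m : ℝ → ℝ) : ℝ≥0∞ :=
  ∫⁻ t in D, ENNReal.ofReal ((derivWithin (derivWithin m D) D t) ^ 2)

/-- The mean squared error `Q_n(m, θ)` for the data `(x_i, y_i)`, `i < n`. -/
def Qn (n : ℕ) (x : ℕ → EuclideanSpace ℝ (Fin d)) (y : ℕ → ℝ) (m : ℝ → ℝ)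
    (θ : EuclideanSpace ℝ (Fin d)) : ℝ :=
  (1 / (n : ℝ)) * ∑ i ∈ Finset.range n, (y i - m (inner ℝ θ (x i))) ^ 2

/-- The penalized loss `Q_n(m, θ) + λ² J²(m)`. -/
def penLoss (D : Set ℝ) (n : ℕ) (x : ℕ → EuclideanSpace ℝ (Fin d)) (y : ℕ → ℝ) (lam : ℝ)
    (m : ℝ → ℝ) (θ : EuclideanSpace ℝ (Fin d)) : ℝ≥0∞ :=
  ENNReal.ofReal (Qn n x y m θ) + ENNReal.ofReal (lam ^ 2) * Jsq D m

/-- `(m, θ)` is a penalized least squares estimator (a minimizer of the penalized loss over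
`𝓡 × Θ`). -/
def IsPLSE [NeZero d] (D : Set ℝ) (n : ℕ) (x : ℕ → EuclideanSpace ℝ (Fin d)) (y : ℕ → ℝ)
    (lam : ℝ) (m : ℝ → ℝ) (θ : EuclideanSpace ℝ (Fin d)) : Prop :=
  m ∈ classR D ∧ θ ∈ Theta d ∧
    ∀ m' ∈ classR D, ∀ θ' ∈ Theta d, penLoss D n x y lam m θ ≤ penLoss D n x y lam m' θ'

/-- `sup_{t ∈ I} |g t|`, possibly `∞`. -/
def supNorm (I : Set ℝ) (g : ℝ → ℝ) : ℝ≥0∞ := ⨆ t ∈ I, ‖g t‖ₑ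

/-- The Sobolev norm `sup_I |g| + sup_I |g'|` of a function `g` that is differentiable on
`D ⊇ I`, with `g'` the derivative of `g` on `D`. -/
def sobolevNorm (D I : Set ℝ) (g : ℝ → ℝ) : ℝ≥0∞ :=
  supNorm I g + supNorm I (derivWithin g D)

/-- `Z_n = O_p(r_n)` for nonnegative `Z_n` (with outer probability if `Z_n` is not measurable). -/
def IsBigOp {Ω : Type*} [MeasurableSpace Ω] (P : Measure Ω) (Z : ℕ → Ω → ℝ≥0∞) (r : ℕ → ℝ) :
    Prop :=
  ∀ δ : ℝ≥0∞, 0 < δ → ∃ C : ℝ≥0, ∀ᶠ n in atTop,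
    P {ω | (C : ℝ≥0∞) * ENNReal.ofReal (r n) < Z n ω} ≤ δ

/-- `Z_n = o_p(r_n)` for nonnegative `Z_n` (with outer probability if `Z_n` is not measurable). -/
def IsLittleOp {Ω : Type*} [MeasurableSpace Ω] (P : Measure Ω) (Z : ℕ → Ω → ℝ≥0∞) (r : ℕ → ℝ) :
    Prop :=
  ∀ δ : ℝ≥0, 0 < δ →
    Tendsto (fun n => P {ω | (δ : ℝ≥0∞) * ENNReal.ofReal (r n) ≤ Z n ω}) atTop (𝓝 0)

/-- The first `d₁` coordinates of `x`. -/
def contPart {d₁ : ℕ} (h : d₁ ≤ d) (x : EuclideanSpace ℝ (Fin d)) : Fin d₁ → ℝ :=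
  fun i => x (Fin.castLE h i)

/-- The last `d - d₁` coordinates of `x`. -/
def discPart {d₁ : ℕ} (h : d₁ ≤ d) (x : EuclideanSpace ℝ (Fin d)) : Fin (d - d₁) → ℝ :=
  fun j => x ⟨d₁ + j, by omega⟩

/-- There are `d - d₁ + 1` affinely independent vectors `c_0, …, c_{d-d₁}` of `ℝ^{d-d₁}` such that
`I` lies in each of the sets `{θᵀx : x ∈ χ, (x_{d₁+1}, …, x_d) = c_l}`. -/
def CommonInSlices {d₁ : ℕ} (h : d₁ ≤ d) (χ : Set (EuclideanSpace ℝ (Fin d)))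
    (θ : EuclideanSpace ℝ (Fin d)) (I : Set ℝ) : Prop :=
  ∃ c : Fin (d - d₁ + 1) → (Fin (d - d₁) → ℝ),
    LinearIndependent ℝ (fun l : Fin (d - d₁) => c l.succ - c 0) ∧
    ∀ l, I ⊆ {t | ∃ x ∈ χ, discPart h x = c l ∧ inner ℝ θ x = t}

/-- (A0): identifiability. The first `d₁ ≥ 1` covariates have a joint Lebesgue density, the others
are discrete, and a nonempty open interval lies in all slices of `D₀` belonging to suitable affinely
independent values of the discrete covariates; if there are discrete covariates, `m₀` is not
constant on that interval. -/
def A0 [NeZero d] (ν : Measure (EuclideanSpace ℝ (Fin d) × ℝ)) (m₀ : ℝ → ℝ)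
    (θ₀ : EuclideanSpace ℝ (Fin d)) : Prop :=
  0 < θ₀ 0 ∧ ∃ (d₁ : ℕ) (h : d₁ ≤ d), 1 ≤ d₁ ∧
    (lawX ν).map (contPart h) ≪ volume ∧
    (∃ S : Set (Fin (d - d₁) → ℝ), S.Countable ∧ ∀ᵐ x ∂(lawX ν), discPart h x ∈ S) ∧
    ∃ a b : ℝ, a < b ∧ CommonInSlices h (supp ν) θ₀ (Ioo a b) ∧
      (d₁ < d → ∃ s ∈ Ioo a b, ∃ t ∈ Ioo a b, m₀ s ≠ m₀ t)

/-- (A1): `X` has compact support, contained in a ball of radius `T`. -/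
def A1 (ν : Measure (EuclideanSpace ℝ (Fin d) × ℝ)) : Prop :=
  IsCompact (supp ν) ∧ ∃ T : ℝ, ∀ x ∈ supp ν, ‖x‖ ≤ T

/-- (A2): conditionally on `X`, the error has mean zero and is uniformly sub-Gaussian. -/
def A2 (ν : Measure (EuclideanSpace ℝ (Fin d) × ℝ)) : Prop :=
  (∃ K : ℝ, 0 < K ∧
    Integrable (fun p : EuclideanSpace ℝ (Fin d) × ℝ => Real.exp (p.2 ^ 2 / K) - 1) ν ∧
    ∀ᵐ p ∂ν, K * (ν[fun p : EuclideanSpace ℝ (Fin d) × ℝ => Real.exp (p.2 ^ 2 / K) - 1 |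
      MeasurableSpace.comap Prod.fst inferInstance]) p ≤ 1) ∧
  Integrable (fun p : EuclideanSpace ℝ (Fin d) × ℝ => p.2) ν ∧
  ν[fun p : EuclideanSpace ℝ (Fin d) × ℝ => p.2 |
    MeasurableSpace.comap Prod.fst inferInstance] =ᵐ[ν] 0

/-- (A3): the matrix `E[X Xᵀ m₀'(θ₀ᵀX)²]` is nonsingular. -/
def A3 [NeZero d] (ν : Measure (EuclideanSpace ℝ (Fin d) × ℝ)) (m₀ : ℝ → ℝ)
    (θ₀ : EuclideanSpace ℝ (Fin d)) : Prop :=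
  IsUnit (Matrix.of fun i j : Fin d =>
    ∫ x, x i * x j * (derivWithin m₀ (dom (supp ν)) (inner ℝ θ₀ x)) ^ 2 ∂(lawX ν))

/-- (A4): the covariance matrix of `X` is positive definite. -/
def A4 (ν : Measure (EuclideanSpace ℝ (Fin d) × ℝ)) : Prop :=
  (Matrix.of fun i j : Fin d =>
    cov[fun x : EuclideanSpace ℝ (Fin d) => x i, fun x => x j; lawX ν]).PosDef

/-- (P1): `m₀` is convex with absolutely continuous derivative, bounded on `D`, and
`J(m₀) < ∞`. -/
def P1 (D : Set ℝ) (m₀ : ℝ → ℝ) : Prop :=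
  m₀ ∈ classR D ∧ (∃ M₀ : ℝ, ∀ t ∈ D, |m₀ t| ≤ M₀) ∧ Jsq D m₀ < ∞

/-- (P2): the random tuning parameters are nonzero, `λ_n⁻¹ = O_p(n^{2/5})` and
`λ_n = o_p(n^{-1/4})`. -/
def P2 {Ω : Type*} [MeasurableSpace Ω] (P : Measure Ω) (lam : ℕ → Ω → ℝ) : Prop :=
  (∀ n ω, lam n ω ≠ 0) ∧
  IsBigOp P (fun n ω => ‖(lam n ω)⁻¹‖ₑ) (fun n => (n : ℝ) ^ (2 / 5 : ℝ)) ∧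
  IsLittleOp P (fun n ω => ‖lam n ω‖ₑ) (fun n => (n : ℝ) ^ (-(1 / 4) : ℝ))

end ConvexSIM

end

/-!
The estimator is shown to lie, with probability tending to one, in a compact class of index models
in which the truth is identified; consistency then follows from a compactness argument.

*Control of the noise.* Conditionally on the design the errors are independent and sub-Gaussian, so
the projection of the error vector on a space of dimension `M` has norm of order `M^{1/2}`, up to
exponentially small probabilities (`measure_exists_span_lt_le`; the design is integrated out in
`pi_le_of_ae_pi_condDistrib_le`). A function `m` with `J(m) ≤ J` is approximated in the empirical
norm, at any design, by functions that are linear on `N` cells, with an error of order `J / N²`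
(`exists_cellVec_approx`). Dyadic chaining over `N = 2^k n^{1/5}`, together with a union bound over
the levels and over a net of the index set of polynomial size (`whp_noise`), yields, with
`μ = n^{-2/5}` and uniformly in `m` and `θ`,
`n⁻¹ ∑ᵢ εᵢ (m(θᵀxᵢ) - m₀(θ₀ᵀxᵢ)) ≤ K (μ² + μ² J(m) + μ ‖m ∘ θ - m₀ ∘ θ₀‖ₙ)`
(`edot_le_of_near`). Neither boundedness of `m` nor an entropy bound is presupposed: the slope of
`m`, which matters for passing from `θ` to the net, is bounded through the empirical variance of the
index (`SmoothOn.abs_deriv_le_of_rms`), and this variance is bounded away from zero because the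
covariance matrix of `X` is positive definite (`whp_cov`).

*Boundedness and rate.* In the basic inequality, which compares the penalized loss at the estimator
with that at the truth, this bound and `λ⁻¹ = O(n^{2/5})` give `J(m̂) = O(1)`, boundedness of `m̂` and
of its derivative, and `‖m̂ ∘ θ̂ - m₀ ∘ θ₀‖ₙ = O(λ)` (`whp_estimator_bounds`). The third claim of the
theorem is part of this.

*Consistency.* Convex functions with bounded value, derivative and roughness form a compact set for
the `C¹` norm by the Arzelà-Ascoli theorem, the derivatives being Hölder continuous of order `1/2`
(`isCompact_derivClass`). A parameter `(m, θ)` of this set that does not represent the truth has a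
neighbourhood on which the empirical distance to the truth is bounded away from zero, by the law of
large numbers. By compactness, a small empirical distance forces `(m̂, θ̂)` near the parameters that
represent the truth (`exists_whp_of_isCompact`), and for those `θ = θ₀`, and `m` and `m'` agree with
`m₀` and `m₀'` on `D₀` (`identifiability`).

*Identifiability.* If `m(θᵀX) = m₀(θ₀ᵀX)` almost surely, then differentiation in the continuous
covariates, at density points of the slices of the support, shows that the gradients agree. Hence
the continuous part of `θ` is a positive multiple of that of `θ₀`, as `m₀'(θ₀ᵀX)` does not vanish
almost surely by (A3). On the slices of the discrete covariates the index for `θ` is then a common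
multiple of that for `θ₀` up to shifts. By convexity of `m`, two different shifts would make `m₀`
constant on the interval common to the slices; so the shifts agree, and by affine independence the
discrete part of `θ` is the same multiple. Both vectors have norm one.
-/

namespace ConvexSIM

/-! ### Sub-Gaussian noise projected on a finite-dimensional space -/

/-- `κ` has Laplace transform at most that of a centred Gaussian law of variance `s`. -/
def IsSubG (s : ℝ) (κ : Measure ℝ) : Prop :=
  ∀ t : ℝ, ∫⁻ y, ENNReal.ofReal (Real.exp (t * y)) ∂κ ≤ ENNReal.ofReal (Real.exp (s * t ^ 2 / 2))

lemma lintegral_pi_prod {ι : Type*} [Fintype ι] {E : Type*} [MeasurableSpace E]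
    (κ : ι → Measure E) [∀ i, IsProbabilityMeasure (κ i)] (f : ι → E → ℝ≥0∞)
    (hf : ∀ i, Measurable (f i)) :
    ∫⁻ z, ∏ i, f i (z i) ∂(Measure.pi κ) = ∏ i, ∫⁻ y, f i y ∂(κ i) := by
  have hi : iIndepFun (fun i (z : ι → E) => f i (z i)) (Measure.pi κ) :=
    iIndepFun_pi (X := f) (fun i => (hf i).aemeasurable)
  have := lintegral_prod_eq_prod_lintegral_of_indepFun (μ := Measure.pi κ) Finset.univ
    (fun i (z : ι → E) => f i (z i)) hi (fun i => (hf i).comp (measurable_pi_apply i))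
  rw [this]
  refine Finset.prod_congr rfl fun i _ => ?_
  exact (measurePreserving_eval κ i).lintegral_comp (hf i)

lemma lintegral_exp_gaussian (t : ℝ) :
    ∫⁻ y, ENNReal.ofReal (Real.exp (t * y)) ∂(gaussianReal 0 1)
      = ENNReal.ofReal (Real.exp (t ^ 2 / 2)) := by
  rw [← ofReal_integral_eq_lintegral_ofReal (integrable_exp_mul_gaussianReal t)
    (ae_of_all _ fun y => (Real.exp_pos _).le)]
  have := congrFun (mgf_fun_id_gaussianReal (μ := 0) (v := 1)) t
  simp only [mgf] at this
  rw [this]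
  simp

lemma lintegral_exp_sq_gaussian :
    ∫⁻ y, ENNReal.ofReal (Real.exp (y ^ 2 / 4)) ∂(gaussianReal 0 1) ≤
      ENNReal.ofReal (Real.exp 1) := by
  rw [gaussianReal_of_var_ne_zero _ one_ne_zero,
    lintegral_withDensity_eq_lintegral_mul _ (measurable_gaussianPDF 0 1) (by fun_prop)]
  have h1 : ∀ y : ℝ, (gaussianPDF 0 1 * fun y => ENNReal.ofReal (Real.exp (y ^ 2 / 4))) y
      = ENNReal.ofReal ((√(2 * Real.pi))⁻¹ * Real.exp (-(1 / 4) * y ^ 2)) := by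
    intro y
    simp only [Pi.mul_apply, gaussianPDF, gaussianPDFReal]
    rw [← ENNReal.ofReal_mul (by positivity), mul_assoc, ← Real.exp_add]
    congr 2
    · simp
    · congr 1
      simp only [NNReal.coe_one]
      ring
  simp_rw [h1]
  rw [← ofReal_integral_eq_lintegral_ofReal
    ((integrable_exp_neg_mul_sq (by norm_num)).const_mul _)
    (ae_of_all _ fun y => by positivity)]
  refine ENNReal.ofReal_le_ofReal ?_
  rw [integral_const_mul, integral_gaussian, ← Real.sqrt_inv, ← Real.sqrt_mul (by positivity)]
  have : (2 * Real.pi)⁻¹ * (Real.pi / (1 / 4)) = 2 := by field_simp; norm_num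
  rw [this]
  have h2 : √2 ≤ 2 := by
    rw [Real.sqrt_le_left (by norm_num)]; norm_num
  linarith [Real.add_one_le_exp (1 : ℝ)]

/-- Gaussian decoupling: `exp (|Πe|² / (4 s))` is a Gaussian average of exponentials of linear
forms in `e`, each of which the sub-Gaussian bound controls. -/
lemma lintegral_exp_sq_proj_le {ι κ : Type*} [Fintype ι] [Fintype κ] [DecidableEq κ] {s : ℝ}
    (hs : 0 < s) (K : ι → Measure ℝ) [∀ i, IsProbabilityMeasure (K i)] (hK : ∀ i, IsSubG s (K i))
    (b : κ → ι → ℝ) (hb : ∀ j k, ∑ i, b j i * b k i = if j = k then 1 else 0) :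
    ∫⁻ e, ENNReal.ofReal (Real.exp ((∑ j, (∑ i, b j i * e i) ^ 2) / (4 * s))) ∂(Measure.pi K) ≤
      ENNReal.ofReal (Real.exp (Fintype.card κ)) := by
  classical
  -- scaled so that a standard Gaussian average of `exp (τ u t)` equals `exp (u² / (4 s))`
  set τ : ℝ := √(1 / (2 * s)) with hτ
  have hτ2 : τ ^ 2 = 1 / (2 * s) := Real.sq_sqrt (by positivity)
  set γ : Measure (κ → ℝ) := Measure.pi fun _ => gaussianReal 0 1
  have h1 : ∀ e : ι → ℝ,
      ENNReal.ofReal (Real.exp ((∑ j, (∑ i, b j i * e i) ^ 2) / (4 * s))) =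
      ∫⁻ t, ENNReal.ofReal (Real.exp (∑ j, τ * (∑ i, b j i * e i) * t j)) ∂γ := by
    intro e
    simp_rw [Real.exp_sum]
    have := lintegral_pi_prod (fun _ : κ => gaussianReal 0 1)
      (fun j y => ENNReal.ofReal (Real.exp (τ * (∑ i, b j i * e i) * y))) (fun j => by fun_prop)
    simp_rw [← ENNReal.ofReal_prod_of_nonneg (fun j _ => (Real.exp_pos _).le)] at this
    rw [this]
    simp_rw [lintegral_exp_gaussian]
    rw [← ENNReal.ofReal_prod_of_nonneg (fun j _ => (Real.exp_pos _).le), ← Real.exp_sum]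
    congr 2
    rw [Finset.sum_div]
    refine Finset.sum_congr rfl fun j _ => ?_
    rw [mul_pow, hτ2]
    field_simp
    norm_num
  simp_rw [h1]
  rw [lintegral_lintegral_swap (by fun_prop)]
  have h2 : ∀ t : κ → ℝ,
      ∫⁻ e, ENNReal.ofReal (Real.exp (∑ j, τ * (∑ i, b j i * e i) * t j)) ∂(Measure.pi K) ≤
        ∏ j, ENNReal.ofReal (Real.exp (t j ^ 2 / 4)) := by
    intro t
    have e1 : ∀ e : ι → ℝ, ∑ j, τ * (∑ i, b j i * e i) * t j
        = ∑ i, (τ * ∑ j, t j * b j i) * e i := by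
      intro e
      simp_rw [Finset.mul_sum, Finset.sum_mul]
      rw [Finset.sum_comm]
      exact Finset.sum_congr rfl fun _ _ => Finset.sum_congr rfl fun _ _ => by ring
    simp_rw [e1, Real.exp_sum]
    have := lintegral_pi_prod K
      (fun i y => ENNReal.ofReal (Real.exp ((τ * ∑ j, t j * b j i) * y))) (fun j => by fun_prop)
    simp_rw [← ENNReal.ofReal_prod_of_nonneg (fun j _ => (Real.exp_pos _).le)] at this
    rw [this, ← ENNReal.ofReal_prod_of_nonneg (fun j _ => (Real.exp_pos _).le), ← Real.exp_sum]
    refine (Finset.prod_le_prod' fun i _ => hK i _).trans_eq ?_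
    rw [← ENNReal.ofReal_prod_of_nonneg (fun j _ => (Real.exp_pos _).le), ← Real.exp_sum]
    congr 2
    have e2 : ∑ i, (∑ j, t j * b j i) ^ 2 = ∑ j, t j ^ 2 := by
      calc ∑ i, (∑ j, t j * b j i) ^ 2 = ∑ i, ∑ j, ∑ k, t j * t k * (b j i * b k i) := by
            refine Finset.sum_congr rfl fun i _ => ?_
            rw [sq, Finset.sum_mul_sum]
            exact Finset.sum_congr rfl fun _ _ => Finset.sum_congr rfl fun _ _ => by ring
        _ = ∑ j, ∑ k, t j * t k * ∑ i, b j i * b k i := by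
            rw [Finset.sum_comm]
            refine Finset.sum_congr rfl fun j _ => ?_
            rw [Finset.sum_comm]
            simp_rw [Finset.mul_sum]
        _ = ∑ j, t j ^ 2 := by simp [hb, sq]
    simp_rw [mul_pow, hτ2]
    rw [← Finset.sum_div, ← Finset.sum_div, ← Finset.mul_sum, ← Finset.mul_sum, e2]
    field_simp
    ring
  refine (lintegral_mono h2).trans ?_
  rw [lintegral_pi_prod (fun _ : κ => gaussianReal 0 1)
    (fun _ y => ENNReal.ofReal (Real.exp (y ^ 2 / 4))) (fun j => by fun_prop)]
  refine (Finset.prod_le_prod' fun j _ => lintegral_exp_sq_gaussian).trans_eq ?_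
  rw [Finset.prod_const, ← ENNReal.ofReal_pow (Real.exp_pos _).le, ← Real.exp_nat_mul]
  simp

/-- Fixed design: the sub-Gaussian noise has inner product at most `r |v|` with every element `v`
of a space spanned by `M` vectors, except with probability `exp (M - r² / (4 s))`. -/
lemma measure_exists_span_lt_le {ι κ : Type*} [Fintype ι] [Fintype κ] {s : ℝ} (hs : 0 < s)
    (K : ι → Measure ℝ) [∀ i, IsProbabilityMeasure (K i)] (hK : ∀ i, IsSubG s (K i))
    (w : κ → ι → ℝ) {r : ℝ} (hr : 0 ≤ r) :
    Measure.pi K {e | ∃ q : κ → ℝ,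
      r * √(∑ i, (∑ j, q j * w j i) ^ 2) < ∑ i, e i * ∑ j, q j * w j i} ≤
      ENNReal.ofReal (Real.exp (Fintype.card κ - r ^ 2 / (4 * s))) := by
  classical
  let W : κ → EuclideanSpace ℝ ι := fun j => WithLp.toLp 2 (w j)
  let V : Submodule ℝ (EuclideanSpace ℝ ι) := Submodule.span ℝ (Set.range W)
  let b := stdOrthonormalBasis ℝ V
  have hcard : Module.finrank ℝ V ≤ Fintype.card κ := finrank_range_le_card W
  let B : Fin (Module.finrank ℝ V) → ι → ℝ := fun j i => (b j : EuclideanSpace ℝ ι) i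
  have hB : ∀ j k, ∑ i, B j i * B k i = if j = k then 1 else 0 := by
    intro j k
    have := orthonormal_iff_ite.1 b.orthonormal k j
    rw [Submodule.coe_inner, PiLp.inner_apply] at this
    simp only [RCLike.inner_apply, conj_trivial] at this
    rw [this]
    simp [eq_comm]
  have hexp := lintegral_exp_sq_proj_le hs K hK B hB
  set F : (ι → ℝ) → ℝ := fun e => ∑ j, (∑ i, B j i * e i) ^ 2 with hF
  have hsub : {e : ι → ℝ | ∃ q : κ → ℝ,
      r * √(∑ i, (∑ j, q j * w j i) ^ 2) < ∑ i, e i * ∑ j, q j * w j i} ⊆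
      {e | ENNReal.ofReal (Real.exp (r ^ 2 / (4 * s))) ≤
        ENNReal.ofReal (Real.exp (F e / (4 * s)))} := by
    rintro e ⟨q, hq⟩
    refine ENNReal.ofReal_le_ofReal (Real.exp_le_exp.2 ?_)
    refine div_le_div_of_nonneg_right ?_ (by positivity)
    let v : V := ⟨∑ j, q j • W j, Submodule.sum_mem _ fun j _ => Submodule.smul_mem _ _
      (Submodule.subset_span ⟨j, rfl⟩)⟩
    have hvi : ∀ i, (v : EuclideanSpace ℝ ι) i = ∑ j, q j * w j i := by
      intro i
      simp [v, W]
    let c : Fin (Module.finrank ℝ V) → ℝ := fun j => b.repr v j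
    have hv : ∀ i, ∑ j, q j * w j i = ∑ j, c j * B j i := by
      intro i
      rw [← hvi]
      have := congrArg (fun u : V => (u : EuclideanSpace ℝ ι) i) (b.sum_repr v)
      simp only at this
      rw [← this]
      simp [c, B]
    have hin : ∑ i, e i * ∑ j, q j * w j i = ∑ j, c j * ∑ i, B j i * e i := by
      simp_rw [hv, Finset.mul_sum]
      rw [Finset.sum_comm]
      exact Finset.sum_congr rfl fun _ _ => Finset.sum_congr rfl fun _ _ => by ring
    have hnorm : ∑ i, (∑ j, q j * w j i) ^ 2 = ∑ j, c j ^ 2 := by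
      have h1 : ‖v‖ ^ 2 = ∑ i, (∑ j, q j * w j i) ^ 2 := by
        rw [Submodule.coe_norm, EuclideanSpace.norm_sq_eq]
        simp [hvi]
      have h2 : ‖v‖ ^ 2 = ∑ j, c j ^ 2 := by
        rw [← b.repr.norm_map v, EuclideanSpace.norm_sq_eq]
        simp [c]
      rw [← h1, h2]
    rw [hin, hnorm] at hq
    have hcs := Finset.sum_mul_sq_le_sq_mul_sq Finset.univ c (fun j => ∑ i, B j i * e i)
    have hc0 : 0 ≤ ∑ j, c j ^ 2 := Finset.sum_nonneg fun _ _ => sq_nonneg _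
    have hq2 : (r * √(∑ j, c j ^ 2)) ^ 2 < (∑ j, c j * ∑ i, B j i * e i) ^ 2 :=
      pow_lt_pow_left₀ hq (by positivity) (by norm_num)
    rw [mul_pow, Real.sq_sqrt hc0] at hq2
    have hlt : (∑ j, c j ^ 2) * r ^ 2 < (∑ j, c j ^ 2) * F e := by
      rw [mul_comm _ (r ^ 2)]
      exact hq2.trans_le hcs
    exact (lt_of_mul_lt_mul_left hlt hc0).le
  refine (measure_mono hsub).trans ?_
  have hpos : 0 < Real.exp (r ^ 2 / (4 * s)) := Real.exp_pos _
  refine (meas_ge_le_lintegral_div (by fun_prop) (by simpa using hpos) (by simp)).trans ?_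
  refine (ENNReal.div_le_div_right hexp _).trans ?_
  rw [← ENNReal.ofReal_div_of_pos hpos, ← Real.exp_sub]
  refine ENNReal.ofReal_le_ofReal (Real.exp_le_exp.2 ?_)
  have : (Module.finrank ℝ V : ℝ) ≤ Fintype.card κ := by exact_mod_cast hcard
  simp only [Fintype.card_fin]
  linarith

/-! ### Conditionally sub-Gaussian noise over a random design -/

lemma exp_le_add_exp_sq (x : ℝ) : Real.exp x ≤ x + Real.exp (x ^ 2) := by
  rcases le_or_gt |x| 1 with h | h
  · have h1 := (abs_le.1 (Real.abs_exp_sub_one_sub_id_le h)).2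
    have h2 := Real.add_one_le_exp (x ^ 2)
    linarith
  · rcases le_or_gt 0 x with h0 | h0
    · rw [abs_of_nonneg h0] at h
      have : Real.exp x ≤ Real.exp (x ^ 2) := Real.exp_le_exp.2 (by nlinarith)
      linarith
    · rw [abs_of_neg h0] at h
      have h1 : Real.exp x ≤ 1 := Real.exp_le_one_iff.2 h0.le
      have h2 := Real.add_one_le_exp (x ^ 2)
      nlinarith

/-- A centred law with an exponential square moment is sub-Gaussian. -/
lemma isSubG_of_exp_sq_moment {K : ℝ} (hK : 0 < K) (κ : Measure ℝ) [IsProbabilityMeasure κ]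
    (h1 : Integrable (fun y : ℝ => Real.exp (y ^ 2 / K) - 1) κ)
    (h2 : K * ∫ y, (Real.exp (y ^ 2 / K) - 1) ∂κ ≤ 1)
    (h3 : Integrable (fun y : ℝ => y) κ) (h4 : ∫ y, y ∂κ = 0) : IsSubG (2 * (1 + K)) κ := by
  have h2' : ∫ y, (Real.exp (y ^ 2 / K) - 1) ∂κ ≤ 1 / K := by
    rw [le_div_iff₀ hK]; linarith
  have hconv : ∀ ρ : ℝ, 0 ≤ ρ → ρ ≤ 1 → ∀ z : ℝ,
      Real.exp (ρ * z) ≤ 1 + ρ * (Real.exp z - 1) := by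
    intro ρ h0 h1 z
    have := convexOn_exp.2 (mem_univ z) (mem_univ (0 : ℝ)) h0 (sub_nonneg.2 h1) (by ring)
    simp only [smul_eq_mul, mul_zero, add_zero, Real.exp_zero] at this
    linarith
  intro t
  -- for small `t`, compare `exp (t y)` with `t y + exp (t² y²)`, which uses the zero mean; for
  -- large `t`, separate `t` and `y` by the inequality of the arithmetic and geometric means
  rcases le_or_gt (t ^ 2 * K) 1 with ht | ht
  · have hpt : ∀ y : ℝ, Real.exp (t * y) ≤
        t * y + (1 + (t ^ 2 * K) * (Real.exp (y ^ 2 / K) - 1)) := by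
      intro y
      refine (exp_le_add_exp_sq _).trans ?_
      have := hconv (t ^ 2 * K) (by positivity) ht (y ^ 2 / K)
      have e : t ^ 2 * K * (y ^ 2 / K) = (t * y) ^ 2 := by field_simp
      rw [e] at this
      linarith
    have hint1 : Integrable (fun y : ℝ => 1 + (t ^ 2 * K) * (Real.exp (y ^ 2 / K) - 1)) κ :=
      (integrable_const 1).add (h1.const_mul _)
    have hint : Integrable (fun y : ℝ =>
        t * y + (1 + (t ^ 2 * K) * (Real.exp (y ^ 2 / K) - 1))) κ :=
      (h3.const_mul t).add hint1
    refine (lintegral_mono fun y => ENNReal.ofReal_le_ofReal (hpt y)).trans ?_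
    rw [← ofReal_integral_eq_lintegral_ofReal hint
      (ae_of_all _ fun y => (Real.exp_pos _).le.trans (hpt y))]
    refine ENNReal.ofReal_le_ofReal ?_
    rw [integral_add (h3.const_mul t) hint1,
      integral_add (integrable_const 1) (h1.const_mul _), integral_const_mul, integral_const_mul,
      h4]
    simp only [integral_const, probReal_univ, smul_eq_mul, mul_one, mul_zero, zero_add]
    have e1 : t ^ 2 * K * ∫ y, (Real.exp (y ^ 2 / K) - 1) ∂κ ≤ t ^ 2 := by
      rw [mul_assoc]; exact mul_le_of_le_one_right (sq_nonneg t) h2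
    have e2 := Real.add_one_le_exp (t ^ 2)
    have e3 : Real.exp (t ^ 2) ≤ Real.exp (2 * (1 + K) * t ^ 2 / 2) :=
      Real.exp_le_exp.2 (by nlinarith [sq_nonneg t])
    linarith
  · have hpt : ∀ y : ℝ, Real.exp (t * y) ≤
        Real.exp (t ^ 2 * K / 2) * (1 + (1 / 2) * (Real.exp (y ^ 2 / K) - 1)) := by
      intro y
      have h5 := hconv (1 / 2) (by norm_num) (by norm_num) (y ^ 2 / K)
      have h6 : t * y ≤ t ^ 2 * K / 2 + 1 / 2 * (y ^ 2 / K) := by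
        have h7 : 0 ≤ (t * K - y) ^ 2 / K := by positivity
        have h8 : (t * K - y) ^ 2 / K = t ^ 2 * K - 2 * (t * y) + y ^ 2 / K := by
          field_simp; ring
        linarith
      calc Real.exp (t * y) ≤ Real.exp (t ^ 2 * K / 2 + 1 / 2 * (y ^ 2 / K)) :=
            Real.exp_le_exp.2 h6
        _ = Real.exp (t ^ 2 * K / 2) * Real.exp (1 / 2 * (y ^ 2 / K)) := Real.exp_add _ _
        _ ≤ _ := mul_le_mul_of_nonneg_left h5 (Real.exp_pos _).le
    have hint : Integrable (fun y : ℝ =>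
        Real.exp (t ^ 2 * K / 2) * (1 + (1 / 2) * (Real.exp (y ^ 2 / K) - 1))) κ :=
      ((integrable_const 1).add (h1.const_mul _)).const_mul _
    refine (lintegral_mono fun y => ENNReal.ofReal_le_ofReal (hpt y)).trans ?_
    rw [← ofReal_integral_eq_lintegral_ofReal hint
      (ae_of_all _ fun y => (Real.exp_pos _).le.trans (hpt y))]
    refine ENNReal.ofReal_le_ofReal ?_
    rw [integral_const_mul, integral_add (integrable_const 1) (h1.const_mul _),
      integral_const_mul]
    simp only [integral_const, probReal_univ, smul_eq_mul, mul_one]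
    have e1 : 1 / K ≤ t ^ 2 := by rw [div_le_iff₀ hK]; exact ht.le
    have e2 := Real.add_one_le_exp (t ^ 2 / 2)
    calc Real.exp (t ^ 2 * K / 2) * (1 + 1 / 2 * ∫ y, (Real.exp (y ^ 2 / K) - 1) ∂κ)
        ≤ Real.exp (t ^ 2 * K / 2) * Real.exp (t ^ 2 / 2) :=
          mul_le_mul_of_nonneg_left (by linarith) (Real.exp_pos _).le
      _ = Real.exp (t ^ 2 * K / 2 + t ^ 2 / 2) := (Real.exp_add _ _).symm
      _ ≤ _ := Real.exp_le_exp.2 (by nlinarith [sq_nonneg t])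

/-- The conditional moment assumptions on the errors, restated for the regular conditional laws. -/
lemma A2.ae_isSubG {d : ℕ} {ν : Measure (EuclideanSpace ℝ (Fin d) × ℝ)} [IsProbabilityMeasure ν]
    (h : A2 ν) : ∃ s : ℝ, 0 < s ∧
      ∀ᵐ x ∂(lawX ν), IsSubG s (condDistrib (Prod.snd : EuclideanSpace ℝ (Fin d) × ℝ → ℝ)
        Prod.fst ν x) := by
  obtain ⟨⟨K, hK, hi, hb⟩, hi1, hm⟩ := h
  refine ⟨2 * (1 + K), by positivity, ?_⟩
  set κ := condDistrib (Prod.snd : EuclideanSpace ℝ (Fin d) × ℝ → ℝ) Prod.fst ν with hκ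
  have hid : ν.map (fun p : EuclideanSpace ℝ (Fin d) × ℝ => (p.1, p.2)) = ν := Measure.map_id
  have i1 : ∀ᵐ x ∂(lawX ν), Integrable (fun y : ℝ => Real.exp (y ^ 2 / K) - 1) (κ x) :=
    Integrable.condDistrib_ae_map (f := fun p : EuclideanSpace ℝ (Fin d) × ℝ =>
      Real.exp (p.2 ^ 2 / K) - 1) measurable_snd.aemeasurable (by rwa [hid])
  have i2 : ∀ᵐ x ∂(lawX ν), Integrable (fun y : ℝ => y) (κ x) :=
    Integrable.condDistrib_ae_map (f := fun p : EuclideanSpace ℝ (Fin d) × ℝ => p.2)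
      measurable_snd.aemeasurable (by rwa [hid])
  have c1 := condExp_ae_eq_integral_condDistrib (μ := ν)
    (measurable_fst : Measurable (Prod.fst : EuclideanSpace ℝ (Fin d) × ℝ → _))
    (measurable_snd : Measurable (Prod.snd : EuclideanSpace ℝ (Fin d) × ℝ → _)).aemeasurable
    (f := fun y : ℝ => Real.exp (y ^ 2 / K) - 1)
    (by exact (by fun_prop : Measurable fun y : ℝ => Real.exp (y ^ 2 / K) - 1).stronglyMeasurable)
    hi
  have c2 := condExp_ae_eq_integral_condDistrib (μ := ν)
    (measurable_fst : Measurable (Prod.fst : EuclideanSpace ℝ (Fin d) × ℝ → _))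
    (measurable_snd : Measurable (Prod.snd : EuclideanSpace ℝ (Fin d) × ℝ → _)).aemeasurable
    (f := fun y : ℝ => y) stronglyMeasurable_id hi1
  have m1 : Measurable fun x => ∫ y, (Real.exp (y ^ 2 / K) - 1) ∂κ x :=
    (StronglyMeasurable.integral_kernel (κ := κ) (f := fun y : ℝ => Real.exp (y ^ 2 / K) - 1)
    (by fun_prop : Measurable fun y : ℝ => Real.exp (y ^ 2 / K) - 1).stronglyMeasurable).measurable
  have m2 : Measurable fun x => ∫ y, y ∂κ x :=
    (StronglyMeasurable.integral_kernel (κ := κ) (f := fun y : ℝ => y)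
      stronglyMeasurable_id).measurable
  have j1 : ∀ᵐ x ∂(lawX ν), K * ∫ y, (Real.exp (y ^ 2 / K) - 1) ∂κ x ≤ 1 := by
    rw [lawX, ae_map_iff measurable_fst.aemeasurable
      (measurableSet_le (m1.const_mul K) measurable_const)]
    filter_upwards [hb, c1] with p hp hc
    rwa [hc] at hp
  have j2 : ∀ᵐ x ∂(lawX ν), ∫ y, y ∂κ x = 0 := by
    rw [lawX, ae_map_iff measurable_fst.aemeasurable (measurableSet_eq_fun m2 measurable_const)]
    filter_upwards [hm, c2] with p hp hc
    rwa [hc] at hp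
  filter_upwards [i1, i2, j1, j2] with x a1 a2 a3 a4
  exact isSubG_of_exp_sq_moment hK _ a1 a3 a2 a4

/-- Conditioning on the design: an event whose conditional probability given the design is at most
`δ` has probability at most `δ`. The conditional laws are realised as images of independent uniform
variables, which turns the statement into Tonelli's theorem. -/
lemma pi_le_of_ae_pi_condDistrib_le {E ι : Type*} [MeasurableSpace E] [Fintype ι]
    (ν : Measure (E × ℝ)) [IsProbabilityMeasure ν] {A : Set (ι → E × ℝ)} (hA : MeasurableSet A)
    {δ : ℝ≥0∞}
    (h : ∀ᵐ x ∂(Measure.pi fun _ : ι => ν.map Prod.fst),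
      Measure.pi (fun i => condDistrib (Prod.snd : E × ℝ → ℝ) Prod.fst ν (x i))
        {e | (fun i => (x i, e i)) ∈ A} ≤ δ) :
    Measure.pi (fun _ : ι => ν) A ≤ δ := by
  set κ := condDistrib (Prod.snd : E × ℝ → ℝ) Prod.fst ν with hκ
  set μ := ν.map Prod.fst with hμ
  have : IsProbabilityMeasure μ :=
    Measure.isProbabilityMeasure_map measurable_fst.aemeasurable
  obtain ⟨f, hf, hfκ⟩ := Kernel.exists_measurable_map_eq_unitInterval κ
  let Φ : E × unitInterval → E × ℝ := fun p => (p.1, f p.1 p.2)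
  have hΦ : Measurable Φ := measurable_fst.prodMk hf
  have hν : (μ.prod volume).map Φ = ν := by
    have h1 : μ ⊗ₘ κ = ν := by
      rw [hμ, hκ, compProd_map_condDistrib measurable_snd.aemeasurable]
      exact Measure.map_id
    rw [← h1]
    ext S hS
    rw [Measure.map_apply hΦ hS, Measure.prod_apply (hΦ hS), Measure.compProd_apply hS]
    refine lintegral_congr fun x => ?_
    rw [← hfκ x, Measure.map_apply (by fun_prop) (measurable_prodMk_left hS)]
    rfl
  have hpi : Measure.pi (fun _ : ι => ν) =
      (Measure.pi fun _ : ι => μ.prod volume).map (fun z i => Φ (z i)) := by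
    have : IsProbabilityMeasure ((μ.prod volume).map Φ) := by rw [hν]; infer_instance
    rw [Measure.pi_map_pi (fun _ => hΦ.aemeasurable)]
    simp_rw [hν]
  have hΨ : Measurable fun (z : ι → E × unitInterval) i => Φ (z i) := by fun_prop
  have mp := (measurePreserving_arrowProdEquivProdArrow E unitInterval ι (fun _ => μ)
    (fun _ => volume)).symm
  have hS := hΨ hA
  rw [hpi, Measure.map_apply hΨ hA, ← mp.measure_preimage hS.nullMeasurableSet,
    Measure.prod_apply (mp.measurable hS)]
  calc _ ≤ ∫⁻ _, δ ∂(Measure.pi fun _ : ι => μ) := by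
        refine lintegral_mono_ae ?_
        filter_upwards [h] with x hx
        refine le_trans (le_of_eq ?_) hx
        have hfx : ∀ i, Measurable (f (x i)) := fun i => by fun_prop
        have hP : ∀ i, IsProbabilityMeasure ((volume : Measure unitInterval).map (f (x i))) :=
          fun i => Measure.isProbabilityMeasure_map (hfx i).aemeasurable
        simp_rw [← hfκ]
        rw [← Measure.pi_map_pi (fun i => (hfx i).aemeasurable), Measure.map_apply]
        · rfl
        · fun_prop
        · exact measurableSet_preimage (by fun_prop) hA
    _ = δ := by simp

/-- The tail bound of `measure_exists_span_lt_le` for vectors `w j` that depend on the design. -/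
lemma measure_pi_exists_span_lt_le {d : ℕ} {ι κ : Type*} [Fintype ι] [Fintype κ] {s : ℝ}
    (hs : 0 < s) (ν : Measure (EuclideanSpace ℝ (Fin d) × ℝ)) [IsProbabilityMeasure ν]
    (hν : ∀ᵐ x ∂(lawX ν), IsSubG s (condDistrib (Prod.snd : EuclideanSpace ℝ (Fin d) × ℝ → ℝ)
        Prod.fst ν x))
    (w : κ → (ι → EuclideanSpace ℝ (Fin d)) → ι → ℝ) (hw : ∀ j i, Measurable fun x => w j x i)
    {r : ℝ} (hr : 0 ≤ r) :
    Measure.pi (fun _ : ι => ν) {z | ∃ q : κ → ℝ,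
      r * √(∑ i, (∑ j, q j * w j (fun i => (z i).1) i) ^ 2) <
        ∑ i, (z i).2 * ∑ j, q j * w j (fun i => (z i).1) i} ≤
      ENNReal.ofReal (Real.exp (Fintype.card κ - r ^ 2 / (4 * s))) := by
  have hprob : IsProbabilityMeasure (lawX ν) :=
    Measure.isProbabilityMeasure_map measurable_fst.aemeasurable
  refine pi_le_of_ae_pi_condDistrib_le ν ?_ ?_
  · -- by continuity in `q` it suffices to consider countably many `q`
    have heq : {z : ι → EuclideanSpace ℝ (Fin d) × ℝ | ∃ q : κ → ℝ,
        r * √(∑ i, (∑ j, q j * w j (fun i => (z i).1) i) ^ 2) <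
          ∑ i, (z i).2 * ∑ j, q j * w j (fun i => (z i).1) i} =
        ⋃ k : ℕ, {z | r * √(∑ i, (∑ j, TopologicalSpace.denseSeq (κ → ℝ) k j *
            w j (fun i => (z i).1) i) ^ 2) <
          ∑ i, (z i).2 * ∑ j, TopologicalSpace.denseSeq (κ → ℝ) k j *
            w j (fun i => (z i).1) i} := by
      ext z
      simp only [mem_ofPred_eq, mem_iUnion]
      constructor
      · rintro ⟨q, hq⟩
        have ho : IsOpen {q : κ → ℝ | r * √(∑ i, (∑ j, q j * w j (fun i => (z i).1) i) ^ 2) <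
            ∑ i, (z i).2 * ∑ j, q j * w j (fun i => (z i).1) i} :=
          isOpen_lt (by fun_prop) (by fun_prop)
        obtain ⟨_, h1, ⟨k, rfl⟩⟩ :=
          (TopologicalSpace.denseRange_denseSeq (κ → ℝ)).inter_open_nonempty _ ho ⟨q, hq⟩
        exact ⟨k, h1⟩
      · rintro ⟨k, hk⟩
        exact ⟨_, hk⟩
    rw [heq]
    have hw' : ∀ j i, Measurable fun z : ι → EuclideanSpace ℝ (Fin d) × ℝ =>
        w j (fun i => (z i).1) i := fun j i => (hw j i).comp (by fun_prop)
    refine MeasurableSet.iUnion fun k => measurableSet_lt ?_ ?_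
    · refine (Measurable.sqrt ?_).const_mul r
      exact Finset.measurable_sum _ fun i _ =>
        (Finset.measurable_sum _ fun j _ => (hw' j i).const_mul _).pow_const 2
    · exact Finset.measurable_sum _ fun i _ =>
        (by fun_prop : Measurable fun z : ι → EuclideanSpace ℝ (Fin d) × ℝ => (z i).2).mul
          (Finset.measurable_sum _ fun j _ => (hw' j i).const_mul _)
  · have hall : ∀ᵐ x ∂(Measure.pi fun _ : ι => lawX ν), ∀ i, IsSubG s
        (condDistrib (Prod.snd : EuclideanSpace ℝ (Fin d) × ℝ → ℝ) Prod.fst ν (x i)) :=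
      ae_all_iff.2 fun i => (Measure.quasiMeasurePreserving_eval (fun _ : ι => lawX ν) i).ae hν
    filter_upwards [hall] with x hx
    exact measure_exists_span_lt_le hs _ hx (fun j => w j x) hr

/-! ### Functions with a square integrable second derivative -/

lemma lintegral_sq_le_mul {α : Type*} [MeasurableSpace α] (μ : Measure α) {f : α → ℝ≥0∞}
    (hf : AEMeasurable f μ) : (∫⁻ x, f x ∂μ) ^ 2 ≤ μ univ * ∫⁻ x, f x ^ 2 ∂μ := by
  have h := ENNReal.lintegral_mul_le_Lp_mul_Lq μ Real.HolderConjugate.two_two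
    (f := fun _ => 1) (g := f) aemeasurable_const hf
  simp only [Pi.mul_apply, one_mul, ENNReal.one_rpow, lintegral_const] at h
  calc (∫⁻ x, f x ∂μ) ^ 2 ≤ (μ univ ^ (1 / 2 : ℝ) * (∫⁻ x, f x ^ (2 : ℝ) ∂μ) ^ (1 / 2 : ℝ)) ^ 2 :=
        pow_le_pow_left' h 2
    _ = μ univ * ∫⁻ x, f x ^ 2 ∂μ := by
        rw [mul_pow, ← ENNReal.rpow_natCast, ← ENNReal.rpow_natCast, ← ENNReal.rpow_mul,
          ← ENNReal.rpow_mul]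
        norm_num

/-- `m` is differentiable on `[a, b]` with derivative `p`, and the increments of `p` are controlled
by `q`, which stands for the square of the second derivative of `m`. -/
structure SmoothOn (a b : ℝ) (m p : ℝ → ℝ) (q : ℝ → ℝ≥0∞) : Prop where
  meas : Measurable q
  deriv : ∀ t ∈ Icc a b, HasDerivWithinAt m (p t) (Icc a b) t
  incr : ∀ s t, a ≤ s → s ≤ t → t ≤ b →
    ENNReal.ofReal ((p t - p s) ^ 2) ≤ ENNReal.ofReal (t - s) * ∫⁻ u in Ioo s t, q u

/-- The derivative is the integral of the second derivative, so the Cauchy-Schwarz inequality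
bounds its increments. -/
lemma classR.exists_smoothOn {a b : ℝ} {m : ℝ → ℝ} (hm : m ∈ classR (Icc a b)) :
    ∃ q : ℝ → ℝ≥0∞, SmoothOn a b m (derivWithin m (Icc a b)) q ∧
      ∫⁻ u in Icc a b, q u = Jsq (Icc a b) m := by
  set p := derivWithin m (Icc a b) with hp
  refine ⟨fun t => ENNReal.ofReal ((deriv p t) ^ 2), ⟨?_, ?_, ?_⟩, ?_⟩
  · exact ((measurable_deriv p).pow_const 2).ennreal_ofReal
  · intro t ht
    exact (hm.2.1 t ht).hasDerivWithinAt
  · intro s t hs hst ht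
    have hac := hm.2.2 s ⟨hs, hst.trans ht⟩ t ⟨hs.trans hst, ht⟩
    rw [← hac.integral_deriv_eq_sub, intervalIntegral.integral_of_le hst,
      integral_Ioc_eq_integral_Ioo]
    have h1 : ENNReal.ofReal ((∫ u in Ioo s t, deriv p u) ^ 2) ≤
        (∫⁻ u in Ioo s t, ‖deriv p u‖ₑ) ^ 2 := by
      rw [← sq_abs, ENNReal.ofReal_pow (abs_nonneg _), ← Real.enorm_eq_ofReal_abs]
      exact pow_le_pow_left' (enorm_integral_le_lintegral_enorm _) 2
    refine h1.trans ((lintegral_sq_le_mul _ ?_).trans_eq ?_)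
    · exact (measurable_deriv p).enorm.aemeasurable
    · congr 1
      · simp
      · refine lintegral_congr fun u => ?_
        rw [← sq_abs, ENNReal.ofReal_pow (abs_nonneg _), ← Real.enorm_eq_ofReal_abs]
  · rw [Jsq, setLIntegral_congr Ioo_ae_eq_Icc.symm, setLIntegral_congr Ioo_ae_eq_Icc.symm]
    refine setLIntegral_congr_fun measurableSet_Ioo fun t ht => ?_
    rw [derivWithin_of_mem_nhds (Icc_mem_nhds ht.1 ht.2)]

namespace SmoothOn

variable {a b : ℝ} {m p : ℝ → ℝ} {q : ℝ → ℝ≥0∞}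

/-- The derivative is Hölder continuous of order `1/2`. -/
lemma sq_sub_le (h : SmoothOn a b m p q) {J : ℝ}
    (hJ : ∫⁻ u in Icc a b, q u ≤ ENNReal.ofReal (J ^ 2))
    {s t : ℝ} (hs : s ∈ Icc a b) (ht : t ∈ Icc a b) : (p t - p s) ^ 2 ≤ |t - s| * J ^ 2 := by
  wlog hst : s ≤ t generalizing s t
  · rw [abs_sub_comm, ← neg_sub (p s), neg_sq]
    exact this ht hs (le_of_not_ge hst)
  have h1 := h.incr s t hs.1 hst ht.2
  rw [abs_of_nonneg (sub_nonneg.2 hst)]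
  have h2 : ∫⁻ u in Ioo s t, q u ≤ ENNReal.ofReal (J ^ 2) :=
    (lintegral_mono_set (Ioo_subset_Icc_self.trans (Icc_subset_Icc hs.1 ht.2))).trans hJ
  have h3 := h1.trans (mul_le_mul_right h2 _)
  rw [← ENNReal.ofReal_mul (sub_nonneg.2 hst)] at h3
  exact (ENNReal.ofReal_le_ofReal_iff (mul_nonneg (sub_nonneg.2 hst) (sq_nonneg J))).1 h3

lemma abs_sub_le (h : SmoothOn a b m p q) {J : ℝ} (hJ0 : 0 ≤ J)
    (hJ : ∫⁻ u in Icc a b, q u ≤ ENNReal.ofReal (J ^ 2))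
    {s t : ℝ} (hs : s ∈ Icc a b) (ht : t ∈ Icc a b) : |p t - p s| ≤ √(b - a) * J := by
  have h1 := h.sq_sub_le hJ hs ht
  have h2 : |t - s| ≤ b - a := abs_sub_le_iff.2 ⟨by linarith [hs.1, ht.2], by linarith [ht.1, hs.2]⟩
  have hba : 0 ≤ b - a := (abs_nonneg _).trans h2
  refine abs_le_of_sq_le_sq ?_ (by positivity)
  rw [mul_pow, Real.sq_sqrt hba]
  exact h1.trans (mul_le_mul_of_nonneg_right h2 (sq_nonneg J))

lemma abs_taylor_le (h : SmoothOn a b m p q) {J : ℝ} (hJ0 : 0 ≤ J)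
    (hJ : ∫⁻ u in Icc a b, q u ≤ ENNReal.ofReal (J ^ 2))
    {s t : ℝ} (hs : s ∈ Icc a b) (ht : t ∈ Icc a b) :
    |m t - m s - p s * (t - s)| ≤ √(b - a) * J * |t - s| := by
  have hd : ∀ u ∈ Icc a b, HasDerivWithinAt (fun u => m u - p s * u) (p u - p s) (Icc a b) u := by
    intro u hu
    have := (h.deriv u hu).fun_sub (((hasDerivAt_id u).const_mul (p s)).hasDerivWithinAt)
    simpa using this
  have := Convex.norm_image_sub_le_of_norm_hasDerivWithin_le hd
    (fun u hu => h.abs_sub_le hJ0 hJ hs hu) (convex_Icc a b) hs ht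
  simp only [Real.norm_eq_abs] at this
  convert this using 2
  ring

lemma abs_image_sub_le (h : SmoothOn a b m p q) {M : ℝ} (hM : ∀ t ∈ Icc a b, |p t| ≤ M)
    {s t : ℝ} (hs : s ∈ Icc a b) (ht : t ∈ Icc a b) : |m t - m s| ≤ M * |t - s| :=
  Convex.norm_image_sub_le_of_norm_hasDerivWithin_le h.deriv hM (convex_Icc a b) hs ht

/-- A local Taylor bound: the remainder between `t` and `c` is controlled by the roughness on
`(t, c)` alone. -/
lemma sq_taylor_le (h : SmoothOn a b m p q) (hq : ∫⁻ u in Icc a b, q u ≠ ∞)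
    {t c : ℝ} (hta : a ≤ t) (htc : t ≤ c) (hcb : c ≤ b) :
    ENNReal.ofReal ((m t - m c - p c * (t - c)) ^ 2) ≤
      ENNReal.ofReal ((c - t) ^ 3) * ∫⁻ u in Ioo t c, q u := by
  have hct : 0 ≤ c - t := sub_nonneg.2 htc
  have hfin : ∫⁻ u in Ioo t c, q u ≠ ∞ := ne_top_of_le_ne_top hq
    (lintegral_mono_set (Ioo_subset_Icc_self.trans (Icc_subset_Icc hta hcb)))
  set Q := (∫⁻ u in Ioo t c, q u).toReal with hQ
  have hQe : ∫⁻ u in Ioo t c, q u = ENNReal.ofReal Q := (ENNReal.ofReal_toReal hfin).symm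
  have hQ0 : 0 ≤ Q := ENNReal.toReal_nonneg
  have hp : ∀ u ∈ Icc t c, |p u - p c| ≤ √((c - t) * Q) := by
    intro u hu
    rw [abs_sub_comm]
    refine Real.abs_le_sqrt ?_
    have h1 := h.incr u c (hta.trans hu.1) hu.2 hcb
    have h2 : ∫⁻ v in Ioo u c, q v ≤ ENNReal.ofReal Q :=
      (lintegral_mono_set (Ioo_subset_Ioo_left hu.1)).trans_eq hQe
    have h3 := h1.trans (mul_le_mul' (ENNReal.ofReal_le_ofReal
      (by linarith [hu.1] : c - u ≤ c - t)) h2)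
    rw [← ENNReal.ofReal_mul hct] at h3
    exact (ENNReal.ofReal_le_ofReal_iff (by positivity)).1 h3
  have hd : ∀ u ∈ Icc t c, HasDerivWithinAt (fun u => m u - p c * u) (p u - p c) (Icc t c) u := by
    intro u hu
    have := ((h.deriv u ⟨hta.trans hu.1, hu.2.trans hcb⟩).mono (Icc_subset_Icc hta hcb)).fun_sub
      (((hasDerivAt_id u).const_mul (p c)).hasDerivWithinAt)
    simpa using this
  have h4 := Convex.norm_image_sub_le_of_norm_hasDerivWithin_le hd hp (convex_Icc t c)
    (right_mem_Icc.2 htc) (left_mem_Icc.2 htc)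
  simp only [Real.norm_eq_abs] at h4
  rw [hQe, ← ENNReal.ofReal_mul (by positivity)]
  refine ENNReal.ofReal_le_ofReal ?_
  have h5 : |m t - m c - p c * (t - c)| ≤ √((c - t) * Q) * (c - t) := by
    rw [abs_sub_comm t c, abs_of_nonneg hct] at h4
    convert h4 using 2
    ring
  calc (m t - m c - p c * (t - c)) ^ 2 = |m t - m c - p c * (t - c)| ^ 2 := (sq_abs _).symm
    _ ≤ (√((c - t) * Q) * (c - t)) ^ 2 := pow_le_pow_left₀ (abs_nonneg _) h5 2
    _ = (c - t) ^ 3 * Q := by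
      rw [mul_pow, Real.sq_sqrt (by positivity)]; ring

end SmoothOn

/-! ### Piecewise linear approximation adapted to the design -/

/-- Position of the design point `t i` on a scale that combines its location in `[a, a + L]` and
its rank among the design points. -/
noncomputable def designScale {ι : Type*} [Fintype ι] (a L : ℝ) (t : ι → ℝ) (i : ι) : ℝ :=
  (t i - a) / L + (Finset.univ.filter fun j => t j < t i).card / Fintype.card ι

/-- The spanning vectors `i ↦ 1{i ∈ cell k} (t i)^l`, `l = 0, 1`, of the piecewise linear functions
of the design. The cells are the level sets of `⌊N · designScale⌋`; a cell spans a length of at most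
`L / N` and, but for its largest point, a proportion `1 / N` of the design. -/
noncomputable def cellVec {ι : Type*} [Fintype ι] (a L : ℝ) (N : ℕ) (t : ι → ℝ)
    (k : Fin (2 * N + 1) × Fin 2) (i : ι) : ℝ :=
  if ⌊N * designScale a L t i⌋₊ = k.1 then t i ^ (k.2 : ℕ) else 0

section Approx

variable {ι : Type*} [Fintype ι] {a L : ℝ} {t : ι → ℝ}

lemma designScale_nonneg (hL : 0 < L) (ht : ∀ i, a ≤ t i) (i : ι) : 0 ≤ designScale a L t i := by
  have := sub_nonneg.2 (ht i)
  unfold designScale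
  positivity

lemma designScale_le_two (hL : 0 < L) (ht : ∀ i, t i ≤ a + L) (i : ι) :
    designScale a L t i ≤ 2 := by
  have h1 : (t i - a) / L ≤ 1 := (div_le_one hL).2 (by linarith [ht i])
  have h2 : ((Finset.univ.filter fun j => t j < t i).card : ℝ) / Fintype.card ι ≤ 1 := by
    refine div_le_one_of_le₀ ?_ (by positivity)
    exact_mod_cast Finset.card_le_univ _
  unfold designScale
  linarith

/-- The scale grows by at least the relative location and by at least the proportion of points
passed. -/
lemma designScale_sub_ge [Nonempty ι] {i j : ι} (hij : t i ≤ t j) (S : Finset ι)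
    (hS : ∀ k ∈ S, t i ≤ t k ∧ t k < t j) :
    (t j - t i) / L + S.card / Fintype.card ι ≤ designScale a L t j - designScale a L t i := by
  classical
  have hc : S.card + (Finset.univ.filter fun k => t k < t i).card ≤
      (Finset.univ.filter fun k => t k < t j).card := by
    rw [← Finset.card_union_of_disjoint]
    · refine Finset.card_le_card fun k hk => ?_
      simp only [Finset.mem_union, Finset.mem_filter, Finset.mem_univ, true_and] at hk ⊢
      rcases hk with hk | hk
      · exact (hS k hk).2
      · exact hk.trans_le hij
    · refine Finset.disjoint_left.2 fun k hk hk' => ?_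
      simp only [Finset.mem_filter, Finset.mem_univ, true_and] at hk'
      exact (hS k hk).1.not_gt hk'
  have hn : (0 : ℝ) < Fintype.card ι := by exact_mod_cast Fintype.card_pos
  have hc' : (S.card : ℝ) + (Finset.univ.filter fun k => t k < t i).card ≤
      (Finset.univ.filter fun k => t k < t j).card := by exact_mod_cast hc
  have h3 := div_le_div_of_nonneg_right hc' hn.le
  rw [add_div] at h3
  have h4 : (t j - t i) / L = (t j - a) / L - (t i - a) / L := by ring
  unfold designScale
  linarith

/-- Linear approximation in the empirical norm with the `L²` rate `N⁻²` of twice weakly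
differentiable functions, whatever the design points are. The expansion point of a cell is its
largest design point, so that ties there cause no error. -/
lemma exists_cellVec_approx [Nonempty ι] (hL : 0 < L) (ht : ∀ i, t i ∈ Icc a (a + L))
    {m p : ℝ → ℝ} {q : ℝ → ℝ≥0∞} (h : SmoothOn a (a + L) m p q) {J : ℝ}
    (hJ : ∫⁻ u in Icc a (a + L), q u ≤ ENNReal.ofReal (J ^ 2)) {N : ℕ} (hN : 0 < N) :
    ∃ v : Fin (2 * N + 1) × Fin 2 → ℝ,
      ∑ i, (m (t i) - ∑ k, v k * cellVec a L N t k i) ^ 2 ≤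
        Fintype.card ι * (L ^ 3 / N ^ 4 * J ^ 2) := by
  classical
  have hN' : (0 : ℝ) < N := by exact_mod_cast hN
  have hn : (0 : ℝ) < Fintype.card ι := by exact_mod_cast Fintype.card_pos
  set G := designScale a L t with hG
  set c : ι → ℕ := fun i => ⌊N * G i⌋₊ with hc
  have hG0 : ∀ i, 0 ≤ N * G i := fun i =>
    mul_nonneg hN'.le (designScale_nonneg hL (fun i => (ht i).1) i)
  have hclt : ∀ i, c i < 2 * N + 1 := by
    intro i
    rw [Nat.lt_succ_iff]
    refine Nat.floor_le_of_le ?_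
    have := designScale_le_two hL (fun i => (ht i).2) i
    push_cast
    nlinarith
  have hGmono : ∀ i j, t i ≤ t j → G i ≤ G j := by
    intro i j hij
    have := designScale_sub_ge (a := a) (L := L) hij ∅ (by simp)
    simp only [Finset.card_empty, Nat.cast_zero, zero_div, add_zero] at this
    have h0 : 0 ≤ (t j - t i) / L := div_nonneg (sub_nonneg.2 hij) hL.le
    linarith
  have hcmono : ∀ i j, t i ≤ t j → c i ≤ c j := fun i j hij =>
    Nat.floor_le_floor (mul_le_mul_of_nonneg_left (hGmono i j hij) hN'.le)
  have hcell : ∀ i j, c i = c j → G j - G i ≤ 1 / N := by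
    intro i j hij
    rw [le_div_iff₀ hN']
    have h1 := Nat.lt_floor_add_one (N * G j)
    have h2 := Nat.floor_le (hG0 i)
    simp only [hc] at hij
    rw [← hij] at h1
    linarith
  -- the largest design point of each cell
  have htop : ∀ k : ℕ, ∃ j : ι, (∃ i, c i = k) → c j = k ∧ ∀ i, c i = k → t i ≤ t j := by
    intro k
    by_cases hk : ∃ i, c i = k
    · obtain ⟨j, hj, hmax⟩ := Finset.exists_max_image (Finset.univ.filter fun i => c i = k) t
        (by obtain ⟨i, hi⟩ := hk; exact ⟨i, by simp [hi]⟩)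
      refine ⟨j, fun _ => ⟨by simpa using hj, fun i hi => hmax i (by simp [hi])⟩⟩
    · exact ⟨Classical.arbitrary ι, fun h => absurd h hk⟩
  choose top htop using htop
  have htop1 : ∀ i, c (top (c i)) = c i := fun i => (htop (c i) ⟨i, rfl⟩).1
  have htop2 : ∀ i, t i ≤ t (top (c i)) := fun i => (htop (c i) ⟨i, rfl⟩).2 i rfl
  set z : ι → ℝ := fun i => t (top (c i)) with hz
  refine ⟨fun k => if k.2 = 0 then m (t (top k.1)) - p (t (top k.1)) * t (top k.1)
    else p (t (top k.1)), ?_⟩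
  have hsum : ∀ i, ∑ k : Fin (2 * N + 1) × Fin 2,
      (if k.2 = 0 then m (t (top k.1)) - p (t (top k.1)) * t (top k.1) else p (t (top k.1))) *
        cellVec a L N t k i = m (z i) + p (z i) * (t i - z i) := by
    intro i
    rw [Fintype.sum_prod_type]
    rw [Finset.sum_eq_single (⟨c i, hclt i⟩ : Fin (2 * N + 1))]
    · simp [cellVec, hc, hz, hG]
      ring
    · intro k _ hk
      have : ¬ (⌊N * designScale a L t i⌋₊ = (k : ℕ)) := fun h => hk (Fin.ext h.symm)
      simp [cellVec, this]
    · simp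
  simp_rw [hsum]
  have hzt : ∀ i, z i - t i ≤ L / N := by
    intro i
    have h1 := designScale_sub_ge (a := a) (L := L) (htop2 i) ∅ (by simp)
    have h2 := hcell i (top (c i)) (htop1 i).symm
    simp only [Finset.card_empty, Nat.cast_zero, zero_div, add_zero] at h1
    have h3 : (z i - t i) / L ≤ 1 / N := h1.trans h2
    rw [div_le_iff₀ hL] at h3
    calc z i - t i ≤ 1 / N * L := h3
      _ = L / N := by ring
  -- at most `n / N` of the intervals `(t i, z i)` contain a given point
  have hcount : ∀ s : ℝ, ((Finset.univ.filter fun i => s ∈ Ioo (t i) (z i)).card : ℝ) ≤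
      Fintype.card ι / N := by
    intro s
    set S := Finset.univ.filter fun i => s ∈ Ioo (t i) (z i) with hS
    rcases S.eq_empty_or_nonempty with h0 | hne
    · rw [h0]; simp only [Finset.card_empty, Nat.cast_zero]; positivity
    obtain ⟨i0, hi0, hmin⟩ := Finset.exists_min_image S t hne
    have hmem : ∀ i ∈ S, t i < s ∧ s < z i := fun i hi => by simpa [hS] using hi
    have h1 := designScale_sub_ge (a := a) (L := L) (htop2 i0) S fun k hk =>
      ⟨hmin k hk, (hmem k hk).1.trans (hmem i0 hi0).2⟩
    have h2 := hcell i0 (top (c i0)) (htop1 i0).symm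
    have h3 : 0 ≤ (t (top (c i0)) - t i0) / L := div_nonneg (sub_nonneg.2 (htop2 i0)) hL.le
    have h4 : (S.card : ℝ) / Fintype.card ι ≤ 1 / N := by linarith
    rw [div_le_iff₀ hn] at h4
    calc (S.card : ℝ) ≤ 1 / N * Fintype.card ι := h4
      _ = Fintype.card ι / N := by ring
  have hqfin : ∫⁻ u in Icc a (a + L), q u ≠ ∞ := ne_top_of_le_ne_top ENNReal.ofReal_ne_top hJ
  have herr : ∀ i, ENNReal.ofReal ((m (t i) - (m (z i) + p (z i) * (t i - z i))) ^ 2) ≤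
      ENNReal.ofReal ((L / N) ^ 3) * ∫⁻ u, (Ioo (t i) (z i)).indicator q u := by
    intro i
    have h1 := h.sq_taylor_le hqfin (ht i).1 (htop2 i) (ht (top (c i))).2
    rw [← sub_sub, lintegral_indicator measurableSet_Ioo]
    refine h1.trans (mul_le_mul_left (ENNReal.ofReal_le_ofReal ?_) _)
    exact pow_le_pow_left₀ (sub_nonneg.2 (htop2 i)) (hzt i) 3
  have hpt : ∀ u, ∑ i, (Ioo (t i) (z i)).indicator q u ≤
      ENNReal.ofReal (Fintype.card ι / N) * (Icc a (a + L)).indicator q u := by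
    intro u
    have h1 : ∑ i, (Ioo (t i) (z i)).indicator q u =
        (Finset.univ.filter fun i => u ∈ Ioo (t i) (z i)).card * q u := by
      simp_rw [indicator_apply]
      rw [← Finset.sum_filter, Finset.sum_const, nsmul_eq_mul]
    by_cases hu : u ∈ Icc a (a + L)
    · rw [h1, indicator_of_mem hu]
      refine mul_le_mul_left ?_ _
      rw [← ENNReal.ofReal_natCast]
      exact ENNReal.ofReal_le_ofReal (hcount u)
    · rw [indicator_of_notMem hu, mul_zero, nonpos_iff_eq_zero]
      refine Finset.sum_eq_zero fun i _ => indicator_of_notMem (fun hi => hu ?_) _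
      exact ⟨(ht i).1.trans hi.1.le, hi.2.le.trans (ht _).2⟩
  have hfinal : ENNReal.ofReal (∑ i, (m (t i) - (m (z i) + p (z i) * (t i - z i))) ^ 2) ≤
      ENNReal.ofReal (Fintype.card ι * (L ^ 3 / N ^ 4 * J ^ 2)) := by
    rw [ENNReal.ofReal_sum_of_nonneg (fun i _ => sq_nonneg _)]
    calc _ ≤ ∑ i, ENNReal.ofReal ((L / N) ^ 3) * ∫⁻ u, (Ioo (t i) (z i)).indicator q u :=
          Finset.sum_le_sum fun i _ => herr i
      _ = ENNReal.ofReal ((L / N) ^ 3) * ∫⁻ u, ∑ i, (Ioo (t i) (z i)).indicator q u := by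
          rw [← Finset.mul_sum, lintegral_finsetSum _
            fun i _ => h.meas.indicator measurableSet_Ioo]
      _ ≤ ENNReal.ofReal ((L / N) ^ 3) * (ENNReal.ofReal (Fintype.card ι / N) *
            ENNReal.ofReal (J ^ 2)) := by
          refine mul_le_mul_right ?_ _
          refine (lintegral_mono hpt).trans ?_
          rw [lintegral_const_mul _ (h.meas.indicator measurableSet_Icc),
            lintegral_indicator measurableSet_Icc]
          exact mul_le_mul_right hJ _
      _ = _ := by
          rw [← ENNReal.ofReal_mul (by positivity), ← ENNReal.ofReal_mul (by positivity)]
          congr 1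
          field_simp
  exact (ENNReal.ofReal_le_ofReal_iff (by positivity)).1 hfinal

end Approx

/-! ### Empirical norm and the noise term -/

section Empirical

variable {ι : Type*} [Fintype ι]

/-- The empirical norm `(n⁻¹ ∑ᵢ vᵢ²)^{1/2}`. -/
noncomputable def rms (v : ι → ℝ) : ℝ := √((∑ i, v i ^ 2) / Fintype.card ι)

/-- The empirical inner product `n⁻¹ ∑ᵢ eᵢ vᵢ`. -/
noncomputable def edot (e v : ι → ℝ) : ℝ := (∑ i, e i * v i) / Fintype.card ι

lemma rms_nonneg (v : ι → ℝ) : 0 ≤ rms v := Real.sqrt_nonneg _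

lemma sq_rms (v : ι → ℝ) : rms v ^ 2 = (∑ i, v i ^ 2) / Fintype.card ι :=
  Real.sq_sqrt (div_nonneg (Finset.sum_nonneg fun _ _ => sq_nonneg _) (Nat.cast_nonneg _))

lemma rms_eq_norm (v : ι → ℝ) :
    rms v = ‖(WithLp.toLp 2 v : EuclideanSpace ℝ ι)‖ / √(Fintype.card ι) := by
  rw [rms, EuclideanSpace.norm_eq, Real.sqrt_div (Finset.sum_nonneg fun _ _ => sq_nonneg _)]
  simp

lemma rms_add_le (u v : ι → ℝ) : rms (fun i => u i + v i) ≤ rms u + rms v := by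
  rw [rms_eq_norm, rms_eq_norm, rms_eq_norm, ← add_div]
  exact div_le_div_of_nonneg_right
    (norm_add_le (WithLp.toLp 2 u : EuclideanSpace ℝ ι) (WithLp.toLp 2 v)) (Real.sqrt_nonneg _)

lemma rms_neg (u : ι → ℝ) : rms (fun i => -u i) = rms u := by simp [rms]

lemma rms_sub_le (u v : ι → ℝ) : rms (fun i => u i - v i) ≤ rms u + rms v := by
  simpa only [sub_eq_add_neg, rms_neg] using rms_add_le u fun i => -v i

lemma rms_le_of_abs_le [Nonempty ι] {v : ι → ℝ} {M : ℝ} (hM : 0 ≤ M) (h : ∀ i, |v i| ≤ M) :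
    rms v ≤ M := by
  have hn : (0 : ℝ) < Fintype.card ι := by exact_mod_cast Fintype.card_pos
  refine Real.sqrt_le_iff.2 ⟨hM, ?_⟩
  rw [div_le_iff₀ hn]
  calc ∑ i, v i ^ 2 ≤ ∑ _i : ι, M ^ 2 := Finset.sum_le_sum fun i _ => by
        rw [← sq_abs]; exact pow_le_pow_left₀ (abs_nonneg _) (h i) 2
    _ = M ^ 2 * Fintype.card ι := by simp [mul_comm]

lemma exists_abs_le_rms [Nonempty ι] (v : ι → ℝ) : ∃ i, |v i| ≤ rms v := by
  by_contra! h
  have hn : (0 : ℝ) < Fintype.card ι := by exact_mod_cast Fintype.card_pos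
  have h1 : ∑ _i : ι, rms v ^ 2 < ∑ i, v i ^ 2 := by
    refine Finset.sum_lt_sum_of_nonempty Finset.univ_nonempty fun i _ => ?_
    rw [← sq_abs (v i)]
    exact pow_lt_pow_left₀ (h i) (rms_nonneg v) (by norm_num)
  rw [sq_rms] at h1
  simp only [Finset.sum_const, Finset.card_univ, nsmul_eq_mul] at h1
  rw [mul_div_cancel₀ _ hn.ne'] at h1
  exact lt_irrefl _ h1

lemma edot_le_rms_mul (e v : ι → ℝ) : edot e v ≤ rms e * rms v := by
  refine le_of_sq_le_sq ?_ (mul_nonneg (rms_nonneg _) (rms_nonneg _))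
  rw [mul_pow, sq_rms, sq_rms, edot, div_pow, div_mul_div_comm, ← sq]
  exact div_le_div_of_nonneg_right (Finset.sum_mul_sq_le_sq_mul_sq _ _ _) (by positivity)

lemma edot_add (e u v : ι → ℝ) : edot e (fun i => u i + v i) = edot e u + edot e v := by
  simp only [edot, mul_add, Finset.sum_add_distrib, add_div]

/-- `v` is a piecewise linear function of the design points `t` for the partition of size `N`. -/
def IsCellFun (a L : ℝ) (N : ℕ) (t v : ι → ℝ) : Prop :=
  ∃ q : Fin (2 * N + 1) × Fin 2 → ℝ, ∀ i, v i = ∑ k, q k * cellVec a L N t k i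

/-- The noise `e` is small, relative to the dimension, on the spaces spanned by `g` and the
piecewise linear functions of two consecutive dyadic partitions. -/
def NoiseBound (a L : ℝ) (N : ℕ) (C : ℝ) (g t e : ι → ℝ) : Prop :=
  ∀ (c : ℝ) (u v : ι → ℝ), IsCellFun a L N t u → IsCellFun a L (2 * N) t v →
    edot e (fun i => c * g i + (u i + v i)) ≤
      C * √(N / Fintype.card ι) * rms (fun i => c * g i + (u i + v i))

lemma IsCellFun.neg {a L : ℝ} {N : ℕ} {t v : ι → ℝ} (h : IsCellFun a L N t v) :
    IsCellFun a L N t fun i => -v i := by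
  obtain ⟨q, hq⟩ := h
  exact ⟨fun k => -q k, fun i => by simp [hq i]⟩

lemma isCellFun_zero {a L : ℝ} {N : ℕ} {t : ι → ℝ} : IsCellFun a L N t fun _ => 0 :=
  ⟨fun _ => 0, fun i => by simp⟩

/-- Dyadic chaining along piecewise linear approximations: at level `N = 2^k N₀` the increment has
norm of order `J / N²` and lies in a space of dimension of order `N`, so that the contributions
form a convergent geometric series. -/
lemma edot_sub_le_of_noiseBound [Nonempty ι] {a L : ℝ} (hL : 0 < L) {t : ι → ℝ}
    (ht : ∀ i, t i ∈ Icc a (a + L)) {m p : ℝ → ℝ} {q : ℝ → ℝ≥0∞} (h : SmoothOn a (a + L) m p q)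
    {J : ℝ} (hJ0 : 0 ≤ J) (hJ : ∫⁻ u in Icc a (a + L), q u ≤ ENNReal.ofReal (J ^ 2))
    {N : ℕ} (hN : 0 < N) {C C₂ : ℝ} (hC : 0 ≤ C) {g e : ι → ℝ} (hC₂ : rms e ≤ C₂)
    (hb : ∀ k < Fintype.card ι, NoiseBound a L (2 ^ k * N) C g t e) :
    edot e (fun i => m (t i) - g i) ≤
      C * √(N / Fintype.card ι) *
        (rms (fun i => m (t i) - g i) + 5 * (√(L ^ 3) * J / N ^ 2)) +
      C₂ * (√(L ^ 3) * J / Fintype.card ι ^ 2) := by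
  set n := Fintype.card ι with hn_def
  have hn : 0 < n := Fintype.card_pos
  have hn' : (0 : ℝ) < n := by exact_mod_cast hn
  have hN' : (0 : ℝ) < N := by exact_mod_cast hN
  have hNk : ∀ k : ℕ, 0 < 2 ^ k * N := fun k => by positivity
  set δ : ℕ → ℝ := fun k => √(L ^ 3) * J / ((2 ^ k * N : ℕ) : ℝ) ^ 2 with hδ
  have hδ0 : ∀ k, 0 ≤ δ k := fun k => by positivity
  -- the approximations
  have happ : ∀ k : ℕ, ∃ w : ι → ℝ, IsCellFun a L (2 ^ k * N) t w ∧
      rms (fun i => m (t i) - w i) ≤ δ k := by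
    intro k
    obtain ⟨v, hv⟩ := exists_cellVec_approx hL ht h hJ (hNk k)
    refine ⟨fun i => ∑ l, v l * cellVec a L (2 ^ k * N) t l i, ⟨v, fun i => rfl⟩, ?_⟩
    refine Real.sqrt_le_iff.2 ⟨hδ0 k, ?_⟩
    rw [div_le_iff₀ hn']
    refine hv.trans_eq ?_
    simp only [hδ]
    rw [div_pow, mul_pow, Real.sq_sqrt (by positivity)]
    ring
  choose w hw hwδ using happ
  have hstep : ∀ k, rms (fun i => w (k + 1) i - w k i) ≤ δ (k + 1) + δ k := by
    intro k
    have : (fun i => w (k + 1) i - w k i) =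
        fun i => (m (t i) - w k i) - (m (t i) - w (k + 1) i) := by ext; ring
    rw [this]
    exact (rms_sub_le _ _).trans (by linarith [hwδ k, hwδ (k + 1)])
  have hδs : ∀ k, δ (k + 1) ≤ δ k := by
    intro k
    simp only [hδ]
    refine div_le_div_of_nonneg_left (by positivity) (by have := hNk k; positivity) ?_
    refine pow_le_pow_left₀ (by positivity) ?_ 2
    exact_mod_cast Nat.mul_le_mul_right N (Nat.pow_le_pow_right (by norm_num) (by omega))
  set s := √((N : ℝ) / n) with hs
  have hs0 : 0 ≤ s := Real.sqrt_nonneg _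
  have hsk : ∀ k : ℕ, √(((2 ^ k * N : ℕ) : ℝ) / n) ≤ 2 ^ k * s := by
    intro k
    have h1 : (((2 ^ k * N : ℕ) : ℝ) / n) ≤ (2 ^ k) ^ 2 * (N / n) := by
      push_cast
      rw [mul_div_assoc]
      refine mul_le_mul_of_nonneg_right ?_ (by positivity)
      have : (1 : ℝ) ≤ 2 ^ k := one_le_pow₀ (by norm_num)
      nlinarith
    calc √(((2 ^ k * N : ℕ) : ℝ) / n) ≤ √((2 ^ k) ^ 2 * (N / n)) := Real.sqrt_le_sqrt h1
      _ = 2 ^ k * s := by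
        rw [Real.sqrt_mul (by positivity), Real.sqrt_sq (by positivity)]
  have hδk : ∀ k, 2 ^ k * δ k = δ 0 * (1 / 2) ^ k := by
    intro k
    simp only [hδ]
    push_cast
    rw [one_div, inv_pow]
    field_simp
  -- one step of the chain
  have hchain : ∀ k < n, edot e (fun i => w (k + 1) i - w k i) ≤
      C * s * (2 * δ 0) * (1 / 2) ^ k := by
    intro k hk
    have h1 := hb k hk 0 (fun i => -w k i) (w (k + 1)) (hw k).neg (by
      have := hw (k + 1)
      rwa [pow_succ', mul_assoc] at this)
    have h2 : (fun i => 0 * g i + (-w k i + w (k + 1) i)) = fun i => w (k + 1) i - w k i := by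
      ext; ring
    rw [h2] at h1
    calc edot e (fun i => w (k + 1) i - w k i) ≤ C * (2 ^ k * s) * (2 * δ k) := by
          refine h1.trans (mul_le_mul (mul_le_mul_of_nonneg_left (hsk k) hC)
            ((hstep k).trans (by linarith [hδs k])) (rms_nonneg _) (by positivity))
      _ = C * s * 2 * (2 ^ k * δ k) := by ring
      _ = _ := by rw [hδk]; ring
  have hsum : ∀ K ≤ n, edot e (fun i => w K i - w 0 i) ≤
      C * s * (2 * δ 0) * (2 * (1 - (1 / 2) ^ K)) := by
    intro K
    induction K with
    | zero => intro _; simp [edot]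
    | succ K ih =>
      intro hK
      have h1 : (fun i => w (K + 1) i - w 0 i) =
          fun i => (w (K + 1) i - w K i) + (w K i - w 0 i) := by ext; ring
      rw [h1, edot_add]
      have h2 := hchain K (by omega)
      have h3 := ih (by omega)
      have h4 : C * s * (2 * δ 0) * (1 / 2) ^ K + C * s * (2 * δ 0) * (2 * (1 - (1 / 2) ^ K)) =
          C * s * (2 * δ 0) * (2 * (1 - (1 / 2) ^ (K + 1))) := by ring
      linarith
  have hchainN : edot e (fun i => w n i - w 0 i) ≤ C * s * (4 * δ 0) := by
    refine (hsum n le_rfl).trans ?_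
    have h1 : (0 : ℝ) ≤ (1 / 2) ^ n := by positivity
    have h2 : 0 ≤ C * s * (2 * δ 0) := by have := hδ0 0; positivity
    nlinarith
  have hstart : edot e (fun i => w 0 i - g i) ≤
      C * s * (δ 0 + rms (fun i => m (t i) - g i)) := by
    have h1 := hb 0 hn (-1) (w 0) (fun _ => 0) (hw 0) isCellFun_zero
    have h2 : (fun i => -1 * g i + (w 0 i + 0)) = fun i => w 0 i - g i := by ext; ring
    rw [h2] at h1
    simp only [pow_zero, one_mul] at h1
    refine h1.trans (mul_le_mul_of_nonneg_left ?_ (by positivity))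
    have h3 : (fun i => w 0 i - g i) = fun i => (m (t i) - g i) - (m (t i) - w 0 i) := by
      ext; ring
    rw [h3]
    exact (rms_sub_le _ _).trans (by linarith [hwδ 0])
  have hend : edot e (fun i => m (t i) - w n i) ≤ C₂ * (√(L ^ 3) * J / n ^ 2) := by
    refine (edot_le_rms_mul _ _).trans (mul_le_mul hC₂ ((hwδ n).trans ?_) (rms_nonneg _)
      ((rms_nonneg e).trans hC₂))
    simp only [hδ]
    refine div_le_div_of_nonneg_left (by positivity) (by positivity) ?_
    refine pow_le_pow_left₀ hn'.le ?_ 2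
    have : n ≤ 2 ^ n * N := (Nat.lt_two_pow_self).le.trans (Nat.le_mul_of_pos_right _ hN)
    exact_mod_cast this
  have htot : (fun i => m (t i) - g i) = fun i => (m (t i) - w n i) +
      ((w n i - w 0 i) + (w 0 i - g i)) := by ext; ring
  have hδ00 : δ 0 = √(L ^ 3) * J / (N : ℝ) ^ 2 := by simp [hδ]
  have hgoal : edot e (fun i => m (t i) - g i) = edot e (fun i => m (t i) - w n i) +
      (edot e (fun i => w n i - w 0 i) + edot e (fun i => w 0 i - g i)) := by
    conv_lhs => rw [htot]
    rw [edot_add, edot_add]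
  rw [hgoal, ← hδ00]
  have : C * s * (rms (fun i => m (t i) - g i) + 5 * δ 0) =
    C * s * (4 * δ 0) + C * s * (δ 0 + rms (fun i => m (t i) - g i)) := by ring
  linarith

end Empirical

/-! ### The estimator on the good event -/

section Deterministic

variable {ι : Type*} [Fintype ι] [Nonempty ι]

/-- A lower bound on the empirical variance of the index turns empirical bounds on `m` into
bounds on its slope. -/
lemma SmoothOn.abs_deriv_le_of_rms {a L : ℝ} {m p : ℝ → ℝ} {q : ℝ → ℝ≥0∞}
    (h : SmoothOn a (a + L) m p q) {J : ℝ} (hJ0 : 0 ≤ J)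
    (hJ : ∫⁻ u in Icc a (a + L), q u ≤ ENNReal.ofReal (J ^ 2)) (hL : 0 < L) {t : ι → ℝ}
    (ht : ∀ i, t i ∈ Icc a (a + L)) {c : ℝ} (hc : 0 < c)
    (hcov : ∀ α β : ℝ, c * |β| ≤ rms fun i => α + β * t i) {s : ℝ} (hs : s ∈ Icc a (a + L)) :
    |p s| ≤ (rms (fun i => m (t i)) + √(L ^ 3) * J) / c := by
  rw [le_div_iff₀ hc, mul_comm]
  refine (hcov (m s - p s * s) (p s)).trans ?_
  have h1 : (fun i => m s - p s * s + p s * t i) =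
      fun i => m (t i) - (m (t i) - m s - p s * (t i - s)) := by ext; ring
  rw [h1]
  refine (rms_sub_le _ _).trans (add_le_add le_rfl ?_)
  refine rms_le_of_abs_le (by positivity) fun i => ?_
  refine (h.abs_taylor_le hJ0 hJ hs (ht i)).trans ?_
  have h2 : |t i - s| ≤ L := abs_sub_le_iff.2
    ⟨by linarith [(ht i).2, hs.1], by linarith [(ht i).1, hs.2]⟩
  have h3 : √(L ^ 3) = √L * L := by
    rw [pow_succ, mul_comm, Real.sqrt_mul hL.le, Real.sqrt_sq hL.le]
  rw [add_sub_cancel_left, h3]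
  calc √L * J * |t i - s| ≤ √L * J * L := mul_le_mul_of_nonneg_left h2 (by positivity)
    _ = √L * L * J := by ring

/-- Transfer of the noise bound from a nearby index `γ` to the index `θ`. With `ρ = n^{1/5}` the
result is the modulus `μ² + μ² J + μ ‖m ∘ θ - g‖ₙ` for `μ = n^{-2/5}`. -/
lemma edot_le_of_near {d : ℕ} {x : ι → EuclideanSpace ℝ (Fin d)} {e g : ι → ℝ} {a L : ℝ}
    (hL : 0 < L) {θ γ : EuclideanSpace ℝ (Fin d)}
    (hθ : ∀ i, inner ℝ θ (x i) ∈ Icc a (a + L)) (hγ : ∀ i, inner ℝ γ (x i) ∈ Icc a (a + L))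
    {T : ℝ} (hT : ∀ i, ‖x i‖ ≤ T) {C₁ C₂ c M₀ G ρ : ℝ} (hC₁ : 0 ≤ C₁) (hC₂ : rms e ≤ C₂)
    (hg : ∀ i, |g i| ≤ M₀) (hc : 0 < c)
    (hcov : ∀ α β : ℝ, c * |β| ≤ rms fun i => α + β * inner ℝ θ (x i))
    (hG0 : 0 ≤ G) (hG : ‖θ - γ‖ ≤ G / Fintype.card ι) (hρ1 : 1 ≤ ρ)
    (hρ : ρ ^ 5 = Fintype.card ι) {N : ℕ} (hN1 : ρ ≤ N) (hN2 : N ≤ 2 * ρ)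
    (hb : ∀ k < Fintype.card ι, NoiseBound a L (2 ^ k * N) C₁ g (fun i => inner ℝ γ (x i)) e)
    {m p : ℝ → ℝ} {q : ℝ → ℝ≥0∞} (h : SmoothOn a (a + L) m p q) {J : ℝ} (hJ0 : 0 ≤ J)
    (hJ : ∫⁻ u in Icc a (a + L), q u ≤ ENNReal.ofReal (J ^ 2)) :
    edot e (fun i => m (inner ℝ θ (x i)) - g i) ≤
      ((C₂ + 2 * C₁) * (T * G / c) * (1 + M₀ + √(L ^ 3)) + 2 * C₁ + 10 * C₁ * √(L ^ 3) +
        C₂ * √(L ^ 3)) *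
      ((1 / ρ ^ 2) ^ 2 + (1 / ρ ^ 2) ^ 2 * J +
        1 / ρ ^ 2 * rms (fun i => m (inner ℝ θ (x i)) - g i)) := by
  obtain ⟨i₀⟩ := ‹Nonempty ι›
  have : Nonempty ι := ⟨i₀⟩
  have hT0 : 0 ≤ T := (norm_nonneg _).trans (hT i₀)
  have hM0 : 0 ≤ M₀ := (abs_nonneg _).trans (hg i₀)
  have hC20 : 0 ≤ C₂ := (rms_nonneg e).trans hC₂
  have hρ0 : 0 < ρ := by linarith
  set n := Fintype.card ι
  have hn' : (0 : ℝ) < n := by exact_mod_cast (Fintype.card_pos : 0 < Fintype.card ι)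
  have hNpos : (0 : ℝ) < N := hρ0.trans_le hN1
  set S := √(L ^ 3) with hS
  have hS0 : 0 ≤ S := Real.sqrt_nonneg _
  set A := rms (fun i => m (inner ℝ θ (x i)) - g i) with hA
  have hA0 : 0 ≤ A := rms_nonneg _
  set μ := 1 / ρ ^ 2 with hμ
  have hμ0 : 0 < μ := by positivity
  have hμ1 : μ ≤ 1 := (div_le_one (by positivity)).2 (one_le_pow₀ hρ1)
  have hμ2 : μ ^ 2 = 1 / ρ ^ 4 := by rw [hμ, div_pow, one_pow, ← pow_mul]
  have hn1 : 1 / (n : ℝ) ≤ μ ^ 2 := by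
    rw [hμ2, ← hρ]
    exact one_div_le_one_div_of_le (by positivity) (pow_le_pow_right₀ hρ1 (by norm_num))
  have hrmsg : rms g ≤ M₀ := rms_le_of_abs_le hM0 hg
  have hrmsm : rms (fun i => m (inner ℝ θ (x i))) ≤ A + M₀ := by
    have : (fun i => m (inner ℝ θ (x i))) = fun i => (m (inner ℝ θ (x i)) - g i) + g i := by
      ext; ring
    rw [this]
    exact (rms_add_le _ _).trans (add_le_add le_rfl hrmsg)
  set M := (A + M₀ + S * J) / c with hM
  have hM0' : 0 ≤ M := by positivity
  have hslope : ∀ s ∈ Icc a (a + L), |p s| ≤ M := fun s hs =>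
    (h.abs_deriv_le_of_rms hJ0 hJ hL hθ hc hcov hs).trans
      (div_le_div_of_nonneg_right (by linarith) hc.le)
  set η := T * G * M * μ ^ 2 with hη
  have hη0 : 0 ≤ η := by positivity
  -- the slope bound `M` controls the change of `m` when `θ` is replaced by `γ`
  have hdiff : rms (fun i => m (inner ℝ θ (x i)) - m (inner ℝ γ (x i))) ≤ η := by
    refine rms_le_of_abs_le hη0 fun i => ?_
    refine (h.abs_image_sub_le hslope (hγ i) (hθ i)).trans ?_
    rw [← inner_sub_left]
    have h1 : |inner ℝ (θ - γ) (x i)| ≤ G * μ ^ 2 * T := by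
      refine (abs_real_inner_le_norm _ _).trans
        (mul_le_mul (hG.trans ?_) (hT i) (norm_nonneg _) (by positivity))
      rw [div_eq_mul_one_div]
      exact mul_le_mul_of_nonneg_left hn1 hG0
    calc M * |inner ℝ (θ - γ) (x i)| ≤ M * (G * μ ^ 2 * T) := mul_le_mul_of_nonneg_left h1 hM0'
      _ = η := by rw [hη]; ring
  have hw : rms (fun i => m (inner ℝ γ (x i)) - g i) ≤ A + η := by
    have : (fun i => m (inner ℝ γ (x i)) - g i) = fun i => (m (inner ℝ θ (x i)) - g i) -
      (m (inner ℝ θ (x i)) - m (inner ℝ γ (x i))) := by ext; ring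
    rw [this]
    exact (rms_sub_le _ _).trans (add_le_add le_rfl hdiff)
  have h1 : edot e (fun i => m (inner ℝ θ (x i)) - m (inner ℝ γ (x i))) ≤ C₂ * η :=
    (edot_le_rms_mul _ _).trans (mul_le_mul hC₂ hdiff (rms_nonneg _) hC20)
  have h2 := edot_sub_le_of_noiseBound hL hγ h hJ0 hJ (by exact_mod_cast hNpos) hC₁ hC₂ hb
  -- `N` is of the order `ρ = n^{1/5}`, so `(N / n)^{1/2}` and `N⁻²` are both of the order `μ`
  have hsq : √((N : ℝ) / n) ≤ 2 * μ := by
    refine Real.sqrt_le_iff.2 ⟨by positivity, ?_⟩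
    rw [mul_pow, hμ2, div_le_iff₀ hn', ← hρ]
    have : (2 : ℝ) ^ 2 * (1 / ρ ^ 4) * ρ ^ 5 = 4 * ρ := by field_simp; norm_num
    rw [this]
    linarith
  have hN2' : 1 / (N : ℝ) ^ 2 ≤ μ :=
    one_div_le_one_div_of_le (by positivity) (pow_le_pow_left₀ hρ0.le hN1 2)
  have hn2 : 1 / (n : ℝ) ^ 2 ≤ μ ^ 2 := by
    have e1 : 1 / (n : ℝ) ≤ 1 := hn1.trans (pow_le_one₀ hμ0.le hμ1)
    have : 1 / (n : ℝ) ^ 2 = (1 / n) * (1 / n) := by ring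
    rw [this]
    calc 1 / (n : ℝ) * (1 / n) ≤ 1 * μ ^ 2 := mul_le_mul e1 hn1 (by positivity) zero_le_one
      _ = μ ^ 2 := one_mul _
  have h3 : edot e (fun i => m (inner ℝ γ (x i)) - g i) ≤
      C₁ * (2 * μ) * ((A + η) + 5 * (S * J * μ)) + C₂ * (S * J * μ ^ 2) := by
    refine h2.trans (add_le_add ?_ ?_)
    · refine mul_le_mul (mul_le_mul_of_nonneg_left hsq hC₁) (add_le_add hw ?_)
        (add_nonneg (rms_nonneg _) (by positivity)) (by positivity)
      refine mul_le_mul_of_nonneg_left ?_ (by norm_num)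
      rw [div_eq_mul_one_div]
      exact mul_le_mul_of_nonneg_left hN2' (by positivity)
    · refine mul_le_mul_of_nonneg_left ?_ hC20
      rw [div_eq_mul_one_div]
      exact mul_le_mul_of_nonneg_left hn2 (by positivity)
  have h4 : edot e (fun i => m (inner ℝ θ (x i)) - g i) =
      edot e (fun i => m (inner ℝ θ (x i)) - m (inner ℝ γ (x i))) +
        edot e (fun i => m (inner ℝ γ (x i)) - g i) := by
    rw [← edot_add]
    congr 1
    ext; ring
  rw [h4]
  set H := T * G / c with hH
  have hH0 : 0 ≤ H := by positivity
  have hηH : η = H * (A + M₀ + S * J) * μ ^ 2 := by rw [hη, hM, hH]; field_simp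
  have hAμ : A * μ ^ 2 ≤ A * μ := mul_le_mul_of_nonneg_left
    (by rw [sq]; exact mul_le_of_le_one_left hμ0.le hμ1) hA0
  have hηle : η ≤ H * (1 + M₀ + S) * (μ ^ 2 + μ ^ 2 * J + μ * A) := by
    have e1 : η = H * (A * μ ^ 2 + M₀ * μ ^ 2 + S * (J * μ ^ 2)) := by rw [hηH]; ring
    rw [e1, mul_assoc]
    refine mul_le_mul_of_nonneg_left ?_ hH0
    have f1 : 0 ≤ μ ^ 2 := by positivity
    have f2 : 0 ≤ μ ^ 2 * J := by positivity
    have f3 : 0 ≤ μ * A := by positivity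
    have f4 : (1 + M₀ + S) * (μ ^ 2 + μ ^ 2 * J + μ * A) = μ ^ 2 + μ ^ 2 * J + μ * A +
      M₀ * μ ^ 2 + M₀ * (μ ^ 2 * J) + M₀ * (μ * A) + S * μ ^ 2 + S * (J * μ ^ 2) +
      S * (μ * A) := by ring
    rw [f4]
    linarith [mul_nonneg hM0 f2, mul_nonneg hM0 f3, mul_nonneg hS0 f1, mul_nonneg hS0 f3]
  have hμη : μ * η ≤ η := mul_le_of_le_one_left hη0 hμ1
  set Z := μ ^ 2 + μ ^ 2 * J + μ * A with hZ
  have f1 : 0 ≤ μ ^ 2 := by positivity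
  have f2 : 0 ≤ μ ^ 2 * J := by positivity
  have f3 : 0 ≤ μ * A := by positivity
  have g1 : (C₂ + 2 * C₁) * η ≤ (C₂ + 2 * C₁) * (H * (1 + M₀ + S) * Z) :=
    mul_le_mul_of_nonneg_left hηle (by positivity)
  have g2 : 2 * C₁ * (μ * η) ≤ 2 * C₁ * η := mul_le_mul_of_nonneg_left hμη (by positivity)
  have g3 : 2 * C₁ * (μ * A) ≤ 2 * C₁ * Z := mul_le_mul_of_nonneg_left (by linarith) (by positivity)
  have g4 : 10 * C₁ * S * (μ ^ 2 * J) ≤ 10 * C₁ * S * Z :=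
    mul_le_mul_of_nonneg_left (by linarith) (by positivity)
  have g5 : C₂ * S * (μ ^ 2 * J) ≤ C₂ * S * Z :=
    mul_le_mul_of_nonneg_left (by linarith) (by positivity)
  calc _ ≤ C₂ * η + (C₁ * (2 * μ) * ((A + η) + 5 * (S * J * μ)) + C₂ * (S * J * μ ^ 2)) :=
        add_le_add h1 h3
    _ = C₂ * η + 2 * C₁ * (μ * η) + 2 * C₁ * (μ * A) + 10 * C₁ * S * (μ ^ 2 * J) +
        C₂ * S * (μ ^ 2 * J) := by ring
    _ ≤ (C₂ + 2 * C₁) * (H * (1 + M₀ + S) * Z) + 2 * C₁ * Z + 10 * C₁ * S * Z + C₂ * S * Z := by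
        linarith
    _ = _ := by ring

end Deterministic

/-- Solving the basic inequality: the error is of the order of the tuning parameter and the
roughness is bounded as soon as `n^{-2/5}` is at most of the order of the tuning parameter. -/
lemma bound_of_basic_ineq {A J l μ K B J₀ : ℝ} (hA : 0 ≤ A) (hJ : 0 ≤ J) (hl : 0 < l)
    (hμ : 0 ≤ μ) (hK : 0 ≤ K) (hB : 0 ≤ B) (hμl : μ ≤ B * l)
    (h : A ^ 2 + l ^ 2 * J ^ 2 ≤ 2 * (K * (μ ^ 2 + μ ^ 2 * J + μ * A)) + l ^ 2 * J₀ ^ 2) :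
    A ≤ (2 * (2 * K * (B ^ 2 + B) + J₀ ^ 2) + 1) * l ∧
      J ≤ 2 * (2 * K * (B ^ 2 + B) + J₀ ^ 2) + 1 := by
  set Q := 2 * K * (B ^ 2 + B) + J₀ ^ 2 with hQ
  have hQ0 : 0 ≤ Q := by positivity
  set α := A / l with hα
  have hα0 : 0 ≤ α := by positivity
  have hAα : A = α * l := by rw [hα]; field_simp
  have hl2 : 0 < l ^ 2 := by positivity
  have hμ2 : μ ^ 2 ≤ B ^ 2 * l ^ 2 := by
    rw [← mul_pow]; exact pow_le_pow_left₀ hμ hμl 2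
  have h1 : μ ^ 2 + μ ^ 2 * J + μ * A ≤ (B ^ 2 + B) * (1 + J + α) * l ^ 2 := by
    have e1 : μ * A ≤ B * α * l ^ 2 := by
      calc μ * A ≤ B * l * A := mul_le_mul_of_nonneg_right hμl hA
        _ = B * α * l ^ 2 := by rw [hAα]; ring
    have e2 : μ ^ 2 * J ≤ B ^ 2 * l ^ 2 * J := mul_le_mul_of_nonneg_right hμ2 hJ
    have e3 : 0 ≤ (B + B * J + B ^ 2 * α) * l ^ 2 := by positivity
    nlinarith
  have h2 : (α ^ 2 + J ^ 2) * l ^ 2 ≤ (Q * (1 + J + α)) * l ^ 2 := by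
    have e1 := mul_le_mul_of_nonneg_left h1 hK
    have e2 : 0 ≤ J₀ ^ 2 * (J + α) * l ^ 2 := by positivity
    calc (α ^ 2 + J ^ 2) * l ^ 2 = A ^ 2 + l ^ 2 * J ^ 2 := by rw [hAα]; ring
      _ ≤ 2 * (K * ((B ^ 2 + B) * (1 + J + α) * l ^ 2)) + l ^ 2 * J₀ ^ 2 := by linarith
      _ ≤ (Q * (1 + J + α)) * l ^ 2 := by rw [hQ]; linarith
  have h3 : α ^ 2 + J ^ 2 ≤ Q * (1 + J + α) := le_of_mul_le_mul_right h2 hl2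
  -- `(α, J)` lies in a disc
  have h4 : (α - Q / 2) ^ 2 + (J - Q / 2) ^ 2 ≤ (Q + 1) ^ 2 := by nlinarith
  have h5 : α - Q / 2 ≤ Q + 1 :=
    le_of_sq_le_sq (by linarith [sq_nonneg (J - Q / 2)]) (by linarith)
  have h6 : J - Q / 2 ≤ Q + 1 :=
    le_of_sq_le_sq (by linarith [sq_nonneg (α - Q / 2)]) (by linarith)
  refine ⟨?_, by linarith⟩
  rw [hAα]
  exact mul_le_mul_of_nonneg_right (by linarith) hl.le

/-! ### Events of probability tending to one -/

section Whp

variable {Ω : Type*} [MeasurableSpace Ω] {P : Measure Ω}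

/-- The (outer) probability of the complement of `E n` tends to `0`. -/
def Whp (P : Measure Ω) (E : ℕ → Set Ω) : Prop := Tendsto (fun n => P (E n)ᶜ) atTop (𝓝 0)

lemma Whp.mono {E F : ℕ → Set Ω} (hE : Whp P E) (h : ∀ᶠ n in atTop, E n ⊆ F n) : Whp P F :=
  tendsto_of_tendsto_of_tendsto_of_le_of_le' tendsto_const_nhds hE
    (Eventually.of_forall fun _ => zero_le)
    (h.mono fun _ hn => measure_mono (compl_subset_compl.2 hn))

lemma Whp.inter {E F : ℕ → Set Ω} (hE : Whp P E) (hF : Whp P F) :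
    Whp P fun n => E n ∩ F n := by
  have h := hE.add hF
  rw [add_zero] at h
  refine tendsto_of_tendsto_of_tendsto_of_le_of_le tendsto_const_nhds h (fun _ => zero_le)
    fun n => ?_
  simp only [compl_inter]
  exact measure_union_le _ _

lemma Whp.biInter {ι : Type*} (s : Finset ι) {E : ι → ℕ → Set Ω} (hE : ∀ i ∈ s, Whp P (E i)) :
    Whp P fun n => ⋂ i ∈ s, E i n := by
  classical
  induction s using Finset.induction_on with
  | empty => simp [Whp]
  | insert i s hi ih =>
    simp only [Finset.set_biInter_insert]
    exact (hE i (Finset.mem_insert_self i s)).inter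
      (ih fun j hj => hE j (Finset.mem_insert_of_mem hj))

lemma whp_of_ae {S : Set Ω} (h : ∀ᵐ ω ∂P, ω ∈ S) : Whp P fun _ => S := by
  have : P Sᶜ = 0 := h
  simp [Whp, this]

lemma whp_of_ae_tendsto [IsFiniteMeasure P] {Z : ℕ → Ω → ℝ} {c : ℝ}
    (hZ : ∀ n, AEStronglyMeasurable (Z n) P)
    (h : ∀ᵐ ω ∂P, Tendsto (fun n => Z n ω) atTop (𝓝 c)) {ε : ℝ} (hε : 0 < ε) :
    Whp P fun n => {ω | |Z n ω - c| < ε} := by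
  have h1 := tendstoInMeasure_of_tendsto_ae hZ h (ENNReal.ofReal ε) (by simpa using hε)
  refine h1.congr fun n => congrArg P ?_
  ext ω
  simp only [mem_ofPred_eq, mem_compl_iff, not_lt]
  rw [edist_dist, Real.dist_eq, ENNReal.ofReal_le_ofReal_iff (abs_nonneg _)]

end Whp

section LLN

variable {Ω : Type*} [MeasurableSpace Ω] {P : Measure Ω}
  {α : Type*} [MeasurableSpace α] {ν : Measure α} {z : ℕ → Ω → α}

lemma ae_tendsto_average (hlaw : ∀ i, HasLaw (z i) ν P) (hindep : iIndepFun z P) {f : α → ℝ}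
    (hf : Measurable f) (hfi : Integrable f ν) :
    ∀ᵐ ω ∂P, Tendsto (fun n : ℕ => (∑ i : Fin n, f (z i ω)) / n) atTop (𝓝 (∫ a, f a ∂ν)) := by
  have h0 : Integrable (fun ω => f (z 0 ω)) P := by
    rw [← (hlaw 0).map_eq] at hfi
    exact hfi.comp_aemeasurable (hlaw 0).aemeasurable
  have h := strong_law_ae_real (μ := P) (fun i ω => f (z i ω)) h0
    (fun i j hij => (hindep.indepFun hij).comp hf hf)
    (fun i => ((hlaw i).identDistrib (hlaw 0)).comp hf)
  have he : ∫ ω, f (z 0 ω) ∂P = ∫ a, f a ∂ν :=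
    (hlaw 0).integral_comp hf.aestronglyMeasurable
  rw [he] at h
  filter_upwards [h] with ω hω
  simpa only [Finset.sum_range] using hω

lemma aestronglyMeasurable_average (hlaw : ∀ i, HasLaw (z i) ν P) {f : α → ℝ}
    (hf : Measurable f) (n : ℕ) :
    AEStronglyMeasurable (fun ω => (∑ i : Fin n, f (z i ω)) / (n : ℝ)) P := by
  refine AEMeasurable.aestronglyMeasurable (AEMeasurable.div_const ?_ _)
  exact Finset.aemeasurable_fun_sum _ fun i _ => hf.comp_aemeasurable (hlaw i).aemeasurable

lemma whp_average [IsFiniteMeasure P] (hlaw : ∀ i, HasLaw (z i) ν P) (hindep : iIndepFun z P)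
    {f : α → ℝ} (hf : Measurable f) (hfi : Integrable f ν) {ε : ℝ} (hε : 0 < ε) :
    Whp P fun n => {ω | |(∑ i : Fin n, f (z i ω)) / (n : ℝ) - ∫ a, f a ∂ν| < ε} :=
  whp_of_ae_tendsto (aestronglyMeasurable_average hlaw hf) (ae_tendsto_average hlaw hindep hf hfi)
    hε

/-- The first `n` observations have the product law. -/
lemma measure_sample_le [IsProbabilityMeasure P] (hlaw : ∀ i, HasLaw (z i) ν P)
    (hindep : iIndepFun z P) (n : ℕ) (A : Set (Fin n → α)) :
    P {ω | (fun i : Fin n => z i ω) ∈ A} ≤ Measure.pi (fun _ : Fin n => ν) A := by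
  have h1 : iIndepFun (fun i : Fin n => z i) P := hindep.precomp Fin.val_injective
  have h2 := (iIndepFun_iff_map_fun_eq_pi_map (fun i : Fin n => (hlaw i).aemeasurable)).1 h1
  simp_rw [(hlaw _).map_eq] at h2
  rw [← h2]
  exact Measure.le_map_apply (aemeasurable_pi_lambda (fun ω (i : Fin n) => z i ω)
    fun i => (hlaw i).aemeasurable) A

end LLN

/-! ### The good event -/

section Good

variable {d : ℕ} {ν : Measure (EuclideanSpace ℝ (Fin d) × ℝ)}
  {Ω : Type*} [MeasurableSpace Ω] {P : Measure Ω}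
  {z : ℕ → Ω → EuclideanSpace ℝ (Fin d) × ℝ}

lemma A2.integrable_sq (h : A2 ν) : Integrable (fun p => p.2 ^ 2) ν := by
  obtain ⟨⟨K, hK, hi, -⟩, -⟩ := h
  refine (hi.const_mul K).mono' (by fun_prop) (ae_of_all _ fun p => ?_)
  rw [Real.norm_of_nonneg (sq_nonneg _)]
  have h1 := Real.add_one_le_exp (p.2 ^ 2 / K)
  have h2 : p.2 ^ 2 = K * (p.2 ^ 2 / K) := by field_simp
  calc p.2 ^ 2 = K * (p.2 ^ 2 / K) := h2
    _ ≤ K * (Real.exp (p.2 ^ 2 / K) - 1) := mul_le_mul_of_nonneg_left (by linarith) hK.le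

lemma whp_rms_noise_le [IsFiniteMeasure P] (h : A2 ν) (hlaw : ∀ i, HasLaw (z i) ν P)
    (hindep : iIndepFun z P) :
    ∃ C : ℝ, Whp P fun n => {ω | rms (fun i : Fin n => (z i ω).2) ≤ C} := by
  refine ⟨√(∫ p, p.2 ^ 2 ∂ν + 1), (whp_average hlaw hindep (f := fun p => p.2 ^ 2) (by fun_prop)
    h.integrable_sq one_pos).mono (Eventually.of_forall fun n ω hω => ?_)⟩
  simp only [mem_ofPred_eq] at hω ⊢
  refine Real.sqrt_le_sqrt ?_
  rw [Fintype.card_fin]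
  linarith [(abs_lt.1 hω).2]

lemma ae_mem_supp : ∀ᵐ x ∂(lawX ν), x ∈ supp ν := Measure.support_mem_ae

instance [IsProbabilityMeasure ν] : IsProbabilityMeasure (lawX ν) :=
  Measure.isProbabilityMeasure_map measurable_fst.aemeasurable

lemma A1.integrable_of_continuous [IsProbabilityMeasure ν] (h : A1 ν)
    {f : EuclideanSpace ℝ (Fin d) → ℝ} (hf : Continuous f) : Integrable f (lawX ν) := by
  obtain ⟨C, hC⟩ := h.1.exists_bound_of_continuousOn hf.continuousOn
  exact Integrable.of_bound hf.aestronglyMeasurable C (ae_mem_supp.mono hC)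

lemma A1.memLp [IsProbabilityMeasure ν] (h : A1 ν) {f : EuclideanSpace ℝ (Fin d) → ℝ}
    (hf : Continuous f) : MemLp f 2 (lawX ν) := by
  obtain ⟨C, hC⟩ := h.1.exists_bound_of_continuousOn hf.continuousOn
  exact MemLp.of_bound hf.aestronglyMeasurable C (ae_mem_supp.mono hC)

lemma integral_lawX {f : EuclideanSpace ℝ (Fin d) → ℝ} (hf : Measurable f) :
    ∫ x, f x ∂(lawX ν) = ∫ p, f p.1 ∂ν :=
  integral_map measurable_fst.aemeasurable hf.aestronglyMeasurable

lemma isCompact_Theta [NeZero d] : IsCompact (Theta d) := by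
  refine (isCompact_sphere (0 : EuclideanSpace ℝ (Fin d)) 1).of_isClosed_subset ?_ ?_
  · exact (isClosed_eq continuous_norm continuous_const).inter
      (isClosed_le continuous_const (EuclideanSpace.proj 0).continuous)
  · intro θ hθ
    simpa using hθ.1

/-- The empirical variance of the index as a quadratic form in the index parameter. -/
lemma average_sq_sub_sq_eq {n : ℕ} (x : Fin n → EuclideanSpace ℝ (Fin d))
    (θ : EuclideanSpace ℝ (Fin d)) :
    (∑ i, inner ℝ θ (x i) ^ 2) / (n : ℝ) - ((∑ i, inner ℝ θ (x i)) / (n : ℝ)) ^ 2 =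
      ∑ j, ∑ k, θ j * θ k * ((∑ i, x i j * x i k) / (n : ℝ) -
        (∑ i, x i j) / (n : ℝ) * ((∑ i, x i k) / (n : ℝ))) := by
  have hin : ∀ y : EuclideanSpace ℝ (Fin d), inner ℝ θ y = ∑ j, θ j * y j := by
    intro y
    rw [PiLp.inner_apply]
    exact Finset.sum_congr rfl fun j _ => by simp [mul_comm]
  have e1 : (∑ i, inner ℝ θ (x i)) / (n : ℝ) = ∑ j, θ j * ((∑ i, x i j) / (n : ℝ)) := by
    simp only [hin]
    rw [Finset.sum_comm, Finset.sum_div]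
    refine Finset.sum_congr rfl fun j _ => ?_
    rw [← Finset.mul_sum, mul_div_assoc]
  have e2 : (∑ i, inner ℝ θ (x i) ^ 2) / (n : ℝ) =
      ∑ j, ∑ k, θ j * θ k * ((∑ i, x i j * x i k) / (n : ℝ)) := by
    simp only [hin, sq, Finset.sum_mul_sum]
    rw [Finset.sum_comm, Finset.sum_div]
    refine Finset.sum_congr rfl fun j _ => ?_
    rw [Finset.sum_comm, Finset.sum_div]
    refine Finset.sum_congr rfl fun k _ => ?_
    rw [mul_div_assoc', Finset.mul_sum]
    congr 1
    exact Finset.sum_congr rfl fun i _ => by ring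
  rw [e1, e2, sq, Finset.sum_mul_sum, ← Finset.sum_sub_distrib]
  refine Finset.sum_congr rfl fun j _ => ?_
  rw [← Finset.sum_sub_distrib]
  exact Finset.sum_congr rfl fun k _ => by ring

/-- An affine function of `s` has empirical second moment at least its empirical variance. -/
lemma le_rms_affine {n : ℕ} (hn : 0 < n) (s : Fin n → ℝ) {c : ℝ}
    (hs : c ^ 2 ≤ (∑ i, s i ^ 2) / (n : ℝ) - ((∑ i, s i) / (n : ℝ)) ^ 2) (α β : ℝ) :
    c * |β| ≤ rms fun i => α + β * s i := by
  have hn' : (0 : ℝ) < n := by exact_mod_cast hn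
  refine le_of_sq_le_sq ?_ (rms_nonneg _)
  rw [mul_pow, sq_abs, sq_rms, Fintype.card_fin]
  have h1 : ∑ i, (α + β * s i) ^ 2 = n * α ^ 2 + 2 * α * β * ∑ i, s i + β ^ 2 * ∑ i, s i ^ 2 := by
    simp_rw [add_sq, Finset.sum_add_distrib, Finset.mul_sum]
    simp only [Finset.sum_const, Finset.card_univ, Fintype.card_fin, nsmul_eq_mul]
    congr 1
    · congr 1
      exact Finset.sum_congr rfl fun i _ => by ring
    · exact Finset.sum_congr rfl fun i _ => by ring
  have hexp : (∑ i, (α + β * s i) ^ 2) / n =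
      β ^ 2 * ((∑ i, s i ^ 2) / n - ((∑ i, s i) / n) ^ 2) + (α + β * ((∑ i, s i) / n)) ^ 2 := by
    rw [h1]
    field_simp
    ring
  rw [hexp]
  have h2 := mul_le_mul_of_nonneg_left hs (sq_nonneg β)
  linarith [sq_nonneg (α + β * ((∑ i, s i) / n))]

lemma A1.whp_empirical_cov [IsProbabilityMeasure ν] [IsFiniteMeasure P] (h1 : A1 ν)
    (hlaw : ∀ i, HasLaw (z i) ν P) (hindep : iIndepFun z P) (j k : Fin d) {ε : ℝ} (hε : 0 < ε) :
    Whp P fun n => {ω | |((∑ i : Fin n, (z i ω).1 j * (z i ω).1 k) / (n : ℝ) -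
      (∑ i : Fin n, (z i ω).1 j) / (n : ℝ) * ((∑ i : Fin n, (z i ω).1 k) / (n : ℝ))) -
      cov[fun x : EuclideanSpace ℝ (Fin d) => x j, fun x => x k; lawX ν]| < ε} := by
  have hlln : ∀ f : EuclideanSpace ℝ (Fin d) → ℝ, Continuous f →
      ∀ᵐ ω ∂P, Tendsto (fun n : ℕ => (∑ i : Fin n, f (z i ω).1) / (n : ℝ)) atTop
        (𝓝 (∫ x, f x ∂(lawX ν))) := by
    intro f hf
    rw [integral_lawX hf.measurable]
    refine ae_tendsto_average hlaw hindep (f := fun p => f p.1)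
      (hf.measurable.comp measurable_fst) ?_
    exact (h1.integrable_of_continuous hf).comp_measurable measurable_fst
  have hmeas : ∀ f : EuclideanSpace ℝ (Fin d) → ℝ, Continuous f → ∀ n : ℕ,
      AEStronglyMeasurable (fun ω => (∑ i : Fin n, f (z i ω).1) / (n : ℝ)) P := fun f hf n =>
    aestronglyMeasurable_average hlaw (f := fun p => f p.1) (hf.measurable.comp measurable_fst) n
  have c1 : Continuous fun x : EuclideanSpace ℝ (Fin d) => x j := by fun_prop
  have c2 : Continuous fun x : EuclideanSpace ℝ (Fin d) => x k := by fun_prop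
  have c3 : Continuous fun x : EuclideanSpace ℝ (Fin d) => x j * x k := by fun_prop
  refine whp_of_ae_tendsto (fun n => ?_) ?_ hε
  · exact (hmeas _ c3 n).sub ((hmeas _ c1 n).mul (hmeas _ c2 n))
  · filter_upwards [hlln _ c3, hlln _ c1, hlln _ c2] with ω a1 a2 a3
    have hcov := covariance_eq_sub (h1.memLp (ν := ν) c1) (h1.memLp (ν := ν) c2)
    rw [hcov]
    exact a1.sub (a2.mul a3)

/-- Uniformly over the index parameter, the empirical variance of the index is bounded below. -/
lemma whp_cov [NeZero d] [IsProbabilityMeasure ν] [IsFiniteMeasure P] (h1 : A1 ν) (h4 : A4 ν)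
    (hlaw : ∀ i, HasLaw (z i) ν P) (hindep : iIndepFun z P) :
    ∃ c : ℝ, 0 < c ∧ Whp P fun n => {ω | ∀ θ ∈ Theta d, ∀ α β : ℝ,
      c * |β| ≤ rms fun i : Fin n => α + β * inner ℝ θ (z i ω).1} := by
  set C : Fin d → Fin d → ℝ := fun i j =>
    cov[fun x : EuclideanSpace ℝ (Fin d) => x i, fun x => x j; lawX ν] with hC
  set F : EuclideanSpace ℝ (Fin d) → ℝ := fun θ => ∑ j, ∑ k, θ j * θ k * C j k with hF
  have hFpos : ∀ θ ∈ Theta d, 0 < F θ := by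
    intro θ hθ
    have h0 : (WithLp.ofLp θ) ≠ 0 := by
      intro h0
      have : θ = 0 := by ext i; exact congrFun h0 i
      have hn := hθ.1
      rw [this, norm_zero] at hn
      exact zero_ne_one hn
    have := Matrix.PosDef.dotProduct_mulVec_pos h4 h0
    simp only [star_trivial, dotProduct, Matrix.mulVec, Finset.mul_sum, Matrix.of_apply] at this
    refine this.trans_eq (Finset.sum_congr rfl fun j _ => Finset.sum_congr rfl fun k _ => ?_)
    simp only [hC]
    ring
  obtain ⟨c₀, hc₀, hFc⟩ : ∃ c₀ : ℝ, 0 < c₀ ∧ ∀ θ ∈ Theta d, c₀ ≤ F θ := by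
    rcases (Theta d).eq_empty_or_nonempty with he | hne
    · exact ⟨1, one_pos, by simp [he]⟩
    · obtain ⟨θ, hθ, hmin⟩ := isCompact_Theta.exists_isMinOn hne
        (f := F) (by simp only [hF]; fun_prop)
      exact ⟨F θ, hFpos θ hθ, fun θ' h' => hmin h'⟩
  have hd : (0 : ℝ) < d := by exact_mod_cast Nat.pos_of_ne_zero (NeZero.ne d)
  set ε := c₀ / (2 * d ^ 2) with hε
  have hε0 : 0 < ε := by positivity
  refine ⟨√(c₀ / 2), by positivity, (Whp.biInter (Finset.univ : Finset (Fin d × Fin d))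
    fun jk _ => h1.whp_empirical_cov hlaw hindep jk.1 jk.2 hε0).mono ?_⟩
  filter_upwards [eventually_gt_atTop 0] with n hn ω hω θ hθ α β
  simp only [mem_iInter, mem_ofPred_eq, Finset.mem_univ, true_imp_iff, Prod.forall] at hω
  have hθ1 : ∀ j, |θ j| ≤ 1 := fun j => by
    have := PiLp.norm_apply_le θ j
    rwa [hθ.1] at this
  refine le_rms_affine hn (fun i : Fin n => inner ℝ θ (z i ω).1) ?_ α β
  rw [average_sq_sub_sq_eq (fun i : Fin n => (z i ω).1) θ, Real.sq_sqrt (by positivity)]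
  set D : Fin d → Fin d → ℝ := fun j k => (∑ i : Fin n, (z i ω).1 j * (z i ω).1 k) / (n : ℝ) -
      (∑ i : Fin n, (z i ω).1 j) / (n : ℝ) * ((∑ i : Fin n, (z i ω).1 k) / (n : ℝ)) with hD
  have hDC : ∀ j k, |D j k - C j k| ≤ ε := fun j k => (hω j k).le
  have h5 : |∑ j, ∑ k, θ j * θ k * D j k - F θ| ≤ c₀ / 2 := by
    rw [hF, ← Finset.sum_sub_distrib]
    simp_rw [← Finset.sum_sub_distrib, ← mul_sub]
    calc _ ≤ ∑ j : Fin d, ∑ k : Fin d, ε := by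
          refine (Finset.abs_sum_le_sum_abs _ _).trans (Finset.sum_le_sum fun j _ => ?_)
          refine (Finset.abs_sum_le_sum_abs _ _).trans (Finset.sum_le_sum fun k _ => ?_)
          rw [abs_mul, abs_mul]
          calc _ ≤ 1 * 1 * ε := mul_le_mul (mul_le_mul (hθ1 j) (hθ1 k) (abs_nonneg _)
                  zero_le_one) (hDC j k) (abs_nonneg _) (by norm_num)
            _ = ε := by ring
      _ = c₀ / 2 := by
          simp only [Finset.sum_const, Finset.card_univ, Fintype.card_fin, nsmul_eq_mul, hε]
          field_simp
  linarith [(abs_le.1 h5).1, hFc θ hθ]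

end Good

section NoiseEvent

variable {d : ℕ} {ν : Measure (EuclideanSpace ℝ (Fin d) × ℝ)}
  {Ω : Type*} [MeasurableSpace Ω] {P : Measure Ω}
  {z : ℕ → Ω → EuclideanSpace ℝ (Fin d) × ℝ}

lemma single_mem_Theta [NeZero d] : (EuclideanSpace.single (0 : Fin d) (1 : ℝ)) ∈ Theta d :=
  ⟨by simp, by simp⟩

/-- A net of the index set of mesh `d / n` and of polynomial cardinality, by rounding the
coordinates. -/
lemma exists_net [NeZero d] {n : ℕ} (hn : 0 < n) :
    ∃ γ : (Fin d → Fin (2 * n + 1)) → EuclideanSpace ℝ (Fin d), (∀ k, γ k ∈ Theta d) ∧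
      ∀ θ ∈ Theta d, ∃ k, ‖θ - γ k‖ ≤ d / n := by
  classical
  have hn' : (0 : ℝ) < n := by exact_mod_cast hn
  have hθ1 : ∀ θ ∈ Theta d, ∀ j, |θ j| ≤ 1 := fun θ hθ j => by
    have := PiLp.norm_apply_le θ j
    rwa [hθ.1] at this
  let φ : EuclideanSpace ℝ (Fin d) → Fin d → ℕ := fun θ j => ⌊n * (θ j + 1)⌋₊
  have hφ : ∀ θ ∈ Theta d, ∀ j, φ θ j < 2 * n + 1 := by
    intro θ hθ j
    rw [Nat.lt_succ_iff]
    refine Nat.floor_le_of_le ?_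
    push_cast
    nlinarith [(abs_le.1 (hθ1 θ hθ j)).2]
  have hrep : ∀ k : Fin d → Fin (2 * n + 1), ∃ γ ∈ Theta d,
      (∃ θ ∈ Theta d, ∀ j, φ θ j = k j) → ∀ j, φ γ j = k j := by
    intro k
    by_cases h : ∃ θ ∈ Theta d, ∀ j, φ θ j = k j
    · obtain ⟨θ, hθ, hk⟩ := h
      exact ⟨θ, hθ, fun _ => hk⟩
    · exact ⟨_, single_mem_Theta, fun h' => absurd h' h⟩
  choose rep hrep1 hrep2 using hrep
  refine ⟨rep, hrep1, fun θ hθ => ?_⟩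
  refine ⟨fun j => ⟨φ θ j, hφ θ hθ j⟩, ?_⟩
  set γ := rep fun j => ⟨φ θ j, hφ θ hθ j⟩ with hγ
  have h1 : γ ∈ Theta d := hrep1 _
  have h2 : ∀ j, φ γ j = φ θ j := hrep2 _ ⟨θ, hθ, fun _ => rfl⟩
  have h3 : ∀ j, |θ j - γ j| ≤ 1 / n := by
    intro j
    rw [le_div_iff₀ hn']
    have a1 := Nat.floor_le (show 0 ≤ n * (θ j + 1) from
      mul_nonneg hn'.le (by linarith [(abs_le.1 (hθ1 θ hθ j)).1]))
    have a2 := Nat.floor_le (show 0 ≤ n * (γ j + 1) from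
      mul_nonneg hn'.le (by linarith [(abs_le.1 (hθ1 γ h1 j)).1]))
    have a3 := Nat.lt_floor_add_one (n * (θ j + 1))
    have a4 := Nat.lt_floor_add_one (n * (γ j + 1))
    have a5 : ((⌊n * (γ j + 1)⌋₊ : ℕ) : ℝ) = (⌊n * (θ j + 1)⌋₊ : ℕ) := congrArg Nat.cast (h2 j)
    have a6 : |n * (θ j - γ j)| ≤ 1 := abs_le.2 ⟨by linarith, by linarith⟩
    rw [abs_mul, abs_of_pos hn'] at a6
    linarith
  have h4 : ‖θ - γ‖ ≤ ∑ j, ‖(θ - γ) j‖ := by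
    rw [EuclideanSpace.norm_eq]
    refine Real.sqrt_le_iff.2 ⟨Finset.sum_nonneg fun _ _ => norm_nonneg _, ?_⟩
    exact Finset.sum_sq_le_sq_sum_of_nonneg fun _ _ => norm_nonneg _
  refine h4.trans ?_
  calc ∑ j, ‖(θ - γ) j‖ ≤ ∑ _j : Fin d, 1 / (n : ℝ) := Finset.sum_le_sum fun j _ => h3 j
    _ = d / n := by simp [div_eq_mul_inv]

lemma measurable_cellVec {n : ℕ} (a L : ℝ) (N : ℕ) (γ : EuclideanSpace ℝ (Fin d))
    (k : Fin (2 * N + 1) × Fin 2) (i : Fin n) :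
    Measurable fun x : Fin n → EuclideanSpace ℝ (Fin d) =>
      cellVec a L N (fun i => inner ℝ γ (x i)) k i := by
  have ht : ∀ j : Fin n, Measurable fun x : Fin n → EuclideanSpace ℝ (Fin d) =>
      inner ℝ γ (x j) := fun j => by fun_prop
  have hG : Measurable fun x : Fin n → EuclideanSpace ℝ (Fin d) =>
      designScale a L (fun i => inner ℝ γ (x i)) i := by
    unfold designScale
    refine (((ht i).sub_const a).div_const L).add (Measurable.div_const ?_ _)
    simp_rw [Finset.card_filter]
    push_cast
    exact Finset.measurable_sum _ fun j _ =>
      Measurable.ite (measurableSet_lt (ht j) (ht i)) measurable_const measurable_const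
  unfold cellVec
  refine Measurable.ite ?_ ((ht i).pow_const _) measurable_const
  exact (Nat.measurable_floor.comp (hG.const_mul _)) (measurableSet_singleton _)

/-- A single noise bound holds except with exponentially small probability. The space in question
is spanned by `12 N + 5` vectors, and the constant `72 s` makes the exponent in the tail bound equal
to `12 N + 5 - 18 N`, which is at most `-N`. -/
lemma measure_not_noiseBound_le [IsProbabilityMeasure ν] [IsProbabilityMeasure P] {s : ℝ}
    (hs : 0 < s)
    (hν : ∀ᵐ x ∂(lawX ν), IsSubG s (condDistrib (Prod.snd : EuclideanSpace ℝ (Fin d) × ℝ → ℝ)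
        Prod.fst ν x))
    (hlaw : ∀ i, HasLaw (z i) ν P) (hindep : iIndepFun z P) {n : ℕ} (hn : 0 < n) {N : ℕ}
    (hN : 0 < N) (a L : ℝ) (γ : EuclideanSpace ℝ (Fin d)) {g : EuclideanSpace ℝ (Fin d) → ℝ}
    (hg : Measurable g) :
    P {ω | ¬ NoiseBound a L N (√(72 * s)) (fun i : Fin n => g (z i ω).1)
      (fun i : Fin n => inner ℝ γ (z i ω).1) (fun i : Fin n => (z i ω).2)} ≤
      ENNReal.ofReal (Real.exp (-N)) := by
  have hn' : (0 : ℝ) < n := by exact_mod_cast hn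
  have hN1 : (1 : ℝ) ≤ N := by exact_mod_cast hN
  let κ := Option ((Fin (2 * N + 1) × Fin 2) ⊕ (Fin (2 * (2 * N) + 1) × Fin 2))
  let w : κ → (Fin n → EuclideanSpace ℝ (Fin d)) → Fin n → ℝ := fun k x i =>
    match k with
    | none => g (x i)
    | some (Sum.inl k) => cellVec a L N (fun i => inner ℝ γ (x i)) k i
    | some (Sum.inr k) => cellVec a L (2 * N) (fun i => inner ℝ γ (x i)) k i
  have hw : ∀ k i, Measurable fun x => w k x i := by
    rintro (_ | k | k) i
    · exact hg.comp (measurable_pi_apply i)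
    · exact measurable_cellVec a L N γ k i
    · exact measurable_cellVec a L (2 * N) γ k i
  set r := √(72 * s) * √N with hr
  have hr0 : 0 ≤ r := by positivity
  have htail := measure_pi_exists_span_lt_le hs ν hν w hw hr0
  refine le_trans (le_trans (measure_mono ?_) (measure_sample_le hlaw hindep n _))
    (htail.trans ?_)
  · intro ω hω
    simp only [mem_ofPred_eq, NoiseBound, not_forall, not_le] at hω ⊢
    obtain ⟨c, u, v, ⟨qu, hu⟩, ⟨qv, hv⟩, hlt⟩ := hω
    let q : κ → ℝ := fun k => match k with
      | none => c
      | some (Sum.inl k) => qu k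
      | some (Sum.inr k) => qv k
    refine ⟨q, ?_⟩
    have hq : ∀ i, ∑ j, q j * w j (fun i : Fin n => (z i ω).1) i =
        c * g (z i ω).1 + (u i + v i) := by
      intro i
      rw [Fintype.sum_option, Fintype.sum_sum_type, hu i, hv i]
    simp_rw [hq]
    rw [edot, rms, Fintype.card_fin, lt_div_iff₀ hn', Real.sqrt_div (Nat.cast_nonneg _),
      Real.sqrt_div (Finset.sum_nonneg fun _ _ => sq_nonneg _)] at hlt
    refine lt_of_eq_of_lt ?_ hlt
    have : √(n : ℝ) * √n = n := Real.mul_self_sqrt hn'.le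
    have hsn : √(n : ℝ) ≠ 0 := (Real.sqrt_pos.2 hn').ne'
    rw [hr]
    field_simp
    rw [Real.sq_sqrt hn'.le]
  · refine ENNReal.ofReal_le_ofReal (Real.exp_le_exp.2 ?_)
    have hcard : (Fintype.card κ : ℝ) = 12 * N + 5 := by
      simp only [κ, Fintype.card_option, Fintype.card_sum, Fintype.card_prod, Fintype.card_fin]
      push_cast
      ring
    have hr2 : r ^ 2 / (4 * s) = 18 * N := by
      rw [hr, mul_pow, Real.sq_sqrt (by positivity), Real.sq_sqrt (by positivity)]
      field_simp
      norm_num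
    rw [hcard, hr2]
    linarith

/-- The base level of the chaining argument: the rounded-up value of `n^{1/5}`. -/
noncomputable def baseLevel (n : ℕ) : ℕ := ⌈(n : ℝ) ^ (1 / 5 : ℝ)⌉₊

/-- The size of the net of index parameters and the number of chaining levels are polynomial in the
sample size, so a union bound over both is affordable. -/
lemma tendsto_union_bound (d : ℕ) :
    Tendsto (fun n : ℕ => ((2 * n + 1 : ℕ) : ℝ) ^ d * n * Real.exp (-(n : ℝ) ^ (1 / 5 : ℝ)))
      atTop (𝓝 0) := by
  have h1 : Tendsto (fun n : ℕ => (n : ℝ) ^ (1 / 5 : ℝ)) atTop atTop :=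
    (tendsto_rpow_atTop (by norm_num)).comp tendsto_natCast_atTop_atTop
  have h2 := ((Real.tendsto_pow_mul_exp_neg_atTop_nhds_zero (5 * (d + 1))).comp h1).const_mul
    ((3 : ℝ) ^ d)
  rw [mul_zero] at h2
  refine tendsto_of_tendsto_of_tendsto_of_le_of_le' tendsto_const_nhds h2
    (Eventually.of_forall fun n => by positivity) ?_
  filter_upwards [eventually_ge_atTop 1] with n hn
  have hn1 : (1 : ℝ) ≤ n := by exact_mod_cast hn
  simp only [Function.comp_apply]
  have h3 : ((n : ℝ) ^ (1 / 5 : ℝ)) ^ (5 * (d + 1)) = (n : ℝ) ^ d * n := by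
    have h5 : ((n : ℝ) ^ (1 / 5 : ℝ)) ^ 5 = n := by
      rw [← Real.rpow_natCast, ← Real.rpow_mul (by positivity)]
      norm_num
    rw [pow_mul, h5, pow_succ]
  rw [h3, ← mul_assoc]
  refine mul_le_mul_of_nonneg_right ?_ (Real.exp_pos _).le
  rw [← mul_assoc, ← mul_pow]
  refine mul_le_mul_of_nonneg_right ?_ (by positivity)
  refine pow_le_pow_left₀ (by positivity) ?_ d
  push_cast
  linarith

/-- With probability tending to one, every index parameter is close to one for which the noise
bound holds on all levels. -/
lemma whp_noise [NeZero d] [IsProbabilityMeasure ν] [IsProbabilityMeasure P] {s : ℝ} (hs : 0 < s)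
    (hν : ∀ᵐ x ∂(lawX ν), IsSubG s (condDistrib (Prod.snd : EuclideanSpace ℝ (Fin d) × ℝ → ℝ)
        Prod.fst ν x))
    (hlaw : ∀ i, HasLaw (z i) ν P) (hindep : iIndepFun z P) (a L : ℝ)
    {g : EuclideanSpace ℝ (Fin d) → ℝ} (hg : Measurable g) :
    Whp P fun n => {ω | ∀ θ ∈ Theta d, ∃ γ ∈ Theta d, ‖θ - γ‖ ≤ d / n ∧
      ∀ k < n, NoiseBound a L (2 ^ k * baseLevel n) (√(72 * s)) (fun i : Fin n => g (z i ω).1)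
        (fun i : Fin n => inner ℝ γ (z i ω).1) (fun i : Fin n => (z i ω).2)} := by
  have h0 := ENNReal.tendsto_ofReal (tendsto_union_bound d)
  rw [ENNReal.ofReal_zero] at h0
  refine tendsto_of_tendsto_of_tendsto_of_le_of_le' tendsto_const_nhds h0
    (Eventually.of_forall fun _ => zero_le) ?_
  filter_upwards [eventually_ge_atTop 1] with n hn
  obtain ⟨γ, hγ, hnet⟩ := exists_net (d := d) hn
  set ρ := (n : ℝ) ^ (1 / 5 : ℝ) with hρ
  have hρ1 : 0 < ρ := Real.rpow_pos_of_pos (by exact_mod_cast hn) _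
  have hbase : 0 < baseLevel n := Nat.ceil_pos.2 hρ1
  have hsub : {ω | ∀ θ ∈ Theta d, ∃ γ ∈ Theta d, ‖θ - γ‖ ≤ d / n ∧
      ∀ k < n, NoiseBound a L (2 ^ k * baseLevel n) (√(72 * s)) (fun i : Fin n => g (z i ω).1)
        (fun i : Fin n => inner ℝ γ (z i ω).1) (fun i : Fin n => (z i ω).2)}ᶜ ⊆
      ⋃ vk : (Fin d → Fin (2 * n + 1)) × Fin n,
        {ω | ¬ NoiseBound a L (2 ^ (vk.2 : ℕ) * baseLevel n) (√(72 * s))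
          (fun i : Fin n => g (z i ω).1) (fun i : Fin n => inner ℝ (γ vk.1) (z i ω).1)
          (fun i : Fin n => (z i ω).2)} := by
    intro ω hω
    by_contra hcon
    simp only [mem_iUnion, mem_ofPred_eq, not_exists, not_not, Prod.forall] at hcon
    refine hω fun θ hθ => ?_
    obtain ⟨v, hv⟩ := hnet θ hθ
    exact ⟨γ v, hγ v, hv, fun k hk => hcon v ⟨k, hk⟩⟩
  refine (measure_mono hsub).trans ((measure_iUnion_fintype_le _ _).trans ?_)
  calc _ ≤ ∑ _vk : (Fin d → Fin (2 * n + 1)) × Fin n, ENNReal.ofReal (Real.exp (-ρ)) := by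
        refine Finset.sum_le_sum fun vk _ => ?_
        refine (measure_not_noiseBound_le hs hν hlaw hindep hn (by positivity) a L _ hg).trans ?_
        refine ENNReal.ofReal_le_ofReal (Real.exp_le_exp.2 (neg_le_neg ?_))
        have h1 : ρ ≤ baseLevel n := Nat.le_ceil _
        have h2 : (1 : ℝ) ≤ 2 ^ (vk.2 : ℕ) := one_le_pow₀ (by norm_num)
        push_cast
        nlinarith
    _ = _ := by
        rw [Finset.sum_const, nsmul_eq_mul, Finset.card_univ, ENNReal.ofReal_mul (by positivity)]
        congr 1
        rw [← ENNReal.ofReal_natCast]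
        congr 1
        simp

end NoiseEvent

/-! ### Boundedness and rate of the estimator -/

section Estimator

variable {d : ℕ} {ν : Measure (EuclideanSpace ℝ (Fin d) × ℝ)}

lemma inner_mem_dom [NeZero d] {χ : Set (EuclideanSpace ℝ (Fin d))}
    {θ x : EuclideanSpace ℝ (Fin d)} (hθ : θ ∈ Theta d) (hx : x ∈ χ) : inner ℝ θ x ∈ dom χ :=
  subset_convexHull ℝ _ ⟨θ, hθ, x, hx, rfl⟩

/-- The domain is a nondegenerate compact interval. -/
lemma exists_dom_eq_Icc [NeZero d] [IsProbabilityMeasure ν] (h1 : A1 ν) (h4 : A4 ν) :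
    ∃ a L : ℝ, 0 < L ∧ dom (supp ν) = Icc a (a + L) := by
  set S : Set ℝ := {t | ∃ θ ∈ Theta d, ∃ x ∈ supp ν, inner ℝ θ x = t} with hS
  have hSc : IsCompact S := by
    have : S = (fun p : EuclideanSpace ℝ (Fin d) × EuclideanSpace ℝ (Fin d) =>
        inner ℝ p.1 p.2) '' (Theta d ×ˢ supp ν) := by
      ext t
      simp only [hS, mem_ofPred_eq, mem_image, mem_prod, Prod.exists]
      constructor
      · rintro ⟨θ, hθ, x, hx, rfl⟩; exact ⟨θ, x, ⟨hθ, hx⟩, rfl⟩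
      · rintro ⟨θ, x, ⟨hθ, hx⟩, rfl⟩; exact ⟨θ, hθ, x, hx, rfl⟩
    rw [this]
    exact (isCompact_Theta.prod h1.1).image (by fun_prop)
  have hne : S.Nonempty := by
    obtain ⟨x, hx⟩ := Measure.nonempty_support (IsProbabilityMeasure.ne_zero (lawX ν))
    exact ⟨_, _, single_mem_Theta, x, hx, rfl⟩
  obtain ⟨a, ha⟩ := hSc.exists_isLeast hne
  obtain ⟨b, hb⟩ := hSc.exists_isGreatest hne
  have hdom : dom (supp ν) = Icc a b := by
    refine Subset.antisymm (convexHull_min (fun t ht => ⟨ha.2 ht, hb.2 ht⟩) (convex_Icc a b)) ?_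
    rw [← segment_eq_Icc (ha.2 hb.1)]
    exact (convex_convexHull ℝ S).segment_subset (subset_convexHull ℝ S ha.1)
      (subset_convexHull ℝ S hb.1)
  refine ⟨a, b - a, ?_, by rw [hdom]; congr 1; ring⟩
  by_contra hcon
  -- otherwise the first coordinate of `X` is constant
  have h0 : ∀ᵐ x ∂(lawX ν), x 0 = a := by
    filter_upwards [ae_mem_supp] with x hx
    have hx' := inner_mem_dom (single_mem_Theta (d := d)) hx
    rw [hdom] at hx'
    have e1 : inner ℝ (EuclideanSpace.single (0 : Fin d) (1 : ℝ)) x = x 0 := by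
      simp [EuclideanSpace.inner_single_left]
    rw [e1] at hx'
    linarith [hx'.1, hx'.2]
  have hdiag := Matrix.PosDef.diag_pos h4 (i := 0)
  simp only [Matrix.of_apply] at hdiag
  have hvar : cov[fun x : EuclideanSpace ℝ (Fin d) => x 0, fun x => x 0; lawX ν] = 0 := by
    have hm : ∫ x, x 0 ∂(lawX ν) = a := by
      rw [integral_congr_ae h0]; simp
    rw [covariance, integral_eq_zero_of_ae]
    filter_upwards [h0] with x hx
    rw [hm, hx]
    simp
  rw [hvar] at hdiag
  exact lt_irrefl _ hdiag

/-- The basic inequality: comparison of the penalized loss of the estimator with that of the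
truth. -/
lemma IsPLSE.basic_ineq [NeZero d] {D : Set ℝ} {n : ℕ} {x : ℕ → EuclideanSpace ℝ (Fin d)}
    {y e : ℕ → ℝ} {m₀ : ℝ → ℝ} {θ₀ : EuclideanSpace ℝ (Fin d)} (hθ₀ : θ₀ ∈ Theta d)
    (hm₀ : m₀ ∈ classR D) (hJ₀ : Jsq D m₀ < ∞) (hy : ∀ i, y i = m₀ (inner ℝ θ₀ (x i)) + e i)
    {l : ℝ} (hl : l ≠ 0) {m : ℝ → ℝ} {θ : EuclideanSpace ℝ (Fin d)}
    (h : IsPLSE D n x y l m θ) :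
    ∃ J : ℝ, 0 ≤ J ∧ Jsq D m = ENNReal.ofReal (J ^ 2) ∧
      rms (fun i : Fin n => m (inner ℝ θ (x i)) - m₀ (inner ℝ θ₀ (x i))) ^ 2 + l ^ 2 * J ^ 2 ≤
        2 * edot (fun i : Fin n => e i)
          (fun i : Fin n => m (inner ℝ θ (x i)) - m₀ (inner ℝ θ₀ (x i))) +
        l ^ 2 * √((Jsq D m₀).toReal) ^ 2 := by
  have hmin := h.2.2 m₀ hm₀ θ₀ hθ₀
  unfold penLoss at hmin
  have hl2 : 0 < l ^ 2 := by positivity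
  have hfin : Jsq D m ≠ ∞ := by
    intro htop
    rw [htop, ENNReal.mul_top (by simpa using hl), add_top, top_le_iff] at hmin
    exact ENNReal.add_ne_top.2 ⟨ENNReal.ofReal_ne_top,
      ENNReal.mul_ne_top ENNReal.ofReal_ne_top hJ₀.ne⟩ hmin
  have hJ0 : 0 ≤ (Jsq D m).toReal := ENNReal.toReal_nonneg
  have hJ00 : 0 ≤ (Jsq D m₀).toReal := ENNReal.toReal_nonneg
  refine ⟨√((Jsq D m).toReal), Real.sqrt_nonneg _, ?_, ?_⟩
  · rw [Real.sq_sqrt hJ0, ENNReal.ofReal_toReal hfin]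
  rw [Real.sq_sqrt hJ0, Real.sq_sqrt hJ00]
  have hQ : ∀ m θ, 0 ≤ Qn n x y m θ := fun m θ =>
    mul_nonneg (by positivity) (Finset.sum_nonneg fun _ _ => sq_nonneg _)
  rw [← ENNReal.ofReal_toReal hfin, ← ENNReal.ofReal_toReal hJ₀.ne,
    ← ENNReal.ofReal_mul hl2.le, ← ENNReal.ofReal_mul hl2.le,
    ← ENNReal.ofReal_add (hQ _ _) (by positivity), ← ENNReal.ofReal_add (hQ _ _) (by positivity),
    ENNReal.ofReal_le_ofReal_iff (add_nonneg (hQ _ _) (by positivity))] at hmin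
  have e1 : Qn n x y m₀ θ₀ = (∑ i : Fin n, e i ^ 2) / n := by
    rw [Qn, Finset.sum_range, one_div, inv_mul_eq_div]
    simp [hy]
  have e2 : Qn n x y m θ = (∑ i : Fin n, e i ^ 2) / n - 2 * edot (fun i : Fin n => e i)
      (fun i : Fin n => m (inner ℝ θ (x i)) - m₀ (inner ℝ θ₀ (x i))) +
      rms (fun i : Fin n => m (inner ℝ θ (x i)) - m₀ (inner ℝ θ₀ (x i))) ^ 2 := by
    rw [Qn, Finset.sum_range, one_div, inv_mul_eq_div, sq_rms, edot, Fintype.card_fin,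
      ← mul_div_assoc, ← sub_div, ← add_div, Finset.mul_sum, ← Finset.sum_sub_distrib,
      ← Finset.sum_add_distrib]
    congr 1
    refine Finset.sum_congr rfl fun i _ => ?_
    rw [hy]
    ring
  rw [e1, e2] at hmin
  linarith

lemma SmoothOn.continuousOn {a b : ℝ} {m p : ℝ → ℝ} {q : ℝ → ℝ≥0∞} (h : SmoothOn a b m p q) :
    ContinuousOn m (Icc a b) := fun t ht => (h.deriv t ht).continuousWithinAt

lemma measurable_comp_projIcc {a b : ℝ} (hab : a ≤ b) {m : ℝ → ℝ} (hm : ContinuousOn m (Icc a b))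
    (θ : EuclideanSpace ℝ (Fin d)) :
    Measurable fun x : EuclideanSpace ℝ (Fin d) => m (projIcc a b hab (inner ℝ θ x)) := by
  have h1 : Continuous fun t : Icc a b => m t := continuousOn_iff_continuous_domRestrict.1 hm
  exact (h1.comp (continuous_projIcc.comp (by fun_prop))).measurable

variable {Ω : Type*} [MeasurableSpace Ω] {P : Measure Ω} [IsProbabilityMeasure P]
  {z : ℕ → Ω → EuclideanSpace ℝ (Fin d) × ℝ}

/-- With probability tending to one, any penalized least squares estimator whose tuning parameter
is at least of the order `n^{-2/5}` is bounded in the roughness and `C¹` norms and has an empirical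
error of at most the order of the tuning parameter. -/
lemma whp_estimator_bounds [NeZero d] [IsProbabilityMeasure ν] (h1 : A1 ν) (h2 : A2 ν)
    (h4 : A4 ν) {m₀ : ℝ → ℝ} (hP1 : P1 (dom (supp ν)) m₀) {θ₀ : EuclideanSpace ℝ (Fin d)}
    (hθ₀ : θ₀ ∈ Theta d) (hlaw : ∀ i, HasLaw (z i) ν P) (hindep : iIndepFun z P) {B : ℝ}
    (hB : 0 ≤ B) :
    ∃ K : ℝ, 0 ≤ K ∧ Whp P fun n => {ω | ∀ (y : ℕ → ℝ) (l : ℝ) (m : ℝ → ℝ)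
      (θ : EuclideanSpace ℝ (Fin d)), (∀ i, (z i ω).1 ∈ supp ν) →
      (∀ i, y i = m₀ (inner ℝ θ₀ (z i ω).1) + (z i ω).2) → l ≠ 0 →
      |l⁻¹| ≤ B * (n : ℝ) ^ (2 / 5 : ℝ) → |l| ≤ 1 →
      IsPLSE (dom (supp ν)) n (fun i => (z i ω).1) y l m θ →
      Jsq (dom (supp ν)) m ≤ ENNReal.ofReal (K ^ 2) ∧
      (∀ t ∈ dom (supp ν), |m t| ≤ K ∧ |derivWithin m (dom (supp ν)) t| ≤ K) ∧
      rms (fun i : Fin n => m (inner ℝ θ (z i ω).1) - m₀ (inner ℝ θ₀ (z i ω).1)) ≤ K * |l|} := by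
  obtain ⟨a, L, hL, hdom⟩ := exists_dom_eq_Icc h1 h4
  obtain ⟨s, hs, hsub⟩ := h2.ae_isSubG
  obtain ⟨C₂, hC₂⟩ := whp_rms_noise_le h2 hlaw hindep
  obtain ⟨c, hc, hcov⟩ := whp_cov h1 h4 hlaw hindep
  obtain ⟨-, T, hT⟩ := h1
  obtain ⟨hm₀, ⟨M₀, hM₀⟩, hJ₀⟩ := hP1
  have hinn : ∀ θ ∈ Theta d, ∀ x ∈ supp ν, inner ℝ θ x ∈ Icc a (a + L) := fun θ hθ x hx => by
    rw [← hdom]; exact inner_mem_dom hθ hx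
  rw [hdom] at hm₀ hM₀ hJ₀
  simp only [hdom]
  have haL : a ≤ a + L := by linarith
  obtain ⟨q₀, hq₀, -⟩ := classR.exists_smoothOn hm₀
  set g : EuclideanSpace ℝ (Fin d) → ℝ :=
    fun x => m₀ (projIcc a (a + L) haL (inner ℝ θ₀ x)) with hg
  have hgx : ∀ x ∈ supp ν, g x = m₀ (inner ℝ θ₀ x) := fun x hx => by
    simp only [hg, projIcc_of_mem haL (hinn θ₀ hθ₀ x hx)]
  have hnoise := whp_noise hs hsub hlaw hindep a L
    (measurable_comp_projIcc haL hq₀.continuousOn θ₀)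
  -- `K₁` bounds the noise term, `K₂` the roughness and the ratio of the empirical error to `|l|`,
  -- `K₃` the slope
  set S := √(L ^ 3) with hS
  set C₁ := √(72 * s) with hC₁
  set K₁ := (C₂ + 2 * C₁) * (T * d / c) * (1 + M₀ + S) + 2 * C₁ + 10 * C₁ * S + C₂ * S with hK₁
  set J₀ := √((Jsq (Icc a (a + L)) m₀).toReal) with hJ₀def
  set K₂ := 2 * (2 * K₁ * (B ^ 2 + B) + J₀ ^ 2) + 1 with hK₂
  set K₃ := (K₂ + M₀ + S * K₂) / c with hK₃
  refine ⟨|K₂| + |K₃| + |K₂ + M₀ + K₃ * L|, by positivity, ((hC₂.inter hcov).inter hnoise).mono ?_⟩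
  filter_upwards [eventually_ge_atTop 1] with n hn
  rintro ω ⟨⟨hω1, hω2⟩, hω3⟩ y l m θ hx hy hl hlB hl1 hplse
  simp only [mem_ofPred_eq] at hω1 hω2 hω3
  have : Nonempty (Fin n) := ⟨⟨0, hn⟩⟩
  have hn1 : (1 : ℝ) ≤ n := by exact_mod_cast hn
  have hθ := hplse.2.1
  obtain ⟨J, hJ0, hJ, hbasic⟩ := hplse.basic_ineq (e := fun i => (z i ω).2) hθ₀ hm₀ hJ₀ hy hl
  obtain ⟨q, hq, hqJ⟩ := classR.exists_smoothOn hplse.1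
  have hqJ' := (hqJ.trans hJ).le
  have hlpos : 0 < |l| := abs_pos.2 hl
  obtain ⟨γ, hγ, hγn, hb⟩ := hω3 θ hθ
  have hgz : (fun i : Fin n => g (z i ω).1) = fun i : Fin n => m₀ (inner ℝ θ₀ (z i ω).1) :=
    funext fun i => hgx _ (hx i)
  rw [hgz] at hb
  set ρ := (n : ℝ) ^ (1 / 5 : ℝ) with hρ
  have hρ1 : 1 ≤ ρ := Real.one_le_rpow hn1 (by norm_num)
  have hρ5 : ρ ^ 5 = n := by
    rw [hρ, ← Real.rpow_natCast, ← Real.rpow_mul (by positivity)]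
    norm_num
  have hρ2 : ρ ^ 2 = (n : ℝ) ^ (2 / 5 : ℝ) := by
    rw [hρ, ← Real.rpow_natCast, ← Real.rpow_mul (by positivity)]
    norm_num
  have hN1 : ρ ≤ baseLevel n := Nat.le_ceil _
  have hN2 : (baseLevel n : ℝ) ≤ 2 * ρ := by
    have := (Nat.ceil_lt_add_one (by positivity : 0 ≤ ρ)).le
    have h' : (baseLevel n : ℝ) ≤ ρ + 1 := this
    linarith
  have hM₀' : ∀ i : Fin n, |m₀ (inner ℝ θ₀ (z i ω).1)| ≤ M₀ := fun i =>
    hM₀ _ (hinn θ₀ hθ₀ _ (hx i))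
  have hM00 : 0 ≤ M₀ := (abs_nonneg _).trans (hM₀' ⟨0, hn⟩)
  have hT0 : 0 ≤ T := (norm_nonneg _).trans (hT _ (hx 0))
  have hC20 : 0 ≤ C₂ := (rms_nonneg _).trans hω1
  have hosc := edot_le_of_near (x := fun i : Fin n => (z i ω).1) hL
    (fun i => hinn θ hθ _ (hx i)) (fun i => hinn γ hγ _ (hx i)) (T := T)
    (fun i => hT _ (hx i)) (Real.sqrt_nonneg (72 * s)) hω1 hM₀' hc (hω2 θ hθ)
    (Nat.cast_nonneg d) (by rw [Fintype.card_fin]; exact hγn) hρ1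
    (by rw [Fintype.card_fin]; exact hρ5) hN1 hN2
    (by rw [Fintype.card_fin]; exact hb) hq hJ0 hqJ'
  rw [← hS, ← hC₁, ← hK₁] at hosc
  set A := rms (fun i : Fin n => m (inner ℝ θ (z i ω).1) - m₀ (inner ℝ θ₀ (z i ω).1)) with hA
  have hμl : 1 / ρ ^ 2 ≤ B * |l| := by
    rw [div_le_iff₀ (by positivity), hρ2]
    rw [abs_inv, inv_le_iff_one_le_mul₀ hlpos] at hlB
    calc 1 ≤ |l| * (B * (n : ℝ) ^ (2 / 5 : ℝ)) := by rwa [mul_comm]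
      _ = _ := by ring
  have hK10 : 0 ≤ K₁ := by positivity
  have hK20 : 0 ≤ K₂ := by positivity
  have hK30 : 0 ≤ K₃ := by positivity
  obtain ⟨hA1, hJ1⟩ := bound_of_basic_ineq (A := A) (J := J) (l := |l|) (μ := 1 / ρ ^ 2) (K := K₁)
    (B := B) (J₀ := J₀) (rms_nonneg _) hJ0 hlpos (by positivity) hK10 hB hμl (by
      rw [sq_abs]
      linarith)
  rw [← hK₂] at hA1 hJ1
  have hAK : A ≤ K₂ := hA1.trans (mul_le_of_le_one_right hK20 hl1)
  have hrms : rms (fun i : Fin n => m (inner ℝ θ (z i ω).1)) ≤ K₂ + M₀ := by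
    have e1 : (fun i : Fin n => m (inner ℝ θ (z i ω).1)) = fun i : Fin n =>
        (m (inner ℝ θ (z i ω).1) - m₀ (inner ℝ θ₀ (z i ω).1)) + m₀ (inner ℝ θ₀ (z i ω).1) := by
      ext; ring
    rw [e1]
    exact (rms_add_le _ _).trans (add_le_add hAK (rms_le_of_abs_le hM00 hM₀'))
  have hslope : ∀ t ∈ Icc a (a + L), |derivWithin m (Icc a (a + L)) t| ≤ K₃ := fun t ht =>
    (hq.abs_deriv_le_of_rms hJ0 hqJ' hL (fun i : Fin n => hinn θ hθ _ (hx i)) hc (hω2 θ hθ)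
      ht).trans (div_le_div_of_nonneg_right
        (add_le_add hrms (mul_le_mul_of_nonneg_left hJ1 (Real.sqrt_nonneg _))) hc.le)
  have hval : ∀ t ∈ Icc a (a + L), |m t| ≤ K₂ + M₀ + K₃ * L := by
    intro t ht
    obtain ⟨i, hi⟩ := exists_abs_le_rms fun i : Fin n => m (inner ℝ θ (z i ω).1)
    have hti := hinn θ hθ _ (hx i)
    have h5 := hq.abs_image_sub_le hslope hti ht
    have h6 : |t - inner ℝ θ (z i ω).1| ≤ L := abs_sub_le_iff.2
      ⟨by linarith [ht.2, hti.1], by linarith [ht.1, hti.2]⟩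
    have h7 := mul_le_mul_of_nonneg_left h6 hK30
    have h8 := abs_sub_abs_le_abs_sub (m t) (m (inner ℝ θ (z i ω).1))
    linarith
  have hK2' := le_abs_self K₂
  have hK3' := le_abs_self K₃
  have hK4' := le_abs_self (K₂ + M₀ + K₃ * L)
  have n2 := abs_nonneg K₂
  have n3 := abs_nonneg K₃
  have n4 := abs_nonneg (K₂ + M₀ + K₃ * L)
  refine ⟨?_, fun t ht => ⟨?_, ?_⟩, ?_⟩
  · rw [hJ]
    exact ENNReal.ofReal_le_ofReal (pow_le_pow_left₀ hJ0 (by linarith) 2)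
  · linarith [hval t ht]
  · linarith [hslope t ht]
  · exact hA1.trans (mul_le_mul_of_nonneg_right (by linarith) hlpos.le)

end Estimator

/-! ### Identifiability -/

section Identifiability

variable {d : ℕ} {ν : Measure (EuclideanSpace ℝ (Fin d) × ℝ)}

lemma eq_on_support_of_ae_eq {X : Type*} [TopologicalSpace X] [MeasurableSpace X]
    [HereditarilyLindelofSpace X] {μ : Measure X} {f g : X → ℝ} (hf : ContinuousOn f μ.support)
    (hg : ContinuousOn g μ.support) (h : f =ᵐ[μ] g) : EqOn f g μ.support := by
  intro x hx
  by_contra hne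
  have h1 : ∀ᶠ y in 𝓝[μ.support] x, f y - g y ≠ 0 :=
    ((hf x hx).sub (hg x hx)).eventually_ne (sub_ne_zero.2 hne)
  have h2 : {y | y ∈ μ.support → f y - g y ≠ 0} ∈ 𝓝 x := eventually_nhdsWithin_iff.1 h1
  have h3 := (Measure.mem_support_iff_forall x).1 hx _ h2
  have h4 : μ {y | y ∈ μ.support → f y - g y ≠ 0} = 0 := by
    have : ∀ᵐ y ∂μ, ¬ (y ∈ μ.support → f y - g y ≠ 0) := by
      filter_upwards [h, Measure.support_mem_ae] with y hy hys
      exact fun hc => hc hys (sub_eq_zero.2 hy)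
    simpa [ae_iff] using this
  exact h3.ne' h4

/-- A function that vanishes on a measurable set has derivative zero at almost every point of the
set, namely at its Lebesgue density points. -/
lemma ae_fderiv_eq_zero_of_eqOn_zero {k : ℕ} {s : Set (Fin k → ℝ)} (hs : MeasurableSet s)
    {f : (Fin k → ℝ) → ℝ} {f' : (Fin k → ℝ) → (Fin k → ℝ) →L[ℝ] ℝ} (h0 : ∀ x ∈ s, f x = 0)
    (hf : ∀ x ∈ s, HasFDerivWithinAt f (f' x) s x) (i : Fin k) :
    ∀ᵐ x, x ∈ s → f' x = 0 := by
  -- the derivative bound is available for maps of a space to itself, so `f` is multiplied by a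
  -- fixed nonzero vector
  set u : Fin k → ℝ := Pi.single i 1 with hu
  have happ : ApproximatesLinearOn (fun x => f x • u) (0 : (Fin k → ℝ) →L[ℝ] (Fin k → ℝ)) s 0 := by
    intro x hx y hy
    simp [h0 x hx, h0 y hy]
  have hder : ∀ x ∈ s, HasFDerivWithinAt (fun x => f x • u) ((f' x).smulRight u) s x :=
    fun x hx => (hf x hx).smul_const u
  have h := happ.norm_fderiv_sub_le volume hs _ hder
  rw [ae_restrict_iff' hs] at h
  filter_upwards [h] with x hx hxs
  have h1 := hx hxs
  rw [nonpos_iff_eq_zero, nnnorm_eq_zero, sub_zero] at h1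
  ext v
  have h2 := congrFun (congrArg (fun A : (Fin k → ℝ) →L[ℝ] (Fin k → ℝ) => A v) h1) i
  simpa [hu] using h2

/-- The point with continuous coordinates `w` and discrete coordinates `v`. -/
noncomputable def glue {d₁ : ℕ} (w : Fin d₁ → ℝ) (v : Fin (d - d₁) → ℝ) :
    EuclideanSpace ℝ (Fin d) :=
  WithLp.toLp 2 fun k => if hk : (k : ℕ) < d₁ then w ⟨k, hk⟩ else v ⟨k - d₁, by omega⟩

lemma glue_contPart_discPart {d₁ : ℕ} (h : d₁ ≤ d) (x : EuclideanSpace ℝ (Fin d)) :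
    glue (contPart h x) (discPart h x) = x := by
  ext k
  by_cases hk : (k : ℕ) < d₁
  · simp [glue, hk, contPart]
  · have : (⟨d₁ + (k - d₁), by omega⟩ : Fin d) = k := Fin.ext (by simp; omega)
    simp [glue, hk, discPart, this]

lemma inner_eq_contPart_add_discPart {d₁ : ℕ} (h : d₁ ≤ d) (θ x : EuclideanSpace ℝ (Fin d)) :
    inner ℝ θ x = ∑ i, contPart h θ i * contPart h x i + ∑ j, discPart h θ j * discPart h x j := by
  have h' : d₁ + (d - d₁) = d := by omega
  have h1 : inner ℝ θ x = ∑ k, θ k * x k := by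
    rw [PiLp.inner_apply]
    exact Finset.sum_congr rfl fun j _ => by simp [mul_comm]
  rw [h1, ← Fin.sum_congr' _ h', Fin.sum_univ_add]
  rfl

lemma inner_glue {d₁ : ℕ} (h : d₁ ≤ d) (θ : EuclideanSpace ℝ (Fin d)) (w : Fin d₁ → ℝ)
    (v : Fin (d - d₁) → ℝ) :
    inner ℝ θ (glue w v) = ∑ i, contPart h θ i * w i + ∑ j, discPart h θ j * v j := by
  rw [inner_eq_contPart_add_discPart h]
  congr 1
  · refine Finset.sum_congr rfl fun i _ => ?_
    simp [contPart, glue]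
  · refine Finset.sum_congr rfl fun i _ => ?_
    simp [discPart, glue]

lemma continuous_glue {d₁ : ℕ} (v : Fin (d - d₁) → ℝ) :
    Continuous fun w : Fin d₁ → ℝ => (glue w v : EuclideanSpace ℝ (Fin d)) := by
  refine (PiLp.continuous_toLp 2 _).comp (continuous_pi fun k => ?_)
  by_cases hk : (k : ℕ) < d₁
  · simpa [hk] using continuous_apply _
  · simpa [hk] using continuous_const

/-- If two ridge functions agree on the support, then their gradients in the continuous
coordinates agree almost surely. -/
lemma ae_gradient_eq [NeZero d] {d₁ : ℕ} (h : d₁ ≤ d)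
    (hac : (lawX ν).map (contPart h) ≪ volume) {S : Set (Fin (d - d₁) → ℝ)} (hS : S.Countable)
    (hdisc : ∀ᵐ x ∂(lawX ν), discPart h x ∈ S) {m m₀ p p₀ : ℝ → ℝ}
    (hm : ∀ t ∈ dom (supp ν), HasDerivWithinAt m (p t) (dom (supp ν)) t)
    (hm₀ : ∀ t ∈ dom (supp ν), HasDerivWithinAt m₀ (p₀ t) (dom (supp ν)) t)
    {θ θ₀ : EuclideanSpace ℝ (Fin d)} (hθ : θ ∈ Theta d) (hθ₀ : θ₀ ∈ Theta d)
    (heq : ∀ x ∈ supp ν, m (inner ℝ θ x) = m₀ (inner ℝ θ₀ x)) :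
    ∀ᵐ x ∂(lawX ν), ∀ i, p (inner ℝ θ x) * contPart h θ i =
      p₀ (inner ℝ θ₀ x) * contPart h θ₀ i := by
  rcases Nat.eq_zero_or_pos d₁ with hz | hpos
  · subst hz
    exact ae_of_all _ fun x i => i.elim0
  have key : ∀ v : Fin (d - d₁) → ℝ, ∀ᵐ w : Fin d₁ → ℝ, glue w v ∈ supp ν →
      ∀ i, p (inner ℝ θ (glue w v)) * contPart h θ i =
        p₀ (inner ℝ θ₀ (glue w v)) * contPart h θ₀ i := by
    intro v
    set s : Set (Fin d₁ → ℝ) := {w | (glue w v : EuclideanSpace ℝ (Fin d)) ∈ supp ν} with hs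
    have hsm : MeasurableSet s :=
      (Measure.isClosed_support.preimage (continuous_glue v)).measurableSet
    let ℓ : EuclideanSpace ℝ (Fin d) → (Fin d₁ → ℝ) →L[ℝ] ℝ := fun η =>
      ∑ i, contPart h η i • ContinuousLinearMap.proj i
    have hlin : ∀ (η : EuclideanSpace ℝ (Fin d)) (w : Fin d₁ → ℝ),
        HasFDerivAt (fun w => inner ℝ η (glue w v : EuclideanSpace ℝ (Fin d))) (ℓ η) w := by
      intro η w
      have e : (fun w => inner ℝ η (glue w v : EuclideanSpace ℝ (Fin d))) =
          fun w => ℓ η w + ∑ j, discPart h η j * v j := by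
        ext w
        rw [inner_glue h]
        simp [ℓ]
      rw [e]
      exact (ℓ η).hasFDerivAt.add_const _
    have hmaps : ∀ η ∈ Theta d, MapsTo
        (fun w => inner ℝ η (glue w v : EuclideanSpace ℝ (Fin d))) s (dom (supp ν)) :=
      fun η hη w hw => inner_mem_dom hη hw
    have hder : ∀ w ∈ s, HasFDerivWithinAt
        (fun w => m (inner ℝ θ (glue w v : EuclideanSpace ℝ (Fin d))) -
          m₀ (inner ℝ θ₀ (glue w v : EuclideanSpace ℝ (Fin d))))
        (p (inner ℝ θ (glue w v)) • ℓ θ - p₀ (inner ℝ θ₀ (glue w v)) • ℓ θ₀) s w := by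
      intro w hw
      exact ((hm _ (hmaps θ hθ hw)).comp_hasFDerivWithinAt w (hlin θ w).hasFDerivWithinAt
        (hmaps θ hθ)).fun_sub ((hm₀ _ (hmaps θ₀ hθ₀ hw)).comp_hasFDerivWithinAt w
          (hlin θ₀ w).hasFDerivWithinAt (hmaps θ₀ hθ₀))
    have h0 := ae_fderiv_eq_zero_of_eqOn_zero hsm
      (fun w hw => sub_eq_zero.2 (heq _ hw)) hder ⟨0, hpos⟩
    filter_upwards [h0] with w hw hws i
    have h1 := congrArg (fun A : (Fin d₁ → ℝ) →L[ℝ] ℝ => A (Pi.single i 1)) (hw hws)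
    have h2 : ∀ η, ℓ η (Pi.single i 1) = contPart h η i := by
      intro η
      simp [ℓ, Pi.single_apply]
    simp only [sub_apply, smul_apply, h2, smul_eq_mul,
      zero_apply] at h1
    linarith
  have hall : ∀ᵐ w : Fin d₁ → ℝ, ∀ v ∈ S, glue w v ∈ supp ν →
      ∀ i, p (inner ℝ θ (glue w v)) * contPart h θ i =
        p₀ (inner ℝ θ₀ (glue w v)) * contPart h θ₀ i :=
    (ae_ball_iff hS).2 fun v _ => key v
  have hcm : AEMeasurable (contPart h) (lawX ν) := by
    refine Measurable.aemeasurable (measurable_pi_lambda _ fun i => ?_)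
    unfold contPart
    fun_prop
  have hx := ae_of_ae_map hcm (hac.ae_le hall)
  filter_upwards [hx, hdisc, ae_mem_supp] with x h1 h2 h3
  have h4 := h1 _ h2
  rw [glue_contPart_discPart] at h4
  exact h4 h3

/-- A convex function with the same values at `ρ t + β` and `ρ t + β'` for all `t ∈ I` does not
depend on `t ∈ I`: by monotonicity of slopes it can neither increase nor decrease. -/
lemma const_of_shift_eq {D : Set ℝ} {m : ℝ → ℝ} (hm : ConvexOn ℝ D m) {I : Set ℝ}
    {ρ β β' : ℝ} (hρ : 0 < ρ) (hβ : β < β') (h1 : ∀ t ∈ I, ρ * t + β ∈ D)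
    (h2 : ∀ t ∈ I, ρ * t + β' ∈ D) (h : ∀ t ∈ I, m (ρ * t + β) = m (ρ * t + β')) {t t' : ℝ}
    (ht : t ∈ I) (ht' : t' ∈ I) : m (ρ * t + β) = m (ρ * t' + β) := by
  wlog htt : t < t' generalizing t t'
  · rcases eq_or_lt_of_le (not_lt.1 htt) with he | hlt
    · rw [he]
    · exact (this ht' ht hlt).symm
  have hlt : ρ * t < ρ * t' := mul_lt_mul_of_pos_left htt hρ
  have s1 := hm.slope_mono_adjacent (h1 t ht) (h2 t' ht') (y := ρ * t' + β) (by linarith)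
    (by linarith)
  have s2 := hm.slope_mono_adjacent (h1 t ht) (h2 t' ht') (y := ρ * t + β') (by linarith)
    (by linarith)
  rw [← h t' ht', sub_self, zero_div, div_le_iff₀ (by linarith), zero_mul] at s1
  rw [← h t ht, sub_self, zero_div, ← h t' ht', le_div_iff₀ (by linarith), zero_mul] at s2
  linarith

/-- The truth is identified: if `m ∘ θ` and `m₀ ∘ θ₀` agree almost surely, then `θ = θ₀`, and `m`
and `m₀` agree together with their derivatives on the range of the true index. -/
lemma identifiability [NeZero d] [IsProbabilityMeasure ν] {m₀ p₀ : ℝ → ℝ}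
    {θ₀ : EuclideanSpace ℝ (Fin d)} (hA0 : A0 ν m₀ θ₀) (hA3 : A3 ν m₀ θ₀) (hθ₀ : θ₀ ∈ Theta d)
    (hp₀ : p₀ = derivWithin m₀ (dom (supp ν)))
    (hm₀ : ∀ t ∈ dom (supp ν), HasDerivWithinAt m₀ (p₀ t) (dom (supp ν)) t)
    (hp₀c : ContinuousOn p₀ (dom (supp ν))) {m p : ℝ → ℝ}
    (hconv : ConvexOn ℝ (dom (supp ν)) m)
    (hm : ∀ t ∈ dom (supp ν), HasDerivWithinAt m (p t) (dom (supp ν)) t)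
    (hpc : ContinuousOn p (dom (supp ν))) {θ : EuclideanSpace ℝ (Fin d)} (hθ : θ ∈ Theta d)
    (hae : ∀ᵐ x ∂(lawX ν), m (inner ℝ θ x) = m₀ (inner ℝ θ₀ x)) :
    θ = θ₀ ∧ ∀ t ∈ domAt (supp ν) θ₀, m t = m₀ t ∧ p t = p₀ t := by
  have hcomp : ∀ {f : ℝ → ℝ} {η : EuclideanSpace ℝ (Fin d)}, ContinuousOn f (dom (supp ν)) →
      η ∈ Theta d → ContinuousOn (fun x => f (inner ℝ η x)) (lawX ν).support :=
    fun hf hη => hf.comp (by fun_prop) fun x hx => inner_mem_dom hη hx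
  have hmc : ContinuousOn m (dom (supp ν)) := fun t ht => (hm t ht).continuousWithinAt
  have hm₀c : ContinuousOn m₀ (dom (supp ν)) := fun t ht => (hm₀ t ht).continuousWithinAt
  have heq : ∀ x ∈ supp ν, m (inner ℝ θ x) = m₀ (inner ℝ θ₀ x) :=
    eq_on_support_of_ae_eq (hcomp hmc hθ) (hcomp hm₀c hθ₀) hae
  obtain ⟨hθ₀0, d₁, h, hd₁, hac, ⟨S, hS, hdisc⟩, a, b, -, ⟨c, hli, hsl⟩, hnc⟩ := hA0
  have hgrad := ae_gradient_eq h hac hS hdisc hm hm₀ hθ hθ₀ heq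
  have hi0 : Fin.castLE h ⟨0, hd₁⟩ = 0 := rfl
  have hc0 : ∀ η : EuclideanSpace ℝ (Fin d), contPart h η ⟨0, hd₁⟩ = η 0 := fun η => rfl
  -- a point where the common gradient does not vanish
  obtain ⟨x, hx0, hxg⟩ : ∃ x, p₀ (inner ℝ θ₀ x) ≠ 0 ∧
      ∀ i, p (inner ℝ θ x) * contPart h θ i = p₀ (inner ℝ θ₀ x) * contPart h θ₀ i := by
    by_contra! hcon
    have hz : ∀ᵐ x ∂(lawX ν), p₀ (inner ℝ θ₀ x) = 0 := by
      filter_upwards [hgrad] with x hx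
      by_contra hne
      obtain ⟨i, hi⟩ := hcon x hne
      exact hi (hx i)
    unfold A3 at hA3
    rw [← hp₀] at hA3
    have hM : (Matrix.of fun i j : Fin d => ∫ x, x i * x j * (p₀ (inner ℝ θ₀ x)) ^ 2 ∂(lawX ν)) =
        0 := by
      ext i j
      simp only [Matrix.of_apply, Matrix.zero_apply]
      refine integral_eq_zero_of_ae ?_
      filter_upwards [hz] with x hx
      simp [hx]
    rw [hM] at hA3
    have : Nonempty (Fin d) := ⟨0⟩
    exact not_isUnit_zero hA3
  have hpx : p (inner ℝ θ x) ≠ 0 := by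
    intro hp
    have := hxg ⟨0, hd₁⟩
    rw [hp, zero_mul, hc0] at this
    exact mul_ne_zero hx0 hθ₀0.ne' this.symm
  set ρ := p₀ (inner ℝ θ₀ x) / p (inner ℝ θ x) with hρ
  -- the continuous parts of the two index parameters are proportional
  have hρi : ∀ i, contPart h θ i = ρ * contPart h θ₀ i := by
    intro i
    rw [hρ, div_mul_eq_mul_div, eq_div_iff hpx, mul_comm, hxg i]
  have hρ0 : ρ ≠ 0 := div_ne_zero hx0 hpx
  have hρpos : 0 < ρ := by
    have h1 := hρi ⟨0, hd₁⟩
    rw [hc0, hc0] at h1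
    have h2 : 0 ≤ ρ * θ₀ 0 := h1 ▸ hθ.2
    exact lt_of_le_of_ne (nonneg_of_mul_nonneg_left h2 hθ₀0) hρ0.symm
  set δ : Fin (d - d₁) → ℝ := fun j => discPart h θ j - ρ * discPart h θ₀ j with hδ
  have hinner : ∀ x, inner ℝ θ x = ρ * inner ℝ θ₀ x + ∑ j, δ j * discPart h x j := by
    intro x
    rw [inner_eq_contPart_add_discPart h, inner_eq_contPart_add_discPart h θ₀]
    simp_rw [hρi, hδ, sub_mul, Finset.sum_sub_distrib, mul_add, Finset.mul_sum, mul_assoc]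
    ring
  -- on the slice of discrete value `c l`, the index for `θ` is `ρ t + β l` when that for `θ₀` is `t`
  set β : Fin (d - d₁ + 1) → ℝ := fun l => ∑ j, δ j * c l j with hβ
  have hslice : ∀ l, ∀ t ∈ Ioo a b, ρ * t + β l ∈ dom (supp ν) ∧ m (ρ * t + β l) = m₀ t := by
    intro l t ht
    obtain ⟨x, hx, hxc, hxt⟩ := hsl l ht
    have h1 := hinner x
    rw [hxc, hxt] at h1
    have h2 := heq x hx
    rw [h1, hxt] at h2
    exact ⟨by rw [hβ, ← h1]; exact inner_mem_dom hθ hx, h2⟩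
  -- distinct shifts would make `m₀` constant on `(a, b)`
  have hβeq : ∀ l, β l = β 0 := by
    intro l
    by_contra hne
    have hlt : d₁ < d := by
      rcases h.lt_or_eq with hlt | he
      · exact hlt
      · have : IsEmpty (Fin (d - d₁)) := by
          rw [he, Nat.sub_self]; infer_instance
        exact absurd (by simp [hβ]) hne
    obtain ⟨s, hs, t, ht, hst⟩ := hnc hlt
    have aux : ∀ l l', β l < β l' → False := by
      intro l l' hll
      refine hst ?_
      rw [← (hslice l s hs).2, ← (hslice l t ht).2]
      exact const_of_shift_eq hconv hρpos hll (fun t ht => (hslice l t ht).1)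
        (fun t ht => (hslice l' t ht).1)
        (fun t ht => (hslice l t ht).2.trans (hslice l' t ht).2.symm) hs ht
    rcases lt_or_gt_of_ne hne with h' | h'
    · exact aux _ _ h'
    · exact aux _ _ h'
  -- a linear form with equal values at affinely independent points vanishes
  have hδ0 : ∀ j, δ j = 0 := by
    have hspan : Submodule.span ℝ (Set.range fun l : Fin (d - d₁) => c l.succ - c 0) = ⊤ :=
      hli.span_eq_top_of_card_eq_finrank' (by simp)
    let φ : (Fin (d - d₁) → ℝ) →ₗ[ℝ] ℝ := ∑ j, δ j • LinearMap.proj j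
    have hφ : φ = 0 := by
      refine LinearMap.ext_on_range hspan fun l => ?_
      have h1 := hβeq l.succ
      simp only [hβ] at h1
      simp [φ, mul_sub, Finset.sum_sub_distrib, h1]
    intro j
    have h1 := congrArg (fun A : (Fin (d - d₁) → ℝ) →ₗ[ℝ] ℝ => A (Pi.single j 1)) hφ
    simpa [φ, Pi.single_apply] using h1
  have hθρ : θ = ρ • θ₀ := by
    refine ext_inner_right ℝ fun v => ?_
    rw [hinner v, inner_smul_left]
    simp [hδ0]
  have hρ1 : ρ = 1 := by
    have h1 := hθ.1
    rw [hθρ, norm_smul, hθ₀.1, mul_one, Real.norm_of_nonneg hρpos.le] at h1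
    exact h1
  have hθθ : θ = θ₀ := by rw [hθρ, hρ1, one_smul]
  refine ⟨hθθ, ?_⟩
  -- the first coordinate of `θ₀` is positive, so the gradients determine the derivatives
  have hpeq : ∀ x ∈ supp ν, p (inner ℝ θ₀ x) = p₀ (inner ℝ θ₀ x) := by
    refine eq_on_support_of_ae_eq (hcomp hpc hθ₀) (hcomp hp₀c hθ₀) ?_
    filter_upwards [hgrad] with x hx
    have h1 := hx ⟨0, hd₁⟩
    rw [hc0, hc0, hθθ] at h1
    exact mul_right_cancel₀ hθ₀0.ne' h1
  rintro t ⟨x, hx, rfl⟩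
  exact ⟨by rw [← heq x hx, hθθ], hpeq x hx⟩

end Identifiability

/-! ### A compact class of index models -/

section Primitive

open BoundedContinuousFunction

variable {a b : ℝ} (h : a ≤ b)

/-- The function on `ℝ` with value `v` at `a` and derivative `f`, where `f` is extended by constants
outside `[a, b]`. -/
noncomputable def primitive (v : ℝ) (f : Icc a b →ᵇ ℝ) (t : ℝ) : ℝ :=
  v + ∫ u in a..t, f (projIcc a b h u)

lemma continuous_comp_proj (f : Icc a b →ᵇ ℝ) : Continuous fun u => f (projIcc a b h u) :=
  f.continuous.comp continuous_projIcc

lemma hasDerivAt_primitive (v : ℝ) (f : Icc a b →ᵇ ℝ) (t : ℝ) :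
    HasDerivAt (primitive h v f) (f (projIcc a b h t)) t :=
  (intervalIntegral.integral_hasDerivAt_right
    ((continuous_comp_proj h f).intervalIntegrable _ _)
    ((continuous_comp_proj h f).stronglyMeasurableAtFilter _ _)
    (continuous_comp_proj h f).continuousAt).const_add v

lemma continuous_primitive (v : ℝ) (f : Icc a b →ᵇ ℝ) : Continuous (primitive h v f) :=
  continuous_iff_continuousAt.2 fun t => (hasDerivAt_primitive h v f t).continuousAt

lemma abs_primitive_sub_le (v v' : ℝ) (f f' : Icc a b →ᵇ ℝ) {t t' : ℝ} (ht : t ∈ Icc a b) :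
    |primitive h v f t - primitive h v' f' t'| ≤
      |v - v'| + (b - a) * ‖f - f'‖ + ‖f'‖ * |t - t'| := by
  have hi : ∀ (g : Icc a b →ᵇ ℝ) (s r : ℝ),
      IntervalIntegrable (fun u => g (projIcc a b h u)) volume s r :=
    fun g s r => (continuous_comp_proj h g).intervalIntegrable _ _
  have e1 : primitive h v f t - primitive h v' f' t' =
      (v - v') + (∫ u in a..t, (f - f') (projIcc a b h u)) +
        ∫ u in t'..t, f' (projIcc a b h u) := by
    have e2 : ∫ u in a..t, (f - f') (projIcc a b h u) =
        (∫ u in a..t, f (projIcc a b h u)) - ∫ u in a..t, f' (projIcc a b h u) :=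
      intervalIntegral.integral_sub (hi f _ _) (hi f' _ _)
    have e3 := intervalIntegral.integral_add_adjacent_intervals (hi f' a t') (hi f' t' t)
    rw [primitive, primitive, e2, ← e3]
    ring
  have h1 : |∫ u in a..t, (f - f') (projIcc a b h u)| ≤ ‖f - f'‖ * |t - a| :=
    intervalIntegral.norm_integral_le_of_norm_le_const fun u _ => (f - f').norm_coe_le_norm _
  have h2 : |∫ u in t'..t, f' (projIcc a b h u)| ≤ ‖f'‖ * |t - t'| :=
    intervalIntegral.norm_integral_le_of_norm_le_const fun u _ => f'.norm_coe_le_norm _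
  have h3 : ‖f - f'‖ * |t - a| ≤ (b - a) * ‖f - f'‖ := by
    rw [mul_comm, abs_of_nonneg (sub_nonneg.2 ht.1)]
    exact mul_le_mul_of_nonneg_right (by linarith [ht.2]) (norm_nonneg _)
  rw [e1]
  refine (abs_add_le _ _).trans ?_
  linarith [abs_add_le (v - v') (∫ u in a..t, (f - f') (projIcc a b h u))]

lemma convexOn_primitive (v : ℝ) {f : Icc a b →ᵇ ℝ} (hf : Monotone f) :
    ConvexOn ℝ (Icc a b) (primitive h v f) := by
  refine MonotoneOn.convexOn_of_deriv (convex_Icc a b) (continuous_primitive h v f).continuousOn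
    (fun t _ => (hasDerivAt_primitive h v f t).differentiableAt.differentiableWithinAt) ?_
  intro s _ t _ hst
  rw [(hasDerivAt_primitive h v f s).deriv, (hasDerivAt_primitive h v f t).deriv]
  exact hf (monotone_projIcc h hst)

/-- The derivatives of the convex functions that are bounded, with their roughness, by `B`. The
last condition is the Hölder bound that follows from a bound on the roughness. -/
def derivClass (a b B : ℝ) : Set (Icc a b →ᵇ ℝ) :=
  {f | (∀ t, f t ∈ Icc (-B) B) ∧ Monotone f ∧
    ∀ s t : Icc a b, (f t - f s) ^ 2 ≤ |(t : ℝ) - s| * B ^ 2}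

lemma isCompact_derivClass (a b B : ℝ) : IsCompact (derivClass a b B) := by
  have hev : ∀ t : Icc a b, Continuous fun f : Icc a b →ᵇ ℝ => f t :=
    fun t => continuous_eval_const t
  refine arzela_ascoli₂ (Icc (-B) B) isCompact_Icc _ ?_ (fun f t hf => hf.1 t) ?_
  · have : derivClass a b B = (⋂ t, {f | f t ∈ Icc (-B) B}) ∩
        ((⋂ s : Icc a b, ⋂ t : Icc a b, {f | s ≤ t → f s ≤ f t}) ∩
          ⋂ s : Icc a b, ⋂ t : Icc a b, {f | (f t - f s) ^ 2 ≤ |(t : ℝ) - s| * B ^ 2}) := by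
      ext f
      simp only [derivClass, mem_ofPred_eq, mem_inter_iff, mem_iInter, Monotone]
    rw [this]
    refine (isClosed_iInter fun t => isClosed_Icc.preimage (hev t)).inter
      ((isClosed_iInter fun s => isClosed_iInter fun t => ?_).inter
        (isClosed_iInter fun s => isClosed_iInter fun t =>
          isClosed_le (((hev t).sub (hev s)).pow 2) continuous_const))
    by_cases hst : s ≤ t
    · simpa [hst] using isClosed_le (hev s) (hev t)
    · simp [hst]
  · refine Metric.equicontinuous_of_continuity_modulus (fun r => √(r * B ^ 2)) ?_ _ ?_
    · have : Continuous fun r : ℝ => √(r * B ^ 2) := by fun_prop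
      simpa using this.tendsto 0
    · rintro s t ⟨f, hf⟩
      refine Real.le_sqrt_of_sq_le ?_
      rw [dist_comm, Real.dist_eq, sq_abs, dist_comm]
      exact hf.2.2 s t

/-- A function of the model class with bounded value, derivative and roughness is a primitive of a
member of the compact class of derivatives. -/
lemma classR.exists_primitive_eq {B : ℝ} {m : ℝ → ℝ} (hm : m ∈ classR (Icc a b))
    (hJ : Jsq (Icc a b) m ≤ ENNReal.ofReal (B ^ 2))
    (hB : ∀ t ∈ Icc a b, |m t| ≤ B ∧ |derivWithin m (Icc a b) t| ≤ B) :
    ∃ v ∈ Icc (-B) B, ∃ f ∈ derivClass a b B, ∀ t ∈ Icc a b, m t = primitive h v f t ∧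
      derivWithin m (Icc a b) t = f (projIcc a b h t) := by
  obtain ⟨q, hq, hqJ⟩ := classR.exists_smoothOn hm
  set p := derivWithin m (Icc a b) with hp
  have hpc : ContinuousOn p (Icc a b) := by
    have := (hm.2.2 a (left_mem_Icc.2 h) b (right_mem_Icc.2 h)).continuousOn
    rwa [uIcc_of_le h] at this
  set f : Icc a b →ᵇ ℝ :=
    BoundedContinuousFunction.mkOfCompact
      ⟨fun t => p t, continuousOn_iff_continuous_domRestrict.1 hpc⟩
    with hf
  have hfp : ∀ t ∈ Icc a b, f (projIcc a b h t) = p t := fun t ht => by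
    rw [projIcc_of_mem h ht]; rfl
  refine ⟨m a, abs_le.1 (hB a (left_mem_Icc.2 h)).1, f,
    ⟨fun t => abs_le.1 (hB t t.2).2, ?_, ?_⟩, ?_⟩
  · exact fun s t hst => hm.1.monotoneOn_derivWithin hm.2.1 s.2 t.2 hst
  · exact fun s t => hq.sq_sub_le (hqJ.trans_le hJ) s.2 t.2
  · intro t ht
    refine ⟨?_, (hfp t ht).symm⟩
    have h1 : ∫ u in a..t, f (projIcc a b h u) = m t - m a := by
      refine intervalIntegral.integral_eq_sub_of_hasDerivAt_of_le ht.1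
        ((show ContinuousOn m (Icc a b) from hm.2.1.continuousOn).mono (Icc_subset_Icc_right ht.2))
        (fun u hu => ?_) ((continuous_comp_proj h f).intervalIntegrable _ _)
      have hu' : u ∈ Icc a b := ⟨hu.1.le, hu.2.le.trans ht.2⟩
      rw [hfp u hu']
      exact (hq.deriv u hu').hasDerivAt (Icc_mem_nhds hu.1 (hu.2.trans_le ht.2))
    rw [primitive, h1]
    ring

end Primitive

/-! ### Consistency -/

section Consistency

variable {d : ℕ} {ν : Measure (EuclideanSpace ℝ (Fin d) × ℝ)}
  {Ω : Type*} [MeasurableSpace Ω] {P : Measure Ω} [IsProbabilityMeasure P]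
  {z : ℕ → Ω → EuclideanSpace ℝ (Fin d) × ℝ}

/-- Over a compact set of regression functions, a small empirical distance to `g` forces the
parameter into any set `U` that is a neighbourhood of the parameters representing `g`. -/
lemma exists_whp_of_isCompact [IsProbabilityMeasure ν] (h1 : A1 ν)
    (hlaw : ∀ i, HasLaw (z i) ν P) (hindep : iIndepFun z P) {𝒦 : Type*} [TopologicalSpace 𝒦]
    {K U : Set 𝒦} (hK : IsCompact K) {h : 𝒦 → EuclideanSpace ℝ (Fin d) → ℝ}
    {g : EuclideanSpace ℝ (Fin d) → ℝ} (hh : ∀ κ ∈ K, Continuous (h κ)) (hg : Continuous g)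
    (hu : ∀ κ ∈ K, ∀ ε > 0, ∀ᶠ κ' in 𝓝[K] κ, ∀ x ∈ supp ν, |h κ' x - h κ x| ≤ ε)
    (hid : ∀ κ ∈ K, h κ =ᵐ[lawX ν] g → U ∈ 𝓝[K] κ) :
    ∃ δ > 0, Whp P fun n => {ω | (∀ i, (z i ω).1 ∈ supp ν) → ∀ κ ∈ K,
      rms (fun i : Fin n => h κ (z i ω).1 - g (z i ω).1) ≤ δ → κ ∈ U} := by
  refine hK.induction_on (p := fun S => ∃ δ > 0, Whp P fun n => {ω |
    (∀ i, (z i ω).1 ∈ supp ν) → ∀ κ ∈ S,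
      rms (fun i : Fin n => h κ (z i ω).1 - g (z i ω).1) ≤ δ → κ ∈ U}) ?_ ?_ ?_ ?_
  · exact ⟨1, one_pos, by simp [Whp]⟩
  · rintro S S' hS ⟨δ, hδ, hw⟩
    exact ⟨δ, hδ, hw.mono (Eventually.of_forall fun n ω hω hs κ hκ => hω hs κ (hS hκ))⟩
  · rintro S S' ⟨δ, hδ, hw⟩ ⟨δ', hδ', hw'⟩
    refine ⟨min δ δ', lt_min hδ hδ', (hw.inter hw').mono (Eventually.of_forall ?_)⟩
    rintro n ω ⟨hω, hω'⟩ hs κ (hκ | hκ) hr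
    · exact hω hs κ hκ (hr.trans (min_le_left _ _))
    · exact hω' hs κ hκ (hr.trans (min_le_right _ _))
  intro κ hκ
  by_cases hae : h κ =ᵐ[lawX ν] g
  · exact ⟨U, hid κ hκ hae, 1, one_pos, by simp +contextual [Whp]⟩
  -- otherwise the empirical distance to `g` is bounded below near `κ`, by the law of large numbers
  have hc : Continuous fun x => (h κ x - g x) ^ 2 := ((hh κ hκ).sub hg).pow 2
  set D := ∫ x, (h κ x - g x) ^ 2 ∂(lawX ν) with hD
  have hDpos : 0 < D := by
    refine lt_of_le_of_ne (integral_nonneg fun x => sq_nonneg _) fun h0 => hae ?_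
    have := (integral_eq_zero_iff_of_nonneg (fun x => sq_nonneg _)
      (h1.integrable_of_continuous hc)).1 h0.symm
    filter_upwards [this] with x hx
    exact sub_eq_zero.1 (pow_eq_zero_iff two_ne_zero |>.1 hx)
  set r := √D with hr
  have hrpos : 0 < r := Real.sqrt_pos.2 hDpos
  refine ⟨{κ' | ∀ x ∈ supp ν, |h κ' x - h κ x| ≤ r / 4}, hu κ hκ (r / 4) (by positivity), r / 4,
    by positivity, ?_⟩
  have hav := whp_average hlaw hindep (f := fun p => (h κ p.1 - g p.1) ^ 2)
    (hc.measurable.comp measurable_fst)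
    ((h1.integrable_of_continuous hc).comp_measurable measurable_fst)
    (ε := 3 / 4 * D) (by positivity)
  refine hav.mono (Eventually.of_forall fun n ω hω hs κ' hκ' hle => ?_)
  exfalso
  simp only [mem_ofPred_eq] at hω hκ'
  rw [← integral_lawX hc.measurable, ← hD] at hω
  rcases Nat.eq_zero_or_pos n with rfl | hn
  · -- the empty average is `0`, which is not close to `D`
    simp only [CharP.cast_eq_zero, div_zero, zero_sub, abs_neg, abs_of_pos hDpos] at hω
    linarith
  have : Nonempty (Fin n) := ⟨⟨0, hn⟩⟩
  have h2 : rms (fun i : Fin n => h κ (z i ω).1 - g (z i ω).1) ≤ r / 4 + r / 4 := by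
    have e : (fun i : Fin n => h κ (z i ω).1 - g (z i ω).1) = fun i : Fin n =>
        (h κ' (z i ω).1 - g (z i ω).1) - (h κ' (z i ω).1 - h κ (z i ω).1) := by
      funext i; ring
    rw [e]
    exact (rms_sub_le _ _).trans (add_le_add hle
      (rms_le_of_abs_le (by positivity) fun i => hκ' _ (hs i)))
  have h3 : rms (fun i : Fin n => h κ (z i ω).1 - g (z i ω).1) ^ 2 ≤ (r / 2) ^ 2 :=
    pow_le_pow_left₀ (rms_nonneg _) (by linarith) 2
  rw [sq_rms, Fintype.card_fin, div_pow, hr, Real.sq_sqrt hDpos.le] at h3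
  linarith [(abs_lt.1 hω).1]

/-- An estimator whose tuning parameter is small, but at least of the order `n^{-2/5}`, is close to
the true parameters. -/
lemma whp_consistency [NeZero d] [IsProbabilityMeasure ν] {m₀ : ℝ → ℝ}
    {θ₀ : EuclideanSpace ℝ (Fin d)} (hθ₀ : θ₀ ∈ Theta d) (h0 : A0 ν m₀ θ₀) (h1 : A1 ν) (h2 : A2 ν)
    (h3 : A3 ν m₀ θ₀) (h4 : A4 ν) (hP1 : P1 (dom (supp ν)) m₀)
    (hlaw : ∀ i, HasLaw (z i) ν P) (hindep : iIndepFun z P) {B : ℝ} (hB : 0 ≤ B) {η : ℝ}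
    (hη : 0 < η) :
    ∃ τ > 0, Whp P fun n => {ω | ∀ (y : ℕ → ℝ) (l : ℝ) (m : ℝ → ℝ)
      (θ : EuclideanSpace ℝ (Fin d)), (∀ i, (z i ω).1 ∈ supp ν) →
      (∀ i, y i = m₀ (inner ℝ θ₀ (z i ω).1) + (z i ω).2) → l ≠ 0 →
      |l⁻¹| ≤ B * (n : ℝ) ^ (2 / 5 : ℝ) → |l| ≤ τ →
      IsPLSE (dom (supp ν)) n (fun i => (z i ω).1) y l m θ →
      ‖θ - θ₀‖ < η ∧ ∀ t ∈ domAt (supp ν) θ₀, |m t - m₀ t| ≤ η ∧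
        |derivWithin m (dom (supp ν)) t - derivWithin m₀ (dom (supp ν)) t| ≤ η} := by
  obtain ⟨K, hK0, hbd⟩ := whp_estimator_bounds h1 h2 h4 hP1 hθ₀ hlaw hindep hB
  obtain ⟨a, L, hL, hdom⟩ := exists_dom_eq_Icc h1 h4
  have hab : a ≤ a + L := by linarith
  obtain ⟨T, hT⟩ := h1.2
  have hm₀ := hP1.1
  have hinn : ∀ θ ∈ Theta d, ∀ x ∈ supp ν, inner ℝ θ x ∈ Icc a (a + L) := fun θ hθ x hx => by
    rw [← hdom]; exact inner_mem_dom hθ hx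
  have hp₀c : ContinuousOn (derivWithin m₀ (dom (supp ν))) (dom (supp ν)) := by
    have := (hm₀.2.2 a (hdom ▸ left_mem_Icc.2 hab) (a + L)
      (hdom ▸ right_mem_Icc.2 hab)).continuousOn
    rwa [uIcc_of_le hab, ← hdom] at this
  have hm₀c : ContinuousOn m₀ (Icc a (a + L)) := hdom ▸ hm₀.2.1.continuousOn
  set 𝒦 : Set (ℝ × BoundedContinuousFunction (Icc a (a + L)) ℝ × EuclideanSpace ℝ (Fin d)) :=
    Icc (-K) K ×ˢ derivClass a (a + L) K ×ˢ Theta d with h𝒦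
  have hcpt : IsCompact 𝒦 := isCompact_Icc.prod ((isCompact_derivClass _ _ _).prod isCompact_Theta)
  set M : (ℝ × BoundedContinuousFunction (Icc a (a + L)) ℝ × EuclideanSpace ℝ (Fin d)) →
    ℝ → ℝ := fun κ => primitive hab κ.1 κ.2.1 with hM
  set U : Set (ℝ × BoundedContinuousFunction (Icc a (a + L)) ℝ × EuclideanSpace ℝ (Fin d)) :=
    {κ | ‖κ.2.2 - θ₀‖ < η ∧ ∀ t ∈ domAt (supp ν) θ₀, |M κ t - m₀ t| ≤ η ∧
      |κ.2.1 (projIcc a (a + L) hab t) - derivWithin m₀ (dom (supp ν)) t| ≤ η} with hU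
  have hdomAt : ∀ t ∈ domAt (supp ν) θ₀, t ∈ Icc a (a + L) := by
    rintro t ⟨x, hx, rfl⟩; exact hinn θ₀ hθ₀ x hx
  -- `m₀` is controlled on the domain only, so the index is projected to it
  set g : EuclideanSpace ℝ (Fin d) → ℝ :=
    fun x => m₀ (projIcc a (a + L) hab (inner ℝ θ₀ x)) with hg
  have hgx : ∀ x ∈ supp ν, g x = m₀ (inner ℝ θ₀ x) := fun x hx => by
    simp only [hg, projIcc_of_mem hab (hinn θ₀ hθ₀ x hx)]
  have hgc : Continuous g :=
    (continuousOn_iff_continuous_domRestrict.1 hm₀c).comp (continuous_projIcc.comp (by fun_prop))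
  -- the regression function depends continuously on the parameter, uniformly on the support
  have hunif : ∀ κ ∈ 𝒦, ∀ ε > 0, ∀ᶠ κ' in 𝓝[𝒦] κ, ∀ x ∈ supp ν,
      |M κ' (inner ℝ κ'.2.2 x) - M κ (inner ℝ κ.2.2 x)| ≤ ε := by
    intro κ hκ ε hε
    have hc : Continuous fun κ' : ℝ × BoundedContinuousFunction (Icc a (a + L)) ℝ ×
        EuclideanSpace ℝ (Fin d) => |κ'.1 - κ.1| + (a + L - a) * ‖κ'.2.1 - κ.2.1‖ +
          ‖κ.2.1‖ * (‖κ'.2.2 - κ.2.2‖ * T) := by fun_prop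
    have hlt := (hc.tendsto κ).eventually_lt_const (u := ε) (by simpa using hε)
    filter_upwards [nhdsWithin_le_nhds hlt, self_mem_nhdsWithin] with κ' hκ' hmem x hx
    refine (abs_primitive_sub_le hab _ _ _ _ (hinn _ hmem.2.2 x hx)).trans (le_trans ?_ hκ'.le)
    refine add_le_add le_rfl (mul_le_mul_of_nonneg_left ?_ (norm_nonneg _))
    rw [← inner_sub_left]
    exact (abs_real_inner_le_norm _ _).trans
      (mul_le_mul_of_nonneg_left (hT x hx) (norm_nonneg _))
  -- by identifiability, every representation of the truth is interior to `U`
  have hrep : ∀ κ ∈ 𝒦, (fun x => M κ (inner ℝ κ.2.2 x)) =ᵐ[lawX ν] g → U ∈ 𝓝[𝒦] κ := by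
    intro κ hκ hae
    have hid := identifiability h0 h3 hθ₀ rfl
      (fun t ht => (hm₀.2.1 t ht).hasDerivWithinAt) hp₀c (m := M κ)
      (p := fun t => κ.2.1 (projIcc a (a + L) hab t))
      (hdom ▸ convexOn_primitive hab κ.1 hκ.2.1.2.1)
      (fun t _ => (hasDerivAt_primitive hab κ.1 κ.2.1 t).hasDerivWithinAt)
      (continuous_comp_proj hab κ.2.1).continuousOn hκ.2.2
      (by filter_upwards [hae, ae_mem_supp] with x hx hxs; rw [hx, hgx x hxs])
    have hc : Continuous fun κ' : ℝ × BoundedContinuousFunction (Icc a (a + L)) ℝ ×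
        EuclideanSpace ℝ (Fin d) => |κ'.1 - κ.1| + (a + L - a) * ‖κ'.2.1 - κ.2.1‖ +
          ‖κ'.2.1 - κ.2.1‖ + ‖κ'.2.2 - κ.2.2‖ := by fun_prop
    have hlt := (hc.tendsto κ).eventually_lt_const (u := η) (by simpa using hη)
    refine nhdsWithin_le_nhds ?_
    filter_upwards [hlt] with κ' hκ'
    have n1 := abs_nonneg (κ'.1 - κ.1)
    have n2 := norm_nonneg (κ'.2.1 - κ.2.1)
    have n3 := norm_nonneg (κ'.2.2 - κ.2.2)
    have n4 : 0 ≤ (a + L - a) * ‖κ'.2.1 - κ.2.1‖ := mul_nonneg (by linarith) n2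
    refine ⟨?_, fun t ht => ⟨?_, ?_⟩⟩
    · rw [← hid.1]; linarith
    · rw [← (hid.2 t ht).1]
      have := abs_primitive_sub_le hab κ'.1 κ.1 κ'.2.1 κ.2.1 (t' := t) (hdomAt t ht)
      rw [sub_self, abs_zero, mul_zero, add_zero] at this
      exact this.trans (by linarith)
    · rw [← (hid.2 t ht).2]
      exact ((κ'.2.1 - κ.2.1).norm_coe_le_norm _).trans (by linarith)
  obtain ⟨δ, hδ, hw⟩ := exists_whp_of_isCompact (U := U) h1 hlaw hindep hcpt
    (fun κ _ => (continuous_primitive hab κ.1 κ.2.1).comp (by fun_prop)) hgc hunif hrep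
  refine ⟨min 1 (δ / (K + 1)), by positivity, (hbd.inter hw).mono (Eventually.of_forall ?_)⟩
  rintro n ω ⟨hω, hω'⟩ y l m θ hs hy hl0 hlB hlτ hest
  obtain ⟨b1, b2, b3⟩ := hω y l m θ hs hy hl0 hlB (hlτ.trans (min_le_left _ _)) hest
  have hmR := hest.1
  rw [hdom] at b1 b2 hmR
  obtain ⟨v, hv, f, hf, hvf⟩ := classR.exists_primitive_eq hab hmR b1 b2
  have hmem := hω' hs (v, f, θ) ⟨hv, hf, hest.2.1⟩ ?_
  · refine ⟨hmem.1, fun t ht => ?_⟩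
    have := hmem.2 t ht
    simp only [hM] at this
    rwa [← (hvf t (hdomAt t ht)).1, ← (hvf t (hdomAt t ht)).2, ← hdom] at this
  · have e : (fun i : Fin n => M (v, f, θ) (inner ℝ θ (z i ω).1) - g (z i ω).1) =
        fun i : Fin n => m (inner ℝ θ (z i ω).1) - m₀ (inner ℝ θ₀ (z i ω).1) := by
      funext i
      rw [hgx _ (hs i), (hvf _ (hinn θ hest.2.1 _ (hs i))).1]
    change rms (fun i : Fin n => M (v, f, θ) (inner ℝ θ (z i ω).1) - g (z i ω).1) ≤ δ
    rw [e]
    calc _ ≤ K * |l| := b3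
      _ ≤ (K + 1) * (δ / (K + 1)) :=
        mul_le_mul (by linarith) (hlτ.trans (min_le_right _ _)) (abs_nonneg _) (by linarith)
      _ = δ := mul_div_cancel₀ _ (by linarith)

end Consistency

/-! ### Stochastic order symbols -/

section Orders

variable {Ω : Type*} [MeasurableSpace Ω] {P : Measure Ω}

lemma IsBigOp.exists_abs_le {X : ℕ → Ω → ℝ} {r : ℕ → ℝ} (h : IsBigOp P (fun n ω => ‖X n ω‖ₑ) r)
    (hr : ∀ n, 0 ≤ r n) {δ : ℝ≥0∞} (hδ : 0 < δ) :
    ∃ C : ℝ, 0 ≤ C ∧ ∀ᶠ n in atTop, P {ω | |X n ω| ≤ C * r n}ᶜ ≤ δ := by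
  obtain ⟨C, hC⟩ := h δ hδ
  refine ⟨C, C.2, hC.mono fun n hn => (measure_mono fun ω hω => ?_).trans hn⟩
  simp only [mem_compl_iff, mem_ofPred_eq, not_le] at hω ⊢
  rw [Real.enorm_eq_ofReal_abs, ← ENNReal.ofReal_coe_nnreal, ← ENNReal.ofReal_mul C.coe_nonneg]
  exact (ENNReal.ofReal_lt_ofReal_iff_of_nonneg (mul_nonneg C.2 (hr n))).2 hω

lemma IsLittleOp.whp_abs_le {X : ℕ → Ω → ℝ} {r : ℕ → ℝ}
    (h : IsLittleOp P (fun n ω => ‖X n ω‖ₑ) r) (hr : ∀ᶠ n in atTop, r n ≤ 1) {τ : ℝ}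
    (hτ : 0 < τ) : Whp P fun n => {ω | |X n ω| ≤ τ} := by
  have h1 : Whp P fun n => {ω | (τ.toNNReal : ℝ≥0∞) * ENNReal.ofReal (r n) ≤ ‖X n ω‖ₑ}ᶜ := by
    simpa only [Whp, compl_compl] using h τ.toNNReal (Real.toNNReal_pos.2 hτ)
  refine h1.mono (hr.mono fun n hn ω hω => ?_)
  simp only [mem_compl_iff, mem_ofPred_eq, not_le, Real.enorm_eq_ofReal_abs] at hω ⊢
  refine (ENNReal.ofReal_le_ofReal_iff hτ.le).1 (hω.le.trans ?_)
  calc _ ≤ (τ.toNNReal : ℝ≥0∞) * 1 := by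
        gcongr; exact (ENNReal.ofReal_le_ofReal hn).trans_eq ENNReal.ofReal_one
    _ = ENNReal.ofReal τ := mul_one _

/-- If `E C n`, for suitable `C`, has probability almost one for all large `n`, it may be used as
an additional hypothesis when `G n` is shown to have high probability. -/
lemma whp_of_forall_const {E : ℝ → ℕ → Set Ω} {G : ℕ → Set Ω}
    (hE : ∀ δ : ℝ≥0∞, 0 < δ → ∃ C : ℝ, 0 ≤ C ∧ ∀ᶠ n in atTop, P (E C n)ᶜ ≤ δ)
    (hG : ∀ C, 0 ≤ C → Whp P fun n => (E C n)ᶜ ∪ G n) : Whp P G := by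
  refine ENNReal.tendsto_nhds_zero.2 fun δ hδ => ?_
  have hδ2 : 0 < δ / 2 := ENNReal.half_pos hδ.ne'
  obtain ⟨C, hC0, hC⟩ := hE (δ / 2) hδ2
  filter_upwards [hC, ENNReal.tendsto_nhds_zero.1 (hG C hC0) (δ / 2) hδ2] with n h1 h2
  calc P (G n)ᶜ ≤ P ((E C n)ᶜ ∪ ((E C n)ᶜ ∪ G n)ᶜ) := measure_mono fun ω hω => by
        by_cases h : ω ∈ E C n
        · exact Or.inr (by simp only [mem_compl_iff, mem_union, not_or, not_not]; exact ⟨h, hω⟩)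
        · exact Or.inl h
    _ ≤ δ / 2 + δ / 2 := (measure_union_le _ _).trans (add_le_add h1 h2)
    _ = δ := ENNReal.add_halves δ

lemma supNorm_le {I : Set ℝ} {g : ℝ → ℝ} {M : ℝ} (h : ∀ t ∈ I, |g t| ≤ M) :
    supNorm I g ≤ ENNReal.ofReal M :=
  iSup₂_le fun t ht => by
    rw [Real.enorm_eq_ofReal_abs]; exact ENNReal.ofReal_le_ofReal (h t ht)

end Orders

end ConvexSIM

theorem mainTheorem9 {d : ℕ} [NeZero d] {Ω : Type*} [MeasurableSpace Ω]
    (P : Measure Ω) [IsProbabilityMeasure P]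
    -- the joint law of `(X, ε)` and the true parameters
    (ν : Measure (EuclideanSpace ℝ (Fin d) × ℝ)) [IsProbabilityMeasure ν]
    (m₀ : ℝ → ℝ) (θ₀ : EuclideanSpace ℝ (Fin d)) (hθ₀ : θ₀ ∈ ConvexSIM.Theta d)
    -- i.i.d. data from the model
    (x : ℕ → Ω → EuclideanSpace ℝ (Fin d)) (e y : ℕ → Ω → ℝ)
    (hlaw : ∀ i, HasLaw (fun ω => (x i ω, e i ω)) ν P)
    (hindep : iIndepFun (fun i ω => (x i ω, e i ω)) P)
    (hy : ∀ i, ∀ᵐ ω ∂P, y i ω = m₀ (inner ℝ θ₀ (x i ω)) + e i ω)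
    -- assumptions
    (hA0 : ConvexSIM.A0 ν m₀ θ₀) (hA1 : ConvexSIM.A1 ν) (hA2 : ConvexSIM.A2 ν)
    (hA3 : ConvexSIM.A3 ν m₀ θ₀) (hA4 : ConvexSIM.A4 ν)
    (hP1 : ConvexSIM.P1 (ConvexSIM.dom (ConvexSIM.supp ν)) m₀)
    (lam : ℕ → Ω → ℝ) (hP2 : ConvexSIM.P2 P lam)
    -- the penalized least squares estimators
    (mhat : ℕ → Ω → ℝ → ℝ) (θhat : ℕ → Ω → EuclideanSpace ℝ (Fin d))
    (hhat : ∀ n, 1 ≤ n → ∀ᵐ ω ∂P, ConvexSIM.IsPLSE (ConvexSIM.dom (ConvexSIM.supp ν)) n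
      (fun i => x i ω) (fun i => y i ω) (lam n ω) (mhat n ω) (θhat n ω)) :
    TendstoInMeasure P θhat atTop (fun _ => θ₀) ∧
    ConvexSIM.IsLittleOp P
      (fun n ω => ConvexSIM.sobolevNorm (ConvexSIM.dom (ConvexSIM.supp ν))
        (ConvexSIM.domAt (ConvexSIM.supp ν) θ₀) (fun t => mhat n ω t - m₀ t)) (fun _ => 1) ∧
    ConvexSIM.IsBigOp P
      (fun n ω => ConvexSIM.supNorm (ConvexSIM.dom (ConvexSIM.supp ν))
        (derivWithin (mhat n ω) (ConvexSIM.dom (ConvexSIM.supp ν)))) (fun _ => 1) := by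
  open ConvexSIM in
  obtain ⟨hlam0, hlamO, hlamo⟩ := hP2
  set D := dom (supp ν) with hD
  obtain ⟨a, L, hL, hdom⟩ := exists_dom_eq_Icc hA1 hA4
  have hDu : UniqueDiffOn ℝ D := by rw [hD, hdom]; exact uniqueDiffOn_Icc (by linarith)
  -- the almost sure properties of the data and of the estimators
  set S : Set Ω := {ω | (∀ i, x i ω ∈ supp ν) ∧ (∀ i, y i ω = m₀ (inner ℝ θ₀ (x i ω)) + e i ω) ∧
    ∀ n, 1 ≤ n → IsPLSE D n (fun i => x i ω) (fun i => y i ω) (lam n ω) (mhat n ω) (θhat n ω)}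
    with hS
  have hSw : Whp P fun _ => S := by
    refine whp_of_ae ?_
    have hx : ∀ i, ∀ᵐ ω ∂P, x i ω ∈ supp ν := fun i => by
      have h1 : ∀ᵐ p ∂ν, p.1 ∈ supp ν := ae_of_ae_map measurable_fst.aemeasurable ae_mem_supp
      have h2 : ∀ᵐ p ∂(P.map fun ω => (x i ω, e i ω)), p.1 ∈ supp ν := by
        rw [(hlaw i).map_eq]; exact h1
      exact ae_of_ae_map (hlaw i).aemeasurable h2
    filter_upwards [ae_all_iff.2 hx, ae_all_iff.2 hy,
      ae_all_iff.2 fun n => ae_all_iff.2 (hhat n)] with ω h1 h2 h3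
    exact ⟨h1, h2, h3⟩
  have hsmall : ∀ τ > 0, Whp P fun n => {ω | |lam n ω| ≤ τ} := fun τ hτ =>
    hlamo.whp_abs_le (eventually_atTop.2 ⟨1, fun n hn =>
      Real.rpow_le_one_of_one_le_of_nonpos (by exact_mod_cast hn) (by norm_num)⟩) hτ
  have hlarge := fun (δ : ℝ≥0∞) (hδ : 0 < δ) =>
    hlamO.exists_abs_le (fun n => by positivity) hδ
  -- consistency in all three components
  have hcons : ∀ η > 0, Whp P fun n => {ω | IsPLSE D n (fun i => x i ω) (fun i => y i ω)
      (lam n ω) (mhat n ω) (θhat n ω) ∧ ‖θhat n ω - θ₀‖ < η ∧ ∀ t ∈ domAt (supp ν) θ₀,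
      |mhat n ω t - m₀ t| ≤ η ∧ |derivWithin (mhat n ω) D t - derivWithin m₀ D t| ≤ η} := by
    intro η hη
    refine whp_of_forall_const hlarge fun C hC => ?_
    obtain ⟨τ, hτ, hw⟩ := whp_consistency hθ₀ hA0 hA1 hA2 hA3 hA4 hP1 hlaw hindep hC hη
    refine ((hSw.inter (hsmall τ hτ)).inter hw).mono (eventually_atTop.2 ⟨1, fun n hn => ?_⟩)
    rintro ω ⟨⟨⟨s1, s2, s3⟩, hτω⟩, hω⟩
    by_cases hE : |(lam n ω)⁻¹| ≤ C * (n : ℝ) ^ (2 / 5 : ℝ)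
    · exact Or.inr ⟨s3 n hn, hω (fun i => y i ω) _ _ _ s1 s2 (hlam0 n ω) hE hτω (s3 n hn)⟩
    · exact Or.inl hE
  refine ⟨fun ε hε => ?_, fun δ hδ => ?_, fun δ hδ => ?_⟩
  · obtain ⟨η, hη, hηε⟩ : ∃ η : ℝ, 0 < η ∧ ENNReal.ofReal η ≤ ε := by
      obtain ⟨r, hr, hrε⟩ := ENNReal.lt_iff_exists_nnreal_btwn.1 hε
      exact ⟨r, by exact_mod_cast hr, by rw [ENNReal.ofReal_coe_nnreal]; exact hrε.le⟩
    have hw : Whp P fun n => {ω | ε ≤ edist (θhat n ω) θ₀}ᶜ := by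
      refine (hcons η hη).mono (Eventually.of_forall fun n ω hω hle => ?_)
      have h1 : edist (θhat n ω) θ₀ < ENNReal.ofReal η := by
        rw [edist_dist, dist_eq_norm]
        exact (ENNReal.ofReal_lt_ofReal_iff hη).2 hω.2.1
      exact (h1.trans_le hηε).not_ge hle
    simpa only [Whp, compl_compl] using hw
  · have hδ' : (0 : ℝ) < δ := hδ
    have hw : Whp P fun n => {ω | (δ : ℝ≥0∞) * ENNReal.ofReal 1 ≤
        sobolevNorm D (domAt (supp ν) θ₀) (fun t => mhat n ω t - m₀ t)}ᶜ := by
      refine (hcons (δ / 3) (by positivity)).mono (Eventually.of_forall fun n ω hω hle => ?_)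
      obtain ⟨hest, -, hclose⟩ := hω
      have h1 : supNorm (domAt (supp ν) θ₀) (fun t => mhat n ω t - m₀ t) ≤
          ENNReal.ofReal (δ / 3) := supNorm_le fun t ht => (hclose t ht).1
      have h2 : supNorm (domAt (supp ν) θ₀) (derivWithin (fun t => mhat n ω t - m₀ t) D) ≤
          ENNReal.ofReal (δ / 3) := supNorm_le fun t ht => by
        have htD : t ∈ D := by
          obtain ⟨u, hu, rfl⟩ := ht
          exact inner_mem_dom hθ₀ hu
        rw [derivWithin_fun_sub (hest.1.2.1 t htD) (hP1.1.2.1 t htD)]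
        exact (hclose t ht).2
      have h3 := hle.trans (add_le_add h1 h2)
      rw [← ENNReal.ofReal_add (by positivity) (by positivity), ENNReal.ofReal_one, mul_one,
        ← ENNReal.ofReal_coe_nnreal, ENNReal.ofReal_le_ofReal_iff (by positivity)] at h3
      linarith
    simpa only [Whp, compl_compl] using hw
  · have hδ2 : 0 < δ / 2 := ENNReal.half_pos hδ.ne'
    obtain ⟨C, hC0, hC⟩ := hlarge (δ / 2) hδ2
    obtain ⟨K, hK, hw⟩ := whp_estimator_bounds hA1 hA2 hA4 hP1 hθ₀ hlaw hindep hC0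
    refine ⟨K.toNNReal, ?_⟩
    have hw' := (hSw.inter (hsmall 1 one_pos)).inter hw
    filter_upwards [hC, ENNReal.tendsto_nhds_zero.1 hw' (δ / 2) hδ2, eventually_ge_atTop 1]
      with n h1 h2 hn
    refine le_trans (measure_mono fun ω hω => ?_) ((measure_union_le _ _).trans
      ((add_le_add h1 h2).trans_eq (ENNReal.add_halves δ)))
    by_contra hcon
    simp only [mem_union, mem_compl_iff, not_or, not_not] at hcon
    obtain ⟨hE, ⟨⟨s1, s2, s3⟩, hτω⟩, hb⟩ := hcon
    have h3 := (hb (fun i => y i ω) _ _ _ s1 s2 (hlam0 n ω) hE hτω (s3 n hn)).2.1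
    have h4 : supNorm D (derivWithin (mhat n ω) D) ≤ ENNReal.ofReal K :=
      supNorm_le fun t ht => (h3 t ht).2
    simp only [mem_ofPred_eq, ENNReal.ofReal_one, mul_one] at hω
    exact hω.not_ge h4
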